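/- Let $n\ge 2$ and $1\le k\le n-1$. Let $S\subset\mathbb R^n$ be a smooth ($C^\infty$, embedded) $k$-dimensional surface with induced surface measure $\sigma$, let $a$ be a complex-valued $C^\infty$ function on $S$ with compact support in $S$, and let $\mu=a\,d\sigma$. For $\theta\in SO(n)$ let $\mu_\theta$ be the rotated measure given by $\langle g,\mu_\theta\rangle=\langle g(\theta^{-1}\cdot),\mu\rangle$, so that $$f*\mu_\theta(x)=\int_S f(x-\theta^{-1}y)\,a(y)\,d\sigma(y),$$ and let $d\theta$ be the normalized Haar measure on $SO(n)$. Then there is a constant $C$, depending only on $n$, $k$, $S$ and $a$, such that for every $f\in L^{\frac{2n-k}{n}}(\mathbb R^n)$ the integral defining $f*\mu_\theta(x)$ converges absolutely for every $\theta$ and almost every $x$, the function $(x,\theta)\mapsto f*\mu_\theta(x)$ belongs to $L^{\frac{2n-k}{n-k}}(\mathbb R^n\times SO(n))$, and $$\Bigl(\int_{SO(n)}\int_{\mathbb R^n}|f*\mu_\theta(x)|^{\frac{2n-k}{n-k}}\,dx\,d\theta\Bigr)^{\frac{n-k}{2n-k}}\le C\Bigl(\int_{\mathbb R^n}|f(y)|^{\frac{2n-k}{n}}\,dy\Bigr)^{\frac{n}{2n-k}}.$$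 -/

import Mathlib

open MeasureTheory Set
open scoped ContDiff ENNReal NNReal

noncomputable section

/-- Euclidean `n`-space. -/
abbrev E (n : ℕ) : Type := EuclideanSpace ℝ (Fin n)

/-! ### The rotation group with its Haar measure -/

/-- The rotation group `SO(n)`, with the subspace topology inherited from real `n × n` matrices. -/
abbrev SO (n : ℕ) : Type := Matrix.specialOrthogonalGroup (Fin n) ℝ

theorem SO.mem_iff {n : ℕ} {A : Matrix (Fin n) (Fin n) ℝ} :
    A ∈ Matrix.specialOrthogonalGroup (Fin n) ℝ ↔ A * A.transpose = 1 ∧ A.det = 1 := by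
  rw [Matrix.mem_specialOrthogonalGroup_iff, Matrix.mem_orthogonalGroup_iff]

theorem SO.coe_inv {n : ℕ} (θ : SO n) : (θ⁻¹ : SO n).1 = θ.1.transpose := rfl

instance SO.instIsTopologicalGroup (n : ℕ) : IsTopologicalGroup (SO n) where
  continuous_mul := by
    refine Continuous.subtype_mk ?_ _
    exact (continuous_subtype_val.comp continuous_fst).mul
      (continuous_subtype_val.comp continuous_snd)
  continuous_inv := by
    refine Continuous.subtype_mk ?_ _
    exact continuous_subtype_val.matrix_transpose

instance SO.instCompactSpace (n : ℕ) : CompactSpace (SO n) := by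
  apply isCompact_iff_compactSpace.mp
  have hclosed : IsClosed
      (Matrix.specialOrthogonalGroup (Fin n) ℝ : Set (Matrix (Fin n) (Fin n) ℝ)) := by
    have h : (Matrix.specialOrthogonalGroup (Fin n) ℝ : Set (Matrix (Fin n) (Fin n) ℝ)) =
        {A | A * A.transpose = 1} ∩ {A | A.det = 1} := by
      ext A; exact SO.mem_iff
    rw [h]
    exact (isClosed_eq (continuous_id.matrix_mul continuous_id.matrix_transpose)
      continuous_const).inter (isClosed_eq continuous_id.matrix_det continuous_const)
  have hbox : IsCompact (Set.pi univ fun _ : Fin n => Set.pi univ fun _ : Fin n =>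
      Set.Icc (-1 : ℝ) 1) :=
    isCompact_univ_pi fun _ => isCompact_univ_pi fun _ => isCompact_Icc
  refine IsCompact.of_isClosed_subset (s := (Set.pi univ fun _ : Fin n =>
    Set.pi univ fun _ : Fin n => Set.Icc (-1 : ℝ) 1)) hbox hclosed ?_
  intro A hA i _ j _
  have h := congrFun (congrFun (SO.mem_iff.mp hA).1 i) i
  replace h : ∑ l, A i l * A i l = 1 :=
    (Matrix.mul_apply (M := A) (N := Matrix.transpose A)).symm.trans
      (h.trans (Matrix.one_apply_eq i))
  have hle : A i j * A i j ≤ ∑ l, A i l * A i l :=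
    Finset.single_le_sum (f := fun l => A i l * A i l)
      (fun l _ => mul_self_nonneg _) (Finset.mem_univ j)
  exact ⟨by nlinarith, by nlinarith⟩

instance SO.instMeasurableSpace (n : ℕ) : MeasurableSpace (SO n) := borel _

instance SO.instBorelSpace (n : ℕ) : BorelSpace (SO n) := ⟨rfl⟩

/-- The Haar measure on `SO(n)` of total mass `1`. -/
def rotationMeasure (n : ℕ) : Measure (SO n) := Measure.haarMeasure ⊤

/-- The action of a rotation on a vector. -/
def rotate {n : ℕ} (θ : SO n) (x : E n) : E n := Matrix.toEuclideanLin θ.1 x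

/-! ### Smooth surfaces and smooth multiples of surface measure -/

/-- `S` is a smooth `k`-dimensional surface (embedded `C^∞` submanifold) in `ℝⁿ`: near each of its
points, it is the image of an open subset of `ℝᵏ` under a smooth immersion which is a
homeomorphism onto its image. -/
def IsSmoothSurface {n : ℕ} (k : ℕ) (S : Set (E n)) : Prop :=
  ∀ p ∈ S, ∃ (V : Set (E n)) (U : Set (E k)) (Φ : E k → E n),
    IsOpen V ∧ p ∈ V ∧ IsOpen U ∧ ContDiffOn ℝ ∞ Φ U ∧
    (∀ u ∈ U, Function.Injective (fderiv ℝ Φ u)) ∧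
    Topology.IsEmbedding (fun u : U => Φ u) ∧ Φ '' U = S ∩ V

/-- `a` is smooth on `S`, with compact support contained in `S`. Values off `S` play no role. -/
def IsSmoothDensity {n : ℕ} (S : Set (E n)) (a : E n → ℂ) : Prop :=
  ContDiffOn ℝ ∞ a S ∧ ∃ K : Set (E n), IsCompact K ∧ K ⊆ S ∧ ∀ x ∈ S \ K, a x = 0

/-- Induced surface measure on a `k`-dimensional surface `S`: the `k`-dimensional Hausdorff measure
on `S`, normalized so as to agree with Lebesgue measure on `ℝᵏ`. -/
def surfaceMeasure {n : ℕ} (k : ℕ) (S : Set (E n)) : Measure (E n) :=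
  (Measure.euclideanHausdorffMeasure k).restrict S

/-- The pairing `⟨g, μ⟩` with the (complex) measure `μ = a dσ`, `σ` the surface measure on `S`. -/
def pairing {n : ℕ} (k : ℕ) (S : Set (E n)) (a : E n → ℂ) (g : E n → ℂ) : ℂ :=
  ∫ y, g y * a y ∂(surfaceMeasure k S)

/-- The pairing with the rotated measure: `⟨g, μ_θ⟩ = ⟨g(θ⁻¹ ·), μ⟩`. -/
def rotatedPairing {n : ℕ} (k : ℕ) (S : Set (E n)) (a : E n → ℂ) (θ : SO n) (g : E n → ℂ) : ℂ :=
  pairing k S a fun y => g (rotate θ⁻¹ y)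

/-- The convolution `(f * μ_θ)(x) = ⟨f(x - ·), μ_θ⟩`. -/
def rotatedConv {n : ℕ} (k : ℕ) (S : Set (E n)) (a : E n → ℂ) (f : E n → ℂ) (x : E n)
    (θ : SO n) : ℂ :=
  rotatedPairing k S a θ fun y => f (x - y)

end

/-!
The surface is cut into finitely many patches, each contained in the graph of a map `ψ` from the
tangent plane `ℝᵏ` to the normal space `ℝᵐ`, `m = n - k`, with a Lipschitz constant as small as
desired (`IsSmoothSurface.exists_graphDensity`). Since the Hausdorff measure of a Lipschitz image is
controlled by the Hausdorff measure of the domain (`GraphDensity.restrict_le`), surface measure on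
a patch is dominated by the image of a smooth compactly supported density `χ du` on `ℝᵏ`. As only
upper bounds are claimed, it suffices to bound the averages of nonnegative functions over the
rotations of such a patch.

The bound for a patch is complex interpolation in the manner of Stein. In coordinates `(u, v)` on
`ℝᵏ × ℝᵐ` adapted to the patch, the measure is replaced by the kernels `χ u * κ_w (v - ψ u)`, where
`κ_w` is an analytic family built from dyadic dilates of a bounded function `Ψ` which has integral
`1`, vanishing moments, and support in an annulus (`exists_moment_kernel`, `dyadicKernel`). It plays
the role of the family of Riesz kernels `|v| ^ (w - m)`, but all its members are bounded with compact
support, and at `w = 0` it equals `Ψ` rescaled to the scale `2 ^ (-J)`, which approximates the delta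
function. The bounds below do not depend on `J`.

* On `re w = m` the kernels are bounded (`norm_dyadicKernel_le`), which gives `L¹ → L^∞`.
* On `re w = -k / 2` the Fourier transform of `κ_w` grows at most like `|η| ^ (k / 2)`
  (`exists_norm_fourier_dyadicKernel_sq_le`). By Plancherel, the `L² → L²` bound over the product of
  `ℝⁿ` and `SO(n)` only involves the mean square over rotations of the Fourier transform of the
  kernel (`lintegral_rotConv_sq_le`). So the growth is compensated by the average decay of the
  Fourier transform of the patch: its mean square over the rotations of a frequency `ξ` is
  `O(|ξ| ^ (-k))`, whatever the curvature of the patch (`GraphDensity.exists_average_decay`).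

The average decay rests on nonstationary phase. A rotated frequency with a large normal
coordinate is rotated further in a plane spanned by a tangent and a normal coordinate direction, which is
permitted by the invariance of Haar measure. Expanding the square, the average over these rotations
of the character at `x - x'`, with `x` and `x'` on the patch over the points `u` and `u'`, is
`O((1 + |ξ| |u - u'|) ^ (-(k + 1)))`, because `x - x'` is almost tangent; the integral of this over
`u` is `O(|ξ| ^ (-k))`. For the remaining frequencies, which have a large tangential coordinate, the
phase has no critical point along that coordinate in the patch, and the Fourier transform itself
decays rapidly.

The point `w = 0` divides the strip in the ratio that gives the exponents `(2n - k) / n` and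
`(2n - k) / (n - k)`, which are conjugate; the three lines theorem is applied to the trilinear form
tested on the extremal function of the duality (`lintegral_rotConv_rpow_le`). Letting the scale
tend to zero gives the bound for continuous functions by Fatou's lemma, and then for all functions
by density (`GraphDensity.exists_lintegral_average_le`).
-/

noncomputable section

/-! ### Nonstationary phase -/

section NonstationaryPhase

/-- A modulated amplitude is continuous as soon as the phase is continuous near the support of the
amplitude. -/
theorem continuous_cexp_mul_of_tsupport_subset {Z : Type*} [TopologicalSpace Z] {Ω : Set Z}
    (hΩ : IsOpen Ω) {φ X : Z → ℝ} (hφ : ContinuousOn φ Ω) (hX : Continuous X)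
    (hsub : tsupport X ⊆ Ω) (s : ℝ) :
    Continuous fun z => Complex.exp (Complex.I * (s * φ z)) * (X z : ℂ) := by
  rw [continuous_iff_continuousAt]
  intro z
  by_cases hz : z ∈ tsupport X
  · have h1 : ContinuousAt φ z := hφ.continuousAt (hΩ.mem_nhds (hsub hz))
    have h2 : ContinuousAt X z := hX.continuousAt
    fun_prop
  · have h0 : (fun z => Complex.exp (Complex.I * (s * φ z)) * (X z : ℂ)) =ᶠ[nhds z]
        fun _ => 0 := by
      filter_upwards [notMem_tsupport_iff_eventuallyEq.mp hz] with w hw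
      simp [hw]
    exact (continuousAt_const).congr h0.symm

theorem hasCompactSupport_slice {P : Type*} [NormedAddCommGroup P] {X : P × ℝ → ℝ}
    (hX : HasCompactSupport X) (p : P) :
    HasCompactSupport fun t : ℝ => X (p, t) := by
  have : Isometry fun t : ℝ => (p, t) := fun a b => by simp [Prod.edist_eq]
  exact hX.comp_isClosedEmbedding this.isClosedEmbedding

/-- **Principle of nonstationary phase**, uniform in parameters: if the phase `φ (p, t)` has no
critical point in `t` near the support of the amplitude `X`, then the oscillatory integral in `t`
decays faster than any power of the frequency `s`, uniformly in `p`. -/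
theorem nonstationary_phase {P : Type*} [NormedAddCommGroup P] [NormedSpace ℝ P]
    {Ω : Set (P × ℝ)} (hΩ : IsOpen Ω) {φ : P × ℝ → ℝ}
    (hφ : ContDiffOn ℝ ∞ φ Ω) (hne : ∀ z ∈ Ω, fderiv ℝ φ z (0, 1) ≠ 0) (N : ℕ) :
    ∀ X : P × ℝ → ℝ, ContDiff ℝ ∞ X → HasCompactSupport X → tsupport X ⊆ Ω →
      ∃ C : ℝ, ∀ (p : P) (s : ℝ),
        |s| ^ N * ‖∫ t, Complex.exp (Complex.I * (s * φ (p, t))) * (X (p, t) : ℂ)‖ ≤ C := by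
  induction N with
  | zero =>
    intro X hX hc _
    obtain ⟨M, hM⟩ := hc.exists_bound_of_continuous hX.continuous
    obtain ⟨R, hR⟩ := hc.isCompact.isBounded.exists_norm_le
    refine ⟨M * (2 * |R|), fun p s => ?_⟩
    have hzero : ∀ t ∉ Icc (-|R|) |R|,
        Complex.exp (Complex.I * (s * φ (p, t))) * (X (p, t) : ℂ) = 0 := by
      intro t ht
      have : X (p, t) = 0 := by
        by_contra h
        have h1 := hR (p, t) (subset_tsupport _ h)
        have h2 : |t| ≤ R := (le_max_right ‖p‖ ‖t‖).trans h1
        exact ht (abs_le.mp (h2.trans (le_abs_self R)))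
      simp [this]
    rw [pow_zero, one_mul, ← setIntegral_eq_integral_of_forall_compl_eq_zero hzero]
    refine (norm_setIntegral_le_of_norm_le_const (C := M) (by simp) fun t _ => ?_).trans ?_
    · rw [norm_mul, show Complex.I * (s * φ (p, t)) = ((s * φ (p, t) : ℝ) : ℂ) * Complex.I by
        push_cast; ring, Complex.norm_exp_ofReal_mul_I, one_mul, Complex.norm_real]
      exact hM _
    · have : (0 : ℝ) ≤ |R| := abs_nonneg R
      simp only [measureReal_def, Real.volume_Icc]
      rw [ENNReal.toReal_ofReal (by linarith)]
      exact le_of_eq (by ring)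
  | succ N ih =>
    intro X hX hc hsub
    -- `X = φ_t * Y`, and integration by parts replaces `X` by `-∂_t Y` at the cost of `1 / s`.
    set D : P × ℝ → ℝ := fun z => fderiv ℝ φ z (0, 1) with hD
    set Y : P × ℝ → ℝ := fun z => X z / D z with hY
    have hsuppY : tsupport Y ⊆ tsupport X :=
      closure_mono fun z hz hXz => hz (by simp [hY, hXz])
    have hDs : ∀ z ∈ Ω, ContDiffAt ℝ ∞ D z := fun z hz => by
      have h1 : ContDiffAt ℝ ∞ φ z := hφ.contDiffAt (hΩ.mem_nhds hz)
      exact (h1.fderiv_right (m := ∞) (by simp)).clm_apply contDiffAt_const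
    have hYs : ContDiff ℝ ∞ Y := by
      refine contDiff_iff_contDiffAt.mpr fun z => ?_
      by_cases hz : z ∈ tsupport Y
      · exact hX.contDiffAt.div (hDs z (hsub (hsuppY hz))) (hne z (hsub (hsuppY hz)))
      · exact contDiffAt_const.congr_of_eventuallyEq (notMem_tsupport_iff_eventuallyEq.mp hz)
    have hYc : HasCompactSupport Y := hc.of_isClosed_subset (isClosed_tsupport _) hsuppY
    set X₁ : P × ℝ → ℝ := fun z => fderiv ℝ Y z (0, 1) with hX₁
    have hX₁s : ContDiff ℝ ∞ X₁ :=
      (hYs.fderiv_right (m := ∞) (by simp)).clm_apply contDiff_const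
    have hsupp₁ : tsupport X₁ ⊆ tsupport Y := by
      refine closure_minimal (fun z hz => ?_) (isClosed_tsupport _)
      refine tsupport_fderiv_subset ℝ (subset_tsupport _ ?_)
      intro h0
      exact hz (by simp [hX₁, h0])
    have hX₁c : HasCompactSupport X₁ := hYc.of_isClosed_subset (isClosed_tsupport _) hsupp₁
    obtain ⟨C, hC⟩ := ih X₁ hX₁s hX₁c (hsupp₁.trans (hsuppY.trans hsub))
    refine ⟨C, fun p s => ?_⟩
    have hslice : Continuous fun t : ℝ => (p, t) := by fun_prop
    have hint : ∀ Z : P × ℝ → ℝ, ContDiff ℝ ∞ Z → HasCompactSupport Z → tsupport Z ⊆ Ω →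
        Integrable fun t => Complex.exp (Complex.I * (s * φ (p, t))) * (Z (p, t) : ℂ) := by
      intro Z hZ hZc hZs
      refine Continuous.integrable_of_hasCompactSupport
        ((continuous_cexp_mul_of_tsupport_subset hΩ hφ.continuousOn hZ.continuous hZs s).comp
          hslice) ?_
      have := hasCompactSupport_slice hZc p
      refine this.mono fun t ht hZt => ht ?_
      simp [hZt]
    have hXi := hint X hX hc hsub
    have hYi := hint Y hYs hYc (hsuppY.trans hsub)
    have hX₁i := hint X₁ hX₁s hX₁c (hsupp₁.trans (hsuppY.trans hsub))
    have hderiv : ∀ t, HasDerivAt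
        (fun t => Complex.exp (Complex.I * (s * φ (p, t))) * (Y (p, t) : ℂ))
        (Complex.I * s * (Complex.exp (Complex.I * (s * φ (p, t))) * (X (p, t) : ℂ)) +
          Complex.exp (Complex.I * (s * φ (p, t))) * (X₁ (p, t) : ℂ)) t := by
      intro t
      have hline : HasDerivAt (fun t : ℝ => (p, t)) ((0 : P), (1 : ℝ)) t :=
        (hasDerivAt_const t p).prodMk (hasDerivAt_id t)
      have hYd : HasDerivAt (fun t => Y (p, t)) (X₁ (p, t)) t :=
        ((hYs.differentiable (by simp)).differentiableAt.hasFDerivAt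
          (x := (p, t))).comp_hasDerivAt t hline
      by_cases hz : (p, t) ∈ tsupport X
      · have hφd : HasDerivAt (fun t => φ (p, t)) (D (p, t)) t :=
          (((hφ.contDiffAt (hΩ.mem_nhds (hsub hz))).differentiableAt
            (by simp)).hasFDerivAt).comp_hasDerivAt t hline
        have hXY : (X (p, t) : ℂ) = D (p, t) * Y (p, t) := by
          have : D (p, t) ≠ 0 := hne _ (hsub hz)
          rw [← Complex.ofReal_mul]
          congr 1
          simp only [hY]
          field_simp
        have := (((hφd.ofReal_comp.const_mul (s : ℂ)).const_mul Complex.I).cexp).mul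
          hYd.ofReal_comp
        refine this.congr_deriv ?_
        rw [hXY]
        ring
      · have h0 : ∀ Z : P × ℝ → ℝ, tsupport Z ⊆ tsupport X → Z (p, t) = 0 := fun Z hZ =>
          image_eq_zero_of_notMem_tsupport fun h => hz (hZ h)
        have hev : (fun t => Complex.exp (Complex.I * (s * φ (p, t))) * (Y (p, t) : ℂ))
            =ᶠ[nhds t] fun _ => 0 := by
          have := notMem_tsupport_iff_eventuallyEq.mp fun h => hz (hsuppY h)
          filter_upwards [hslice.continuousAt.eventually this] with t' ht'
          simp [ht']
        rw [h0 X subset_rfl, h0 X₁ (hsupp₁.trans hsuppY)]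
        simpa using (hasDerivAt_const t (0 : ℂ)).congr_of_eventuallyEq hev
    have hzero := integral_eq_zero_of_hasDerivAt_of_integrable hderiv
      ((hXi.const_mul _).add hX₁i) hYi
    rw [integral_add (hXi.const_mul _) hX₁i, integral_const_mul] at hzero
    have hnorm : |s| * ‖∫ t, Complex.exp (Complex.I * (s * φ (p, t))) * (X (p, t) : ℂ)‖ =
        ‖∫ t, Complex.exp (Complex.I * (s * φ (p, t))) * (X₁ (p, t) : ℂ)‖ := by
      rw [← norm_neg (∫ t, Complex.exp (Complex.I * (s * φ (p, t))) * (X₁ (p, t) : ℂ)),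
        ← eq_neg_of_add_eq_zero_left hzero, norm_mul, norm_mul, Complex.norm_I, Complex.norm_real,
        one_mul, Real.norm_eq_abs]
    calc |s| ^ (N + 1) * ‖∫ t, Complex.exp (Complex.I * (s * φ (p, t))) * (X (p, t) : ℂ)‖
        = |s| ^ N * (|s| * ‖∫ t, Complex.exp (Complex.I * (s * φ (p, t))) * (X (p, t) : ℂ)‖) := by
          ring
      _ ≤ C := by rw [hnorm]; exact hC p s

end NonstationaryPhase

/-! ### Cutoffs, the phase of a rotation orbit, and smooth densities on graphs -/

/-- A smooth even cutoff on the line, vanishing for `|x| ≤ c` and equal to `1` for `2 * c ≤ |x|`. -/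
def awayCutoff (c x : ℝ) : ℝ := Real.smoothTransition ((x ^ 2 - c ^ 2) / (3 * c ^ 2))

theorem awayCutoff_nonneg (c x : ℝ) : 0 ≤ awayCutoff c x := Real.smoothTransition.nonneg _

theorem awayCutoff_le_one (c x : ℝ) : awayCutoff c x ≤ 1 := Real.smoothTransition.le_one _

theorem contDiff_awayCutoff (c : ℝ) : ContDiff ℝ ∞ (awayCutoff c) := by
  unfold awayCutoff
  exact Real.smoothTransition.contDiff.comp (by fun_prop)

theorem awayCutoff_eq_one {c x : ℝ} (hc : 0 < c) (hx : 2 * c ≤ |x|) : awayCutoff c x = 1 := by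
  apply Real.smoothTransition.one_of_one_le
  rw [le_div_iff₀ (by positivity), ← sq_abs x]
  nlinarith

theorem le_abs_of_awayCutoff_ne_zero {c x : ℝ} (hc : 0 < c) (hx : awayCutoff c x ≠ 0) :
    c ≤ |x| := by
  by_contra! h
  apply hx
  apply Real.smoothTransition.zero_of_nonpos
  apply div_nonpos_of_nonpos_of_nonneg _ (by positivity)
  rw [← sq_abs x]
  nlinarith [abs_nonneg x]

theorem fderiv_apply_zero_one {P : Type*} [NormedAddCommGroup P] [NormedSpace ℝ P]
    {φ : P × ℝ → ℝ} {p : P} {t d : ℝ} (hφ : DifferentiableAt ℝ φ (p, t))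
    (hd : HasDerivAt (fun t => φ (p, t)) d t) : fderiv ℝ φ (p, t) (0, 1) = d :=
  (hφ.hasFDerivAt.comp_hasDerivAt t ((hasDerivAt_const t p).prodMk (hasDerivAt_id t))).unique hd

/-- Averaging a character over the rotations of a plane: if `(a₁, a₂)` are the coordinates of the
frequency in the plane and `(1, s)` is proportional to those of the position, then the part of
the average where the second coordinate of the rotated frequency is not small decays rapidly,
provided `s` is small. -/
theorem exists_rotation_integral_bound {c : ℝ} (hc : 0 < c) (τ : ContDiffBump (0 : ℝ)) (N : ℕ) :
    ∃ C : ℝ, ∀ a₁ a₂ s l : ℝ, |a₁| ≤ 1 → |a₂| ≤ 1 → |s| ≤ c / 16 →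
      |l| ^ N * ‖∫ t : ℝ, Complex.exp (Complex.I * (l * ((a₁ * Real.cos t - a₂ * Real.sin t) +
        s * (a₁ * Real.sin t + a₂ * Real.cos t) : ℝ))) *
        ((τ t * awayCutoff c (a₁ * Real.sin t + a₂ * Real.cos t) : ℝ) : ℂ)‖ ≤ C := by
  -- parameters `(a₁, a₂, σ)` in the unit ball, with `s = (c / 16) * σ`
  let ρ : ContDiffBump (0 : ℝ × ℝ × ℝ) := ⟨1, 2, one_pos, one_lt_two⟩
  let φ : (ℝ × ℝ × ℝ) × ℝ → ℝ := fun z =>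
    (z.1.1 * Real.cos z.2 - z.1.2.1 * Real.sin z.2) +
      c / 16 * z.1.2.2 * (z.1.1 * Real.sin z.2 + z.1.2.1 * Real.cos z.2)
  let Q : (ℝ × ℝ × ℝ) × ℝ → ℝ := fun z => z.1.1 * Real.sin z.2 + z.1.2.1 * Real.cos z.2
  let X : (ℝ × ℝ × ℝ) × ℝ → ℝ := fun z => ρ z.1 * (τ z.2 * awayCutoff c (Q z))
  have hφ : ContDiff ℝ ∞ φ := by fun_prop
  have hQ : ContDiff ℝ ∞ Q := by fun_prop
  have hX : ContDiff ℝ ∞ X := by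
    have h1 : ContDiff ℝ ∞ fun z : (ℝ × ℝ × ℝ) × ℝ => ρ z.1 := ρ.contDiff.comp contDiff_fst
    have h2 : ContDiff ℝ ∞ fun z : (ℝ × ℝ × ℝ) × ℝ => τ z.2 := τ.contDiff.comp contDiff_snd
    exact h1.mul (h2.mul ((contDiff_awayCutoff c).comp hQ))
  have hsupp : tsupport X ⊆ {z | ‖z.1‖ ≤ 2 ∧ c ≤ |Q z|} ∩ (Metric.closedBall 0 2 ×ˢ
      Metric.closedBall 0 τ.rOut) := by
    refine closure_minimal (fun z hz => ?_) (IsClosed.inter ?_ ?_)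
    · have h1 : ρ z.1 ≠ 0 := left_ne_zero_of_mul hz
      have h2 : τ z.2 ≠ 0 := left_ne_zero_of_mul (right_ne_zero_of_mul hz)
      have h3 := right_ne_zero_of_mul (right_ne_zero_of_mul hz)
      have h4 : z.1 ∈ Metric.ball 0 2 := by
        rw [← ρ.support_eq]; exact h1
      have h5 : z.2 ∈ Metric.ball 0 τ.rOut := by
        rw [← τ.support_eq]; exact h2
      exact ⟨⟨(mem_ball_zero_iff.mp h4).le, le_abs_of_awayCutoff_ne_zero hc h3⟩,
        Metric.ball_subset_closedBall h4, Metric.ball_subset_closedBall h5⟩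
    · exact (isClosed_le continuous_fst.norm continuous_const).inter
        (isClosed_le continuous_const hQ.continuous.abs)
    · exact Metric.isClosed_closedBall.prod Metric.isClosed_closedBall
  have hXc : HasCompactSupport X :=
    HasCompactSupport.of_support_subset_isCompact
      ((isCompact_closedBall _ _).prod (isCompact_closedBall _ _))
      ((subset_tsupport X).trans (hsupp.trans inter_subset_right))
  set Ω : Set ((ℝ × ℝ × ℝ) × ℝ) := {z | fderiv ℝ φ z (0, 1) ≠ 0} with hΩdef
  have hD : Continuous fun z => fderiv ℝ φ z (0, 1) :=
    (hφ.continuous_fderiv (by simp)).clm_apply continuous_const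
  have hΩ : IsOpen Ω := isOpen_ne_fun hD continuous_const
  have hsub : tsupport X ⊆ Ω := by
    rintro ⟨⟨a₁, a₂, σ⟩, t⟩ hz
    obtain ⟨⟨hp, hq⟩, -⟩ := hsupp hz
    simp only [Prod.norm_def, Real.norm_eq_abs, max_le_iff] at hp
    obtain ⟨h1, h2, h3⟩ := hp
    have hd : HasDerivAt (fun t => φ ((a₁, a₂, σ), t))
        (-Q ((a₁, a₂, σ), t) + c / 16 * σ * (a₁ * Real.cos t - a₂ * Real.sin t)) t := by
      have := (((Real.hasDerivAt_cos t).const_mul a₁).sub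
        ((Real.hasDerivAt_sin t).const_mul a₂)).add
        ((((Real.hasDerivAt_sin t).const_mul a₁).add
        ((Real.hasDerivAt_cos t).const_mul a₂)).const_mul (c / 16 * σ))
      refine this.congr_deriv ?_
      simp only [Q]
      ring
    rw [hΩdef, mem_ofPred_eq,
      fderiv_apply_zero_one (hφ.differentiable (by simp)).differentiableAt hd]
    -- the derivative of the phase in `t` is `-Q` plus a term of size at most `c / 2`
    intro h0
    have h4 : |a₁ * Real.cos t - a₂ * Real.sin t| ≤ 4 := by
      calc _ ≤ |a₁ * Real.cos t| + |a₂ * Real.sin t| := abs_sub _ _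
        _ = |a₁| * |Real.cos t| + |a₂| * |Real.sin t| := by rw [abs_mul, abs_mul]
        _ ≤ 2 * 1 + 2 * 1 := by
          gcongr
          · exact Real.abs_cos_le_one t
          · exact Real.abs_sin_le_one t
        _ = 4 := by norm_num
    have h5 : |Q ((a₁, a₂, σ), t)| ≤ c / 16 * 2 * 4 := by
      rw [show Q ((a₁, a₂, σ), t) = c / 16 * σ * (a₁ * Real.cos t - a₂ * Real.sin t) by linarith,
        abs_mul, abs_mul, abs_of_pos (show 0 < c / 16 by positivity)]
      gcongr
    linarith
  obtain ⟨C, hC⟩ := nonstationary_phase hΩ hφ.contDiffOn (fun z hz => hz) N X hX hXc hsub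
  refine ⟨C, fun a₁ a₂ s l h1 h2 h3 => ?_⟩
  have h4 : |s * 16 / c| ≤ 1 := by
    rw [abs_div, abs_mul, abs_of_pos hc, div_le_one hc, abs_of_pos (by norm_num : (0 : ℝ) < 16)]
    linarith
  have hρ : ρ (a₁, a₂, s * 16 / c) = 1 := by
    apply ρ.one_of_mem_closedBall
    rw [mem_closedBall_zero_iff]
    simp only [Prod.norm_def, Real.norm_eq_abs]
    exact max_le h1 (max_le h2 h4)
  have h5 : c / 16 * (s * 16 / c) = s := by field_simp
  simpa only [φ, X, Q, hρ, one_mul, h5] using hC (a₁, a₂, s * 16 / c) l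

/-- The data of a compactly supported smooth density on a piece of a graph over `ℝᵏ` with values
in `ℝᵐ`: the graph of `ψ` over the open set `dom`, on which `ψ` is smooth and `ε`-Lipschitz, with
the density `χ du`. Off `dom`, the values of `ψ` play no role. -/
structure GraphDensity (k m : ℕ) (ε : ℝ) where
  dom : Set (E k)
  ψ : E k → E m
  χ : E k → ℝ
  isOpen_dom : IsOpen dom
  measurable_ψ : Measurable ψ
  contDiffOn_ψ : ContDiffOn ℝ ∞ ψ dom
  norm_ψ_sub_le : ∀ u ∈ dom, ∀ u' ∈ dom, ‖ψ u - ψ u'‖ ≤ ε * ‖u - u'‖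
  contDiff_χ : ContDiff ℝ ∞ χ
  hasCompactSupport_χ : HasCompactSupport χ
  tsupport_χ_subset : tsupport χ ⊆ dom
  χ_nonneg : ∀ u, 0 ≤ χ u

namespace GraphDensity

variable {k m : ℕ} {ε : ℝ} (G : GraphDensity k m ε)

/-- The phase `⟪(ξ', ξ''), (u, ψ u)⟫`. -/
def phase (ξ : E k × E m) (u : E k) : ℝ := inner ℝ ξ.1 u + inner ℝ ξ.2 (G.ψ u)

/-- The Fourier transform of the density `χ du` on the graph. -/
def fourier (ξ : E k × E m) : ℂ :=
  ∫ u, Complex.exp (Complex.I * ((-2 * Real.pi : ℝ) * G.phase ξ u)) * (G.χ u : ℂ)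

theorem integrable_χ : Integrable G.χ :=
  G.contDiff_χ.continuous.integrable_of_hasCompactSupport G.hasCompactSupport_χ

theorem mem_dom_of_χ_ne_zero {u : E k} (h : G.χ u ≠ 0) : u ∈ G.dom :=
  G.tsupport_χ_subset (subset_tsupport _ h)

theorem measurable_phase (ξ : E k × E m) : Measurable (G.phase ξ) := by
  have := G.measurable_ψ
  unfold phase
  fun_prop

/-- Where the frequency `r • η` is not almost orthogonal to `ℝᵏ`, the Fourier transform of the
density decays rapidly. -/
theorem exists_fourier_le_of_le_abs {c : ℝ} (hc : 0 < c) (hε : 8 * ε ≤ c) (i : Fin k) (N : ℕ) :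
    ∃ C : ℝ, ∀ (η : E k × E m) (r : ℝ), ‖η‖ ≤ 1 → 2 * c ≤ |η.1 i| →
      |r| ^ N * ‖G.fourier (r • η)‖ ≤ C := by
  let e : E k := EuclideanSpace.single i 1
  have he : ‖e‖ = 1 := by simp [e]
  let τ : ContDiffBump (0 : ℝ) := ⟨1, 2, one_pos, one_lt_two⟩
  let ρ : ContDiffBump (0 : E k × E m) := ⟨1, 2, one_pos, one_lt_two⟩
  -- parameters `(η, u)`, integration along the line `u + t e`
  let φ : ((E k × E m) × E k) × ℝ → ℝ := fun z =>
    inner ℝ z.1.1.1 (z.2 • e) + inner ℝ z.1.1.2 (G.ψ (z.1.2 + z.2 • e))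
  let A : ((E k × E m) × E k) × ℝ → E k := fun z => z.1.2 + z.2 • e
  let Q : ((E k × E m) × E k) × ℝ → ℝ := fun z => inner ℝ z.1.1.1 e
  have hA : ContDiff ℝ ∞ A := by fun_prop
  have hQ : ContDiff ℝ ∞ Q := contDiff_fst.fst.fst.inner ℝ contDiff_const
  let X : ((E k × E m) × E k) × ℝ → ℝ := fun z =>
    ρ z.1.1 * awayCutoff c (Q z) * (G.χ (A z) * τ.normed volume z.2)
  have hX : ContDiff ℝ ∞ X := by
    have h1 : ContDiff ℝ ∞ fun z : ((E k × E m) × E k) × ℝ => ρ z.1.1 :=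
      ρ.contDiff.comp (contDiff_fst.comp contDiff_fst)
    have h2 : ContDiff ℝ ∞ fun z : ((E k × E m) × E k) × ℝ => τ.normed volume z.2 :=
      τ.contDiff_normed.comp contDiff_snd
    exact (h1.mul ((contDiff_awayCutoff c).comp hQ)).mul ((G.contDiff_χ.comp hA).mul h2)
  obtain ⟨R, hR⟩ := G.hasCompactSupport_χ.isCompact.isBounded.exists_norm_le
  have hτs : ∀ {t : ℝ}, τ.normed volume t ≠ 0 → |t| ≤ 2 := fun {t} ht => by
    have : t ∈ Metric.ball (0 : ℝ) 2 := by
      rw [← τ.support_normed_eq (μ := volume)]; exact ht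
    exact (mem_ball_zero_iff.mp this).le
  let S : Set (((E k × E m) × E k) × ℝ) :=
    {z | ‖z.1.1‖ ≤ 2 ∧ c ≤ |Q z|} ∩ A ⁻¹' tsupport G.χ ∩
      ((Metric.closedBall 0 2 ×ˢ Metric.closedBall 0 (R + 2)) ×ˢ Metric.closedBall 0 2)
  have hsupp : tsupport X ⊆ S := by
    refine closure_minimal (fun z hz => ?_) ((IsClosed.inter ?_ ?_).inter ?_)
    · have h1 : ρ z.1.1 ≠ 0 := left_ne_zero_of_mul (left_ne_zero_of_mul hz)
      have h3 := right_ne_zero_of_mul (left_ne_zero_of_mul hz)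
      have h4 : G.χ (A z) ≠ 0 := left_ne_zero_of_mul (right_ne_zero_of_mul hz)
      have h2 := hτs (right_ne_zero_of_mul (right_ne_zero_of_mul hz))
      have h5 : z.1.1 ∈ Metric.ball 0 2 := by
        rw [← ρ.support_eq]; exact h1
      have h6 := hR _ (subset_tsupport _ h4)
      have h7 : ‖z.1.2‖ ≤ R + 2 := by
        calc ‖z.1.2‖ = ‖A z - z.2 • e‖ := by simp [A]
          _ ≤ ‖A z‖ + ‖z.2 • e‖ := norm_sub_le _ _
          _ ≤ R + 2 := by
            rw [norm_smul, he, mul_one]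
            exact add_le_add h6 h2
      exact ⟨⟨⟨(mem_ball_zero_iff.mp h5).le, le_abs_of_awayCutoff_ne_zero hc h3⟩,
        subset_tsupport _ h4⟩, ⟨Metric.ball_subset_closedBall h5,
        mem_closedBall_zero_iff.mpr h7⟩, mem_closedBall_zero_iff.mpr h2⟩
    · exact (isClosed_le continuous_fst.fst.norm continuous_const).inter
        (isClosed_le continuous_const hQ.continuous.abs)
    · exact (isClosed_tsupport _).preimage hA.continuous
    · exact (Metric.isClosed_closedBall.prod Metric.isClosed_closedBall).prod
        Metric.isClosed_closedBall
  have hXc : HasCompactSupport X :=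
    HasCompactSupport.of_support_subset_isCompact
      (((isCompact_closedBall _ _).prod (isCompact_closedBall _ _)).prod (isCompact_closedBall _ _))
      ((subset_tsupport X).trans (hsupp.trans inter_subset_right))
  have hAo : IsOpen (A ⁻¹' G.dom) := G.isOpen_dom.preimage hA.continuous
  have hφ : ContDiffOn ℝ ∞ φ (A ⁻¹' G.dom) := by
    have h1 : ContDiffOn ℝ ∞ (fun z => G.ψ (A z)) (A ⁻¹' G.dom) :=
      G.contDiffOn_ψ.comp hA.contDiffOn fun z hz => hz
    have h2 : ContDiff ℝ ∞ fun z : ((E k × E m) × E k) × ℝ => inner ℝ z.1.1.1 (z.2 • e) :=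
      contDiff_fst.fst.fst.inner ℝ (by fun_prop)
    exact h2.contDiffOn.add (contDiff_fst.fst.snd.contDiffOn.inner ℝ h1)
  set Ω : Set (((E k × E m) × E k) × ℝ) := A ⁻¹' G.dom ∩ {z | fderiv ℝ φ z (0, 1) ≠ 0} with hΩdef
  have hΩ : IsOpen Ω :=
    ((hφ.continuousOn_fderiv_of_isOpen hAo (by simp)).clm_apply
      continuousOn_const).isOpen_inter_preimage hAo isOpen_ne
  have hSΩ : S ⊆ Ω := by
    rintro ⟨⟨η, u⟩, t⟩ ⟨⟨⟨hη, hq⟩, hs⟩, -⟩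
    have hdom : u + t • e ∈ G.dom := G.tsupport_χ_subset hs
    refine ⟨hdom, ?_⟩
    have hψ : DifferentiableAt ℝ G.ψ (u + t • e) :=
      (G.contDiffOn_ψ.contDiffAt (G.isOpen_dom.mem_nhds hdom)).differentiableAt (by simp)
    have hφd : DifferentiableAt ℝ φ ((η, u), t) :=
      (hφ.contDiffAt (hAo.mem_nhds hdom)).differentiableAt (by simp)
    have hline : HasDerivAt (fun t : ℝ => u + t • e) e t := by
      simpa using ((hasDerivAt_id t).smul_const e).const_add u
    have hte : HasDerivAt (fun t : ℝ => t • e) e t := by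
      simpa using (hasDerivAt_id t).smul_const e
    have hd : HasDerivAt (fun t => φ ((η, u), t))
        (inner ℝ η.1 e + inner ℝ η.2 (fderiv ℝ G.ψ (u + t • e) e)) t := by
      have h1 := (hasDerivAt_const t η.1).inner ℝ hte
      have h2 := (hasDerivAt_const t η.2).inner ℝ (hψ.hasFDerivAt.comp_hasDerivAt t hline)
      refine (h1.add h2).congr_deriv ?_
      simp
    rw [mem_ofPred_eq, fderiv_apply_zero_one hφd hd]
    intro h0
    have hε0 : 0 ≤ ε ∨ ε < 0 := le_or_gt 0 ε
    have hlip : ‖fderiv ℝ G.ψ (u + t • e)‖ ≤ max ε 0 := by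
      have := norm_fderiv_le_of_lip' ℝ (f := G.ψ) (x₀ := u + t • e) (C := max ε 0)
        (le_max_right _ _) ?_
      · exact this
      · filter_upwards [G.isOpen_dom.mem_nhds hdom] with x hx
        exact (G.norm_ψ_sub_le _ hx _ hdom).trans
          (mul_le_mul_of_nonneg_right (le_max_left _ _) (norm_nonneg _))
    have h1 : |inner ℝ η.2 (fderiv ℝ G.ψ (u + t • e) e)| ≤ 2 * max ε 0 := by
      calc _ ≤ ‖η.2‖ * ‖fderiv ℝ G.ψ (u + t • e) e‖ := abs_real_inner_le_norm _ _
        _ ≤ 2 * (max ε 0 * 1) := by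
          refine mul_le_mul ((norm_snd_le η).trans hη) ?_ (norm_nonneg _) zero_le_two
          rw [← he]
          exact (ContinuousLinearMap.le_opNorm _ _).trans
            (mul_le_mul_of_nonneg_right hlip (norm_nonneg _))
        _ = 2 * max ε 0 := by ring
    have h2 : c ≤ |inner ℝ η.1 e| := hq
    rw [eq_neg_of_add_eq_zero_left h0, abs_neg] at h2
    rcases max_cases ε 0 with h | h <;> linarith
  have hφΩ : ContDiffOn ℝ ∞ φ Ω := hφ.mono inter_subset_left
  obtain ⟨C, hC⟩ := nonstationary_phase hΩ hφΩ (fun z hz => hz.2) N X hX hXc (hsupp.trans hSΩ)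
  have hC0 : 0 ≤ C := le_trans (by positivity) (hC 0 0)
  let V : ℝ := (volume : Measure (E k)).real (Metric.closedBall 0 (R + 2))
  refine ⟨(2 * Real.pi)⁻¹ ^ N * C * V, fun η r hη hηi => ?_⟩
  set l : ℝ := -2 * Real.pi * r with hl
  have hρ : ρ η = 1 := ρ.one_of_mem_closedBall (mem_closedBall_zero_iff.mpr hη)
  have hκ : awayCutoff c (inner ℝ η.1 e) = 1 := by
    apply awayCutoff_eq_one hc
    rwa [show inner ℝ η.1 e = η.1 i by simp [e, EuclideanSpace.inner_single_right]]
  let F : E k → ℂ := fun u =>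
    Complex.exp (Complex.I * ((-2 * Real.pi : ℝ) * G.phase (r • η) u)) * (G.χ u : ℂ)
  have hFm : Measurable F := by
    have := G.measurable_phase (r • η)
    have := G.contDiff_χ.continuous.measurable
    fun_prop
  have hnormF : ∀ u, ‖F u‖ = G.χ u := fun u => by
    simp only [F]
    rw [norm_mul, mul_comm Complex.I, ← Complex.ofReal_mul, Complex.norm_exp_ofReal_mul_I, one_mul,
      Complex.norm_real, Real.norm_of_nonneg (G.χ_nonneg u)]
  have hFi : Integrable F := by
    refine G.integrable_χ.mono' hFm.aestronglyMeasurable (Filter.Eventually.of_forall fun u => ?_)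
    rw [hnormF]
  -- translation invariance lets the integral be averaged along the direction `e`
  have hτ1 : ∫ t, τ.normed volume t = 1 := τ.integral_normed
  have hFub : ∫ u, F u = ∫ u, ∫ t, (τ.normed volume t : ℂ) * F (u + t • e) := by
    have hi : Integrable (fun z : ℝ × E k => (τ.normed volume z.1 : ℂ) * F z.2)
        (volume.prod volume) :=
      (τ.integrable_normed.ofReal (𝕜 := ℂ)).mul_prod hFi
    have hmp : MeasurePreserving (fun z : ℝ × E k => (z.1, z.2 + z.1 • e))
        (volume.prod volume) (volume.prod volume) := by
      refine MeasurePreserving.skew_product (f := id) (MeasurePreserving.id _)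
        (g := fun t u => u + t • e) (by fun_prop) (Filter.Eventually.of_forall fun t => ?_)
      exact (measurePreserving_add_right volume (t • e)).map_eq
    have hi' : Integrable (fun z : ℝ × E k => (τ.normed volume z.1 : ℂ) * F (z.2 + z.1 • e))
        (volume.prod volume) := hmp.integrable_comp_of_integrable hi
    rw [← integral_integral_swap (f := fun (t : ℝ) (u : E k) =>
      (τ.normed volume t : ℂ) * F (u + t • e)) hi']
    simp_rw [integral_const_mul, integral_add_right_eq_self]
    rw [integral_mul_const, integral_complex_ofReal, hτ1]
    simp
  have hinner : ∀ u, ∫ t, (τ.normed volume t : ℂ) * F (u + t • e) =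
      Complex.exp (Complex.I * (l * inner ℝ η.1 u)) *
        ∫ t, Complex.exp (Complex.I * (l * φ ((η, u), t))) * (X ((η, u), t) : ℂ) := by
    intro u
    rw [← integral_const_mul]
    congr 1
    ext t
    have : Complex.exp (Complex.I * ((-2 * Real.pi : ℝ) * G.phase (r • η) (u + t • e))) =
        Complex.exp (Complex.I * (l * inner ℝ η.1 u)) *
          Complex.exp (Complex.I * (l * φ ((η, u), t))) := by
      rw [← Complex.exp_add]
      congr 1
      simp only [phase, φ, hl, Prod.smul_fst, Prod.smul_snd, real_inner_smul_left, inner_add_right]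
      push_cast
      ring
    simp only [F, X, Q, A, hρ, hκ]
    rw [this]
    push_cast
    ring
  have hbound : ∀ u, |r| ^ N * ‖∫ t, (τ.normed volume t : ℂ) * F (u + t • e)‖ ≤
      (Metric.closedBall (0 : E k) (R + 2)).indicator (fun _ => (2 * Real.pi)⁻¹ ^ N * C) u := by
    intro u
    by_cases hu : u ∈ Metric.closedBall (0 : E k) (R + 2)
    · rw [indicator_of_mem hu, hinner, norm_mul, mul_comm Complex.I, ← Complex.ofReal_mul,
        Complex.norm_exp_ofReal_mul_I, one_mul]
      have := hC (η, u) l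
      rw [hl, abs_mul, abs_mul, abs_neg, abs_two, abs_of_pos Real.pi_pos, mul_pow, ← hl] at this
      rw [inv_pow, ← div_eq_inv_mul, le_div_iff₀' (by positivity), ← mul_assoc]
      exact this
    · rw [indicator_of_notMem hu]
      have : ∀ t, (τ.normed volume t : ℂ) * F (u + t • e) = 0 := by
        intro t
        by_contra h
        have h1 : τ.normed volume t ≠ 0 := fun h' => h (by simp [h'])
        have h2 : G.χ (u + t • e) ≠ 0 := fun h' => h (by simp [F, h'])
        apply hu
        rw [mem_closedBall_zero_iff]
        calc ‖u‖ = ‖(u + t • e) - t • e‖ := by simp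
          _ ≤ ‖u + t • e‖ + ‖t • e‖ := norm_sub_le _ _
          _ ≤ R + 2 := by
            rw [norm_smul, he, mul_one]
            exact add_le_add (hR _ (subset_tsupport _ h2)) (hτs h1)
      simp [this]
  have hfour : G.fourier (r • η) = ∫ u, F u := rfl
  rw [hfour, hFub]
  calc |r| ^ N * ‖∫ u, ∫ t, (τ.normed volume t : ℂ) * F (u + t • e)‖
      ≤ |r| ^ N * ∫ u, ‖∫ t, (τ.normed volume t : ℂ) * F (u + t • e)‖ :=
        mul_le_mul_of_nonneg_left (norm_integral_le_integral_norm _) (by positivity)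
    _ = ∫ u, |r| ^ N * ‖∫ t, (τ.normed volume t : ℂ) * F (u + t • e)‖ := by
        rw [integral_const_mul]
    _ ≤ ∫ u, (Metric.closedBall (0 : E k) (R + 2)).indicator
          (fun _ => (2 * Real.pi)⁻¹ ^ N * C) u := by
        refine integral_mono_of_nonneg (Filter.Eventually.of_forall fun u => by positivity) ?_
          (Filter.Eventually.of_forall hbound)
        exact (integrable_indicator_iff measurableSet_closedBall).mpr
          (integrableOn_const (measure_closedBall_lt_top.ne))
    _ = (2 * Real.pi)⁻¹ ^ N * C * V := by
        rw [integral_indicator_const _ measurableSet_closedBall, smul_eq_mul, mul_comm]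

end GraphDensity

/-! ### The action of `SO(n)` and its plane rotations -/

section Rotations

variable {n : ℕ}

theorem rotate_apply (θ : SO n) (x : E n) (i : Fin n) :
    rotate θ x i = ∑ j, θ.1 i j * x j := by
  simp [rotate, Matrix.toLpLin_apply, Matrix.mulVec, dotProduct]

theorem rotate_mul (θ₁ θ₂ : SO n) (x : E n) : rotate (θ₁ * θ₂) x = rotate θ₁ (rotate θ₂ x) := by
  simp [rotate, Matrix.toLpLin_apply, Matrix.mulVec_mulVec]

@[simp] theorem rotate_one (x : E n) : rotate (1 : SO n) x = x := by
  simp [rotate]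

@[simp] theorem rotate_inv_rotate (θ : SO n) (x : E n) : rotate θ⁻¹ (rotate θ x) = x := by
  rw [← rotate_mul]; simp

@[simp] theorem rotate_rotate_inv (θ : SO n) (x : E n) : rotate θ (rotate θ⁻¹ x) = x := by
  rw [← rotate_mul]; simp

theorem inner_rotate_left (θ : SO n) (x y : E n) :
    inner ℝ (rotate θ x) y = inner ℝ x (rotate θ⁻¹ y) := by
  simp only [PiLp.inner_apply, rotate_apply, SO.coe_inv, Matrix.transpose_apply]
  simp only [RCLike.inner_apply, conj_trivial, Finset.mul_sum, Finset.sum_mul]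
  rw [Finset.sum_comm]
  refine Finset.sum_congr rfl fun i _ => Finset.sum_congr rfl fun j _ => by ring

theorem norm_rotate (θ : SO n) (x : E n) : ‖rotate θ x‖ = ‖x‖ := by
  have : ‖rotate θ x‖ ^ 2 = ‖x‖ ^ 2 := by
    rw [← real_inner_self_eq_norm_sq, ← real_inner_self_eq_norm_sq, inner_rotate_left,
      rotate_inv_rotate]
  exact (pow_left_inj₀ (norm_nonneg _) (norm_nonneg _) two_ne_zero).mp this

/-- A rotation as a linear isometric automorphism of `ℝⁿ`. -/
def rotateₗᵢ (θ : SO n) : E n ≃ₗᵢ[ℝ] E n where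
  toFun := rotate θ
  invFun := rotate θ⁻¹
  map_add' := (Matrix.toEuclideanLin θ.1).map_add
  map_smul' := (Matrix.toEuclideanLin θ.1).map_smul
  left_inv := rotate_inv_rotate θ
  right_inv := rotate_rotate_inv θ
  norm_map' := norm_rotate θ

theorem rotate_smul (θ : SO n) (c : ℝ) (x : E n) : rotate θ (c • x) = c • rotate θ x :=
  (rotateₗᵢ θ).map_smul c x

theorem continuous_rotate : Continuous fun z : SO n × E n => rotate z.1 z.2 := by
  have : (fun z : SO n × E n => rotate z.1 z.2) =
      fun z => WithLp.toLp 2 fun i => ∑ j, z.1.1 i j * z.2 j := by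
    ext z i
    exact rotate_apply _ _ _
  rw [this]
  have hentry : ∀ i j, Continuous fun z : SO n × E n => z.1.1 i j * z.2 j := fun i j => by
    have h1 : Continuous fun z : SO n × E n => z.1.1 i j :=
      (continuous_subtype_val.comp continuous_fst).matrix_elem i j
    have h2 : Continuous fun z : SO n × E n => z.2 j :=
      (PiLp.continuous_apply 2 (fun _ : Fin n => ℝ) j).comp continuous_snd
    exact h1.mul h2
  have hpi : Continuous fun (z : SO n × E n) (i : Fin n) => ∑ j, z.1.1 i j * z.2 j :=
    continuous_pi fun i => continuous_finsetSum _ fun j _ => hentry i j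
  exact (PiLp.continuous_toLp 2 (fun _ : Fin n => ℝ)).comp hpi

instance SO.instSecondCountableTopology : SecondCountableTopology (SO n) := by
  have : SecondCountableTopology (Matrix (Fin n) (Fin n) ℝ) :=
    inferInstanceAs (SecondCountableTopology (Fin n → Fin n → ℝ))
  exact TopologicalSpace.Subtype.secondCountableTopology _

instance rotationMeasure.instIsMulLeftInvariant : (rotationMeasure n).IsMulLeftInvariant :=
  inferInstanceAs (Measure.haarMeasure ⊤).IsMulLeftInvariant

instance rotationMeasure.instIsProbabilityMeasure : IsProbabilityMeasure (rotationMeasure n) :=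
  ⟨Measure.haarMeasure_self⟩

/-- The matrix of the rotation by the angle `t` in the oriented plane spanned by the orthonormal
vectors `e`, `e'`. -/
def planeRotationMatrix (e e' : E n) (t : ℝ) : Matrix (Fin n) (Fin n) ℝ :=
  1 + (Real.cos t - 1) • (Matrix.vecMulVec e e + Matrix.vecMulVec e' e') +
    Real.sin t • (Matrix.vecMulVec e' e - Matrix.vecMulVec e e')

theorem toEuclideanLin_planeRotationMatrix (e e' : E n) (t : ℝ) (x : E n) :
    Matrix.toEuclideanLin (planeRotationMatrix e e' t) x =
      x + (Real.cos t - 1) • (inner ℝ e x • e + inner ℝ e' x • e') +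
        Real.sin t • (inner ℝ e x • e' - inner ℝ e' x • e) := by
  have h : ∀ v w : E n, Matrix.toEuclideanLin (Matrix.vecMulVec v w) x = inner ℝ w x • v := by
    intro v w
    ext i
    simp [Matrix.toLpLin_apply, Matrix.vecMulVec_mulVec, PiLp.inner_apply, dotProduct,
      mul_comm]
  have h1 : Matrix.toEuclideanLin (1 : Matrix (Fin n) (Fin n) ℝ) x = x := by
    simp
  simp only [planeRotationMatrix, map_add, map_sub, map_smul, LinearMap.add_apply,
    LinearMap.sub_apply, LinearMap.smul_apply, h, h1]

theorem planeRotationMatrix_transpose (e e' : E n) (t : ℝ) :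
    (planeRotationMatrix e e' t).transpose = planeRotationMatrix e e' (-t) := by
  simp only [planeRotationMatrix, Matrix.transpose_add, Matrix.transpose_smul,
    Matrix.transpose_sub, Matrix.transpose_vecMulVec, Matrix.transpose_one, Real.cos_neg,
    Real.sin_neg]
  module

theorem planeRotationMatrix_mul {e e' : E n} (he : ‖e‖ = 1) (he' : ‖e'‖ = 1)
    (h : inner ℝ e e' = 0) (s t : ℝ) :
    planeRotationMatrix e e' s * planeRotationMatrix e e' t = planeRotationMatrix e e' (s + t) := by
  apply Matrix.toEuclideanLin.injective
  ext1 x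
  have hm : Matrix.toEuclideanLin (planeRotationMatrix e e' s * planeRotationMatrix e e' t) x =
      Matrix.toEuclideanLin (planeRotationMatrix e e' s)
        (Matrix.toEuclideanLin (planeRotationMatrix e e' t) x) := by
    simp [Matrix.toLpLin_apply, Matrix.mulVec_mulVec]
  have h1 : inner ℝ e e = (1 : ℝ) := by rw [real_inner_self_eq_norm_sq, he, one_pow]
  have h2 : inner ℝ e' e' = (1 : ℝ) := by rw [real_inner_self_eq_norm_sq, he', one_pow]
  have h3 : inner ℝ e' e = (0 : ℝ) := by rw [real_inner_comm]; exact h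
  rw [hm]
  simp only [toEuclideanLin_planeRotationMatrix, inner_add_right, inner_sub_right,
    real_inner_smul_right, h, h1, h2, h3, Real.cos_add, Real.sin_add]
  module

/-- The rotation by the angle `t` in the oriented plane spanned by the orthonormal vectors
`e`, `e'`. Its determinant is `1` because it is the square of the rotation by `t / 2`. -/
def planeRotation {e e' : E n} (he : ‖e‖ = 1) (he' : ‖e'‖ = 1) (h : inner ℝ e e' = 0) (t : ℝ) :
    SO n := by
  have horth : ∀ s, planeRotationMatrix e e' s * (planeRotationMatrix e e' s).transpose = 1 := by
    intro s
    rw [planeRotationMatrix_transpose, planeRotationMatrix_mul he he' h]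
    simp [planeRotationMatrix]
  refine ⟨planeRotationMatrix e e' t, SO.mem_iff.mpr ⟨horth t, ?_⟩⟩
  have h1 := congrArg Matrix.det (horth (t / 2))
  rw [Matrix.det_mul, Matrix.det_transpose, Matrix.det_one, ← Matrix.det_mul,
    planeRotationMatrix_mul he he' h, add_halves] at h1
  exact h1

theorem continuous_planeRotation {e e' : E n} (he : ‖e‖ = 1) (he' : ‖e'‖ = 1)
    (h : inner ℝ e e' = 0) : Continuous (planeRotation he he' h) := by
  refine Continuous.subtype_mk ?_ _
  unfold planeRotationMatrix
  fun_prop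

theorem rotate_planeRotation {e e' : E n} (he : ‖e‖ = 1) (he' : ‖e'‖ = 1)
    (h : inner ℝ e e' = 0) (t : ℝ) (x : E n) :
    rotate (planeRotation he he' h t) x =
      x + (Real.cos t - 1) • (inner ℝ e x • e + inner ℝ e' x • e') +
        Real.sin t • (inner ℝ e x • e' - inner ℝ e' x • e) :=
  toEuclideanLin_planeRotationMatrix e e' t x

/-- By invariance of Haar measure, an average over `SO(n)` may first be averaged along a curve of
rotations. -/
theorem norm_integral_rotationMeasure_le {F : SO n → ℂ} (hF : Continuous F) {R : ℝ → SO n}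
    (hR : Continuous R) (τ : ContDiffBump (0 : ℝ)) {M : ℝ}
    (hM : ∀ θ, ‖∫ t, (τ t : ℂ) * F (R t * θ)‖ ≤ M) :
    (∫ t, τ t) * ‖∫ θ, F θ ∂(rotationMeasure n)‖ ≤ M := by
  have hint : Integrable (fun z : ℝ × SO n => (τ z.1 : ℂ) * F (R z.1 * z.2))
      (volume.prod (rotationMeasure n)) := by
    have hτ : Continuous fun t => τ t := τ.continuous
    refine Continuous.integrable_of_hasCompactSupport (by fun_prop) ?_
    refine HasCompactSupport.of_support_subset_isCompact
      (τ.hasCompactSupport.isCompact.prod (isCompact_univ (X := SO n))) fun z hz => ⟨?_, mem_univ _⟩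
    refine subset_tsupport _ fun h0 => hz ?_
    simp [h0]
  have h1 : ((∫ t, τ t : ℝ) : ℂ) * ∫ θ, F θ ∂(rotationMeasure n) =
      ∫ θ, (∫ t, (τ t : ℂ) * F (R t * θ)) ∂(rotationMeasure n) := by
    rw [← integral_integral_swap hint]
    simp_rw [integral_const_mul, integral_mul_left_eq_self F]
    rw [integral_mul_const, integral_complex_ofReal]
  calc (∫ t, τ t) * ‖∫ θ, F θ ∂(rotationMeasure n)‖
      = ‖((∫ t, τ t : ℝ) : ℂ) * ∫ θ, F θ ∂(rotationMeasure n)‖ := by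
        rw [norm_mul, Complex.norm_real, Real.norm_of_nonneg (integral_nonneg fun t => τ.nonneg)]
    _ ≤ M * (rotationMeasure n).real univ := by
        rw [h1]
        exact norm_integral_le_of_norm_le_const (Filter.Eventually.of_forall hM)
    _ = M := by simp

end Rotations

/-! ### Orthogonal splittings and averages over rotations -/

/-- An orthogonal decomposition `ℝⁿ = ℝᵏ ⊕ ℝᵐ`, given by isometric embeddings of the summands. -/
structure OrthogonalSplitting (n k m : ℕ) where
  ι : E k →ₗᵢ[ℝ] E n
  ι' : E m →ₗᵢ[ℝ] E n
  inner_ι_ι' : ∀ u v, inner ℝ (ι u) (ι' v) = 0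
  add_eq : k + m = n

namespace OrthogonalSplitting

variable {n k m : ℕ} (D : OrthogonalSplitting n k m)

theorem norm_add_sq (u : E k) (v : E m) : ‖D.ι u + D.ι' v‖ ^ 2 = ‖u‖ ^ 2 + ‖v‖ ^ 2 := by
  rw [norm_add_sq_real, D.inner_ι_ι', D.ι.norm_map, D.ι'.norm_map]
  ring

/-- The isomorphism `(u, v) ↦ ι u + ι' v`. -/
def glue : (E k × E m) ≃L[ℝ] E n :=
  (LinearMap.linearEquivOfInjective
    (D.ι.toLinearMap.coprod D.ι'.toLinearMap)
    (by
      rw [injective_iff_map_eq_zero]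
      rintro ⟨u, v⟩ h
      have h1 := D.norm_add_sq u v
      rw [show D.ι u + D.ι' v = 0 from h] at h1
      have hu : ‖u‖ = 0 := by nlinarith [norm_nonneg u, norm_nonneg v, norm_zero (E := E n)]
      have hv : ‖v‖ = 0 := by nlinarith [norm_nonneg u, norm_nonneg v, norm_zero (E := E n)]
      rw [norm_eq_zero] at hu hv
      simp [hu, hv])
    (by simp [D.add_eq])).toContinuousLinearEquiv

theorem glue_apply (w : E k × E m) : D.glue w = D.ι w.1 + D.ι' w.2 := rfl

/-- The components of a vector in the two summands. -/
def coord : E n ≃L[ℝ] (E k × E m) := D.glue.symm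

theorem ι_coord_add (x : E n) : D.ι (D.coord x).1 + D.ι' (D.coord x).2 = x :=
  D.glue.apply_symm_apply x

theorem inner_glue (x : E n) (w : E k × E m) :
    inner ℝ x (D.ι w.1 + D.ι' w.2) =
      inner ℝ (D.coord x).1 w.1 + inner ℝ (D.coord x).2 w.2 := by
  have h : ∀ u v, inner ℝ (D.ι' v) (D.ι u) = 0 := fun u v => by
    rw [real_inner_comm]; exact D.inner_ι_ι' u v
  conv_lhs => rw [← D.ι_coord_add x]
  simp only [inner_add_left, inner_add_right, D.inner_ι_ι', h, D.ι.inner_map_map,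
    D.ι'.inner_map_map]
  ring

theorem norm_sq_coord (x : E n) : ‖(D.coord x).1‖ ^ 2 + ‖(D.coord x).2‖ ^ 2 = ‖x‖ ^ 2 := by
  rw [← D.norm_add_sq, D.ι_coord_add]

theorem norm_coord_fst_le (x : E n) : ‖(D.coord x).1‖ ≤ ‖x‖ := by
  have := D.norm_sq_coord x
  exact (abs_le_of_sq_le_sq' (by nlinarith [norm_nonneg (D.coord x).2]) (norm_nonneg _)).2

theorem norm_coord_snd_le (x : E n) : ‖(D.coord x).2‖ ≤ ‖x‖ := by
  have := D.norm_sq_coord x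
  exact (abs_le_of_sq_le_sq' (by nlinarith [norm_nonneg (D.coord x).1]) (norm_nonneg _)).2

theorem norm_coord_le (x : E n) : ‖D.coord x‖ ≤ ‖x‖ :=
  max_le (D.norm_coord_fst_le x) (D.norm_coord_snd_le x)

/-- The unit vectors of the first summand. -/
def e (i : Fin k) : E n := D.ι (EuclideanSpace.single i 1)

/-- The unit vectors of the second summand. -/
def e' (l : Fin m) : E n := D.ι' (EuclideanSpace.single l 1)

theorem norm_e (i : Fin k) : ‖D.e i‖ = 1 := by simp [e]

theorem norm_e' (l : Fin m) : ‖D.e' l‖ = 1 := by simp [e']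

theorem inner_e_e' (i : Fin k) (l : Fin m) : inner ℝ (D.e i) (D.e' l) = 0 := D.inner_ι_ι' _ _

theorem inner_e (i : Fin k) (x : E n) : inner ℝ (D.e i) x = (D.coord x).1 i := by
  have := D.inner_glue x (EuclideanSpace.single i 1, 0)
  rw [real_inner_comm]
  simpa [e, EuclideanSpace.inner_single_right] using this

theorem inner_e' (l : Fin m) (x : E n) : inner ℝ (D.e' l) x = (D.coord x).2 l := by
  have := D.inner_glue x (0, EuclideanSpace.single l 1)
  rw [real_inner_comm]
  simpa [e', EuclideanSpace.inner_single_right] using this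

end OrthogonalSplitting

theorem abs_apply_le_norm {k : ℕ} (x : E k) (i : Fin k) : |x i| ≤ ‖x‖ := by
  simpa using PiLp.norm_apply_le x i

theorem exists_norm_le_mul_abs_apply {k : ℕ} (hk : 1 ≤ k) (x : E k) :
    ∃ i, ‖x‖ ≤ k * |x i| := by
  have : Nonempty (Fin k) := ⟨⟨0, hk⟩⟩
  obtain ⟨i, hi⟩ := Finite.exists_max fun i => |x i|
  refine ⟨i, ?_⟩
  have h1 : ‖x‖ ^ 2 ≤ (k * |x i|) ^ 2 := by
    rw [EuclideanSpace.norm_sq_eq]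
    calc ∑ j, ‖x j‖ ^ 2 ≤ ∑ _j : Fin k, |x i| ^ 2 :=
          Finset.sum_le_sum fun j _ => pow_le_pow_left₀ (norm_nonneg _) (hi j) 2
      _ = k * |x i| ^ 2 := by simp
      _ ≤ (k * |x i|) ^ 2 := by
        rw [mul_pow]
        have : (1 : ℝ) ≤ k := by exact_mod_cast hk
        exact mul_le_mul_of_nonneg_right (by nlinarith) (sq_nonneg _)
  exact (abs_le_of_sq_le_sq' h1 (by positivity)).2

theorem continuous_rotate_left {n : ℕ} (η : E n) : Continuous fun θ : SO n => rotate θ η :=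
  continuous_rotate.comp (Continuous.prodMk_left η)

theorem OrthogonalSplitting.continuous_coord_rotate {n k m : ℕ} (D : OrthogonalSplitting n k m)
    (η : E n) : Continuous fun θ : SO n => D.coord (rotate θ η) :=
  D.coord.continuous.comp (continuous_rotate_left η)

theorem OrthogonalSplitting.continuous_awayCutoff_coord_rotate {n k m : ℕ}
    (D : OrthogonalSplitting n k m) (c : ℝ) (η : E n) (l : Fin m) :
    Continuous fun θ : SO n => awayCutoff c ((D.coord (rotate θ η)).2 l) := by
  have h1 : Continuous fun θ : SO n => (D.coord (rotate θ η)).2 :=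
    continuous_snd.comp (D.continuous_coord_rotate η)
  have h2 : Continuous fun x : E m => x l := by fun_prop
  exact (contDiff_awayCutoff c).continuous.comp (h2.comp h1)

/-- The part of the average of a character over rotations where the `l`-th coordinate in the second
summand of the frequency is not small decays rapidly, if the position `b` makes a small angle with
the first summand. -/
theorem OrthogonalSplitting.exists_cutoff_average_le {n k m : ℕ} (D : OrthogonalSplitting n k m)
    {c : ℝ} (hc : 0 < c) (i : Fin k) (l : Fin m) {N : ℕ} (hN : N ≠ 0) :
    ∃ C : ℝ, ∀ (η b : E n) (r : ℝ), ‖η‖ ≤ 1 → |(D.coord b).2 l| ≤ c / 16 * |(D.coord b).1 i| →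
      |r * (D.coord b).1 i| ^ N * ‖∫ θ, Complex.exp (Complex.I * ((-2 * Real.pi * r *
        inner ℝ (rotate θ η) b : ℝ) : ℂ)) *
        (awayCutoff c ((D.coord (rotate θ η)).2 l) : ℂ) ∂(rotationMeasure n)‖ ≤ C := by
  let τ : ContDiffBump (0 : ℝ) := ⟨1, 2, one_pos, one_lt_two⟩
  have hτ : 0 < ∫ t, τ t := τ.integral_pos
  obtain ⟨C, hC⟩ := exists_rotation_integral_bound hc τ N
  refine ⟨(2 * Real.pi)⁻¹ ^ N * C / ∫ t, τ t, fun η b r hη hb => ?_⟩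
  have hC0 : 0 ≤ C := le_trans (by positivity) (hC 0 0 0 0 (by simp) (by simp) (by simp; positivity))
  set bi := (D.coord b).1 i with hbi
  set bl := (D.coord b).2 l with hbl
  let R := planeRotation (D.norm_e i) (D.norm_e' l) (D.inner_e_e' i l)
  have hR : Continuous R := continuous_planeRotation _ _ _
  let F : SO n → ℂ := fun θ => Complex.exp (Complex.I * ((-2 * Real.pi * r *
        inner ℝ (rotate θ η) b : ℝ) : ℂ)) * (awayCutoff c ((D.coord (rotate θ η)).2 l) : ℂ)
  have hF : Continuous F := by
    have h1 := D.continuous_awayCutoff_coord_rotate c η l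
    have h2 := continuous_rotate_left η
    fun_prop
  by_cases hrb : r * bi = 0
  · rw [hrb, abs_zero, zero_pow hN, zero_mul]
    positivity
  have hbi0 : bi ≠ 0 := right_ne_zero_of_mul hrb
  set s := bl / bi with hs
  set lam : ℝ := -2 * Real.pi * (r * bi) with hlam
  have hlam0 : 0 < |lam| := abs_pos.mpr (by
    have := Real.pi_ne_zero
    simp only [hlam, ne_eq, mul_eq_zero, not_or]
    exact ⟨⟨by norm_num, this⟩, mul_eq_zero.not.mp hrb |> not_or.mp⟩)
  have hs1 : |s| ≤ c / 16 := by
    rw [hs, abs_div, div_le_iff₀ (abs_pos.mpr hbi0)]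
    exact hb
  have key : ∀ θ, ‖∫ t, (τ t : ℂ) * F (R t * θ)‖ ≤ C / |lam| ^ N := by
    intro θ
    set ζ := rotate θ η with hζ
    set a₁ := (D.coord ζ).1 i with ha₁
    set a₂ := (D.coord ζ).2 l with ha₂
    have hζ1 : ‖ζ‖ ≤ 1 := by rw [hζ, norm_rotate]; exact hη
    have h1 : |a₁| ≤ 1 := (abs_apply_le_norm _ i).trans ((D.norm_coord_fst_le ζ).trans hζ1)
    have h2 : |a₂| ≤ 1 := (abs_apply_le_norm _ l).trans ((D.norm_coord_snd_le ζ).trans hζ1)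
    have hRζ : ∀ t, rotate (R t * θ) η = ζ + (Real.cos t - 1) • (a₁ • D.e i + a₂ • D.e' l) +
        Real.sin t • (a₁ • D.e' l - a₂ • D.e i) := by
      intro t
      rw [rotate_mul, rotate_planeRotation, ← hζ, D.inner_e, D.inner_e']
    have hee : inner ℝ (D.e' l) (D.e i) = (0 : ℝ) := by
      rw [real_inner_comm]; exact D.inner_e_e' i l
    have hee' : inner ℝ (D.e' l) (D.e' l) = (1 : ℝ) := by
      rw [real_inner_self_eq_norm_sq, D.norm_e', one_pow]
    have hcoord : ∀ t, (D.coord (rotate (R t * θ) η)).2 l =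
        a₁ * Real.sin t + a₂ * Real.cos t := by
      intro t
      rw [← D.inner_e', hRζ]
      simp only [inner_add_right, inner_sub_right, real_inner_smul_right, hee, hee']
      rw [D.inner_e', ← ha₂]
      ring
    have hinner : ∀ t, inner ℝ (rotate (R t * θ) η) b = (inner ℝ ζ b - a₁ * bi - a₂ * bl) +
        bi * ((a₁ * Real.cos t - a₂ * Real.sin t) +
          s * (a₁ * Real.sin t + a₂ * Real.cos t)) := by
      intro t
      have hbls : bl = bi * s := by rw [hs]; field_simp
      rw [hRζ]
      simp only [inner_add_left, inner_sub_left, real_inner_smul_left, D.inner_e, D.inner_e',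
        ← hbi, ← hbl, hbls]
      ring
    have hFt : ∀ t, (τ t : ℂ) * F (R t * θ) =
        Complex.exp (((-2 * Real.pi * r * (inner ℝ ζ b - a₁ * bi - a₂ * bl) : ℝ) : ℂ) *
          Complex.I) * (Complex.exp (Complex.I * (lam * ((a₁ * Real.cos t - a₂ * Real.sin t) +
        s * (a₁ * Real.sin t + a₂ * Real.cos t) : ℝ))) *
        ((τ t * awayCutoff c (a₁ * Real.sin t + a₂ * Real.cos t) : ℝ) : ℂ)) := by
      intro t
      simp only [F]
      rw [hcoord, hinner, ← mul_assoc (Complex.exp _) (Complex.exp _), ← Complex.exp_add,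
        mul_left_comm, ← Complex.ofReal_mul]
      congr 2
      simp only [hlam]
      push_cast
      ring
    simp_rw [hFt]
    rw [integral_const_mul, norm_mul, Complex.norm_exp_ofReal_mul_I, one_mul,
      le_div_iff₀' (by positivity)]
    exact hC a₁ a₂ s lam h1 h2 hs1
  have h := norm_integral_rotationMeasure_le hF hR τ key
  rw [le_div_iff₀ hτ, mul_assoc, mul_comm _ (∫ t, τ t)]
  calc |r * bi| ^ N * ((∫ t, τ t) * ‖∫ θ, F θ ∂(rotationMeasure n)‖)
      ≤ |r * bi| ^ N * (C / |lam| ^ N) := by gcongr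
    _ = (2 * Real.pi)⁻¹ ^ N * C := by
      have : |lam| = 2 * Real.pi * |r * bi| := by
        rw [hlam, abs_mul, abs_mul, abs_neg, abs_two, abs_of_pos Real.pi_pos]
      have h0 : |r * bi| ≠ 0 := abs_ne_zero.mpr hrb
      rw [this, mul_pow, inv_pow]
      field_simp

/-- The cut-off average of a character, at a position `b` that makes a small angle with the first
summand, decays rapidly in the component of `b` in the first summand: some coordinate of this
component is comparable to its norm, and the average over rotations in the plane of that coordinate
applies. -/
theorem OrthogonalSplitting.exists_cutoff_kernel_le {n k m : ℕ} (D : OrthogonalSplitting n k m)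
    (hk : 1 ≤ k) {ε c : ℝ} (hc : 0 < c) (hεc : 16 * k * ε ≤ c) (hε : 0 ≤ ε) (l : Fin m) (N : ℕ) :
    ∃ C : ℝ, 0 ≤ C ∧ ∀ (η b : E n) (r : ℝ), 0 ≤ r → ‖η‖ ≤ 1 → ‖(D.coord b).2‖ ≤ ε * ‖(D.coord b).1‖ →
      ‖∫ θ, Complex.exp (Complex.I * ((-2 * Real.pi * r * inner ℝ (rotate θ η) b : ℝ) : ℂ)) *
        (awayCutoff c ((D.coord (rotate θ η)).2 l) : ℂ) ∂(rotationMeasure n)‖ ≤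
      C * (1 + r * ‖(D.coord b).1‖) ^ (-((N + 1 : ℕ) : ℝ)) := by
  choose C hC using fun i : Fin k => D.exists_cutoff_average_le hc i l N.succ_ne_zero
  refine ⟨2 ^ N * (1 + k ^ (N + 1) * ∑ i, |C i|), by positivity, fun η b r hr hη hb => ?_⟩
  set I := ‖∫ θ, Complex.exp (Complex.I * ((-2 * Real.pi * r * inner ℝ (rotate θ η) b : ℝ) : ℂ)) *
        (awayCutoff c ((D.coord (rotate θ η)).2 l) : ℂ) ∂(rotationMeasure n)‖ with hI
  have hI1 : I ≤ 1 := by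
    have : I ≤ 1 * (rotationMeasure n).real univ := by
      refine norm_integral_le_of_norm_le_const (Filter.Eventually.of_forall fun θ => ?_)
      rw [norm_mul, mul_comm Complex.I, Complex.norm_exp_ofReal_mul_I, one_mul, Complex.norm_real,
        Real.norm_of_nonneg (awayCutoff_nonneg _ _)]
      exact awayCutoff_le_one _ _
    simpa using this
  obtain ⟨i, hi⟩ := exists_norm_le_mul_abs_apply hk (D.coord b).1
  have hbl : |(D.coord b).2 l| ≤ c / 16 * |(D.coord b).1 i| := by
    calc |(D.coord b).2 l| ≤ ‖(D.coord b).2‖ := abs_apply_le_norm _ _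
      _ ≤ ε * ‖(D.coord b).1‖ := hb
      _ ≤ ε * (k * |(D.coord b).1 i|) := by gcongr
      _ ≤ c / 16 * |(D.coord b).1 i| := by
        rw [← mul_assoc]
        gcongr
        linarith
  have h1 := hC i η b r hη hbl
  rw [← hI, abs_mul, abs_of_nonneg hr] at h1
  set x := r * ‖(D.coord b).1‖ with hx
  have hx0 : 0 ≤ x := by positivity
  have h2 : x ^ (N + 1) * I ≤ k ^ (N + 1) * ∑ i, |C i| := by
    calc x ^ (N + 1) * I ≤ (k * (r * |(D.coord b).1 i|)) ^ (N + 1) * I := by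
          gcongr
          rw [hx, mul_left_comm]
          gcongr
      _ = k ^ (N + 1) * ((r * |(D.coord b).1 i|) ^ (N + 1) * I) := by rw [mul_pow]; ring
      _ ≤ k ^ (N + 1) * ∑ i, |C i| := by
        gcongr
        exact h1.trans ((le_abs_self _).trans
          (Finset.single_le_sum (f := fun i => |C i|) (fun _ _ => abs_nonneg _)
            (Finset.mem_univ i)))
  have h3 : (1 + x) ^ (N + 1) ≤ 2 ^ N * (1 + x ^ (N + 1)) := by
    simpa using add_pow_le zero_le_one hx0 (N + 1)
  rw [Real.rpow_neg (by positivity), Real.rpow_natCast, ← div_eq_mul_inv,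
    le_div_iff₀ (by positivity)]
  calc I * (1 + x) ^ (N + 1) ≤ I * (2 ^ N * (1 + x ^ (N + 1))) := by gcongr
    _ = 2 ^ N * (I + x ^ (N + 1) * I) := by ring
    _ ≤ 2 ^ N * (1 + k ^ (N + 1) * ∑ i, |C i|) := by gcongr

/-! ### Average decay of the Fourier transform of a density on a graph -/

theorem integral_one_add_mul_norm_rpow_neg {k : ℕ} {r : ℝ} (hr : 0 < r) (u : E k) (s : ℝ) :
    ∫ v : E k, (1 + r * ‖u - v‖) ^ (-s) = (r ^ k)⁻¹ * ∫ v : E k, (1 + ‖v‖) ^ (-s) := by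
  have h1 : ∫ v : E k, (1 + r * ‖u - v‖) ^ (-s) = ∫ v : E k, (1 + ‖r • v‖) ^ (-s) := by
    rw [← integral_sub_left_eq_self (fun v : E k => (1 + ‖r • v‖) ^ (-s)) volume u]
    simp_rw [norm_smul, Real.norm_of_nonneg hr.le]
  rw [h1, Measure.integral_comp_smul volume (fun v : E k => (1 + ‖v‖) ^ (-s))]
  simp [abs_of_pos hr]

namespace GraphDensity

variable {k m : ℕ} {ε : ℝ} (G : GraphDensity k m ε)

/-- The integrand of the Fourier transform of the density. -/
def wave (ξ : E k × E m) (u : E k) : ℂ :=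
  Complex.exp (Complex.I * ((-2 * Real.pi : ℝ) * G.phase ξ u)) * (G.χ u : ℂ)

theorem fourier_eq (ξ : E k × E m) : G.fourier ξ = ∫ u, G.wave ξ u := rfl

theorem norm_wave (ξ : E k × E m) (u : E k) : ‖G.wave ξ u‖ = G.χ u := by
  simp only [wave]
  rw [norm_mul, mul_comm Complex.I, ← Complex.ofReal_mul, Complex.norm_exp_ofReal_mul_I, one_mul,
    Complex.norm_real, Real.norm_of_nonneg (G.χ_nonneg u)]

theorem measurable_wave : Measurable fun z : (E k × E m) × E k => G.wave z.1 z.2 := by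
  have h1 := G.measurable_ψ
  have h2 := G.contDiff_χ.continuous.measurable
  unfold wave phase
  fun_prop

theorem integrable_wave (ξ : E k × E m) : Integrable (G.wave ξ) :=
  G.integrable_χ.mono' (G.measurable_wave.of_uncurry_left).aestronglyMeasurable
    (Filter.Eventually.of_forall fun u => (G.norm_wave ξ u).le)

theorem norm_fourier_le (ξ : E k × E m) : ‖G.fourier ξ‖ ≤ ∫ u, G.χ u :=
  (norm_integral_le_integral_norm _).trans_eq (by
    exact integral_congr_ae (Filter.Eventually.of_forall fun u => G.norm_wave ξ u))

theorem continuous_fourier : Continuous G.fourier := by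
  refine continuous_of_dominated (F := G.wave) (bound := G.χ)
    (fun ξ => (G.integrable_wave ξ).aestronglyMeasurable)
    (fun ξ => Filter.Eventually.of_forall fun u => (G.norm_wave ξ u).le) G.integrable_χ
    (Filter.Eventually.of_forall fun u => ?_)
  unfold wave phase
  fun_prop

/-- If the frequency has all its coordinates in the second summand small, then one of its
coordinates in the first summand is large. -/
theorem _root_.OrthogonalSplitting.exists_le_abs_coord {n k m : ℕ}
    (D : OrthogonalSplitting n k m) (hn : 1 ≤ n) {η : E n} (hη : ‖η‖ = 1)
    (h : ∀ l, |(D.coord η).2 l| < 2 * (1 / (4 * n : ℝ))) :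
    ∃ i, 2 * (1 / (4 * n : ℝ)) ≤ |(D.coord η).1 i| := by
  by_contra! h'
  have hn' : (1 : ℝ) ≤ n := by exact_mod_cast hn
  have hsq : ∀ x : ℝ, |x| < 2 * (1 / (4 * n : ℝ)) → ‖x‖ ^ 2 ≤ 1 / (4 * n ^ 2 : ℝ) := by
    intro x hx
    calc ‖x‖ ^ 2 ≤ (2 * (1 / (4 * n : ℝ))) ^ 2 := by
          rw [Real.norm_eq_abs]; gcongr
      _ = 1 / (4 * n ^ 2 : ℝ) := by field_simp; norm_num
  have h1 := D.norm_sq_coord η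
  rw [hη, EuclideanSpace.norm_sq_eq, EuclideanSpace.norm_sq_eq] at h1
  have h2 : ∑ i, ‖(D.coord η).1 i‖ ^ 2 ≤ k * (1 / (4 * n ^ 2 : ℝ)) := by
    simpa using Finset.sum_le_sum fun i (_ : i ∈ Finset.univ) => hsq _ (h' i)
  have h3 : ∑ i, ‖(D.coord η).2 i‖ ^ 2 ≤ m * (1 / (4 * n ^ 2 : ℝ)) := by
    simpa using Finset.sum_le_sum fun i (_ : i ∈ Finset.univ) => hsq _ (h i)
  have h4 : (k : ℝ) + m = n := by exact_mod_cast D.add_eq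
  have h5 : (k : ℝ) * (1 / (4 * n ^ 2 : ℝ)) + m * (1 / (4 * n ^ 2 : ℝ)) = 1 / (4 * n) := by
    rw [← add_mul, h4]; field_simp
  have h6 : 1 / (4 * n : ℝ) < 1 := by
    rw [div_lt_one (by positivity)]
    linarith
  linarith

set_option maxHeartbeats 400000 in
/-- The part of the mean square of the Fourier transform over rotations where the rotated frequency
has a large coordinate in the second summand. Expanding the square turns it into a double integral
over the patch of the averages bounded in `OrthogonalSplitting.exists_cutoff_kernel_le`. -/
theorem exists_cutoff_average_sq_le {n : ℕ} (D : OrthogonalSplitting n k m) (hk : 1 ≤ k) {c : ℝ}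
    (hc : 0 < c) (hε : 0 ≤ ε) (hεc : 16 * k * ε ≤ c) (l : Fin m) :
    ∃ C : ℝ, ∀ (η : E n) (r : ℝ), 0 < r → ‖η‖ = 1 →
      r ^ k * ∫ θ, awayCutoff c ((D.coord (rotate θ η)).2 l) *
        ‖G.fourier (r • D.coord (rotate θ η))‖ ^ 2 ∂(rotationMeasure n) ≤ C := by
  obtain ⟨C, hC0, hC⟩ := D.exists_cutoff_kernel_le hk hc hεc hε l k
  obtain ⟨M, hM⟩ := G.hasCompactSupport_χ.exists_bound_of_continuous G.contDiff_χ.continuous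
  have hM0 : 0 ≤ M := (norm_nonneg _).trans (hM 0)
  let I₀ : ℝ := ∫ v : E k, (1 + ‖v‖) ^ (-((k + 1 : ℕ) : ℝ))
  refine ⟨C * M * I₀ * ∫ u, G.χ u, fun η r hr hη => ?_⟩
  have hcoord := D.continuous_coord_rotate η
  let κ : SO n → ℝ := fun θ => awayCutoff c ((D.coord (rotate θ η)).2 l)
  have hκ : Continuous κ := D.continuous_awayCutoff_coord_rotate c η l
  have hκ1 : ∀ θ, ‖κ θ‖ ≤ 1 := fun θ => by
    rw [Real.norm_of_nonneg (awayCutoff_nonneg _ _)]; exact awayCutoff_le_one _ _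
  obtain ⟨W, hW⟩ : ∃ W : SO n → E k → ℂ,
      ∀ θ u, W θ u = G.wave (r • D.coord (rotate θ η)) u := ⟨_, fun _ _ => rfl⟩
  have hWm : Measurable fun z : SO n × E k => W z.1 z.2 := by
    have h1 : Continuous fun θ : SO n => r • D.coord (rotate θ η) := hcoord.const_smul r
    have h2 : Measurable fun θ : SO n => r • D.coord (rotate θ η) := h1.measurable
    have h3 : Measurable fun z : SO n × E k => (r • D.coord (rotate z.1 η), z.2) :=
      (h2.comp measurable_fst).prodMk measurable_snd
    have h4 := G.measurable_wave.comp h3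
    unfold Function.comp at h4
    simp only [hW]
    exact h4
  have hWn : ∀ θ u, ‖W θ u‖ = G.χ u := fun θ u => by rw [hW, G.norm_wave]
  let H : SO n → E k × E k → ℂ := fun θ z => (κ θ : ℂ) * (W θ z.1 * starRingEnd ℂ (W θ z.2))
  have hHn : ∀ θ z, ‖H θ z‖ ≤ G.χ z.1 * G.χ z.2 := by
    intro θ z
    simp only [H]
    rw [norm_mul, norm_mul, RCLike.norm_conj, hWn, hWn, Complex.norm_real]
    exact mul_le_of_le_one_left (mul_nonneg (G.χ_nonneg _) (G.χ_nonneg _)) (hκ1 θ)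
  have hχχ : Integrable (fun z : E k × E k => G.χ z.1 * G.χ z.2) (volume.prod volume) :=
    G.integrable_χ.mul_prod G.integrable_χ
  have hHi : Integrable (fun z : SO n × (E k × E k) => H z.1 z.2)
      ((rotationMeasure n).prod (volume.prod volume)) := by
    have hm : Measurable fun z : SO n × (E k × E k) => H z.1 z.2 := by
      have h1 : Measurable fun z : SO n × (E k × E k) => W z.1 z.2.1 :=
        hWm.comp (measurable_fst.prodMk measurable_snd.fst)
      have h2 : Measurable fun z : SO n × (E k × E k) => W z.1 z.2.2 :=
        hWm.comp (measurable_fst.prodMk measurable_snd.snd)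
      have h3 : Measurable fun z : SO n × (E k × E k) => (κ z.1 : ℂ) :=
        Complex.measurable_ofReal.comp (hκ.measurable.comp measurable_fst)
      exact h3.mul (h1.mul (Complex.continuous_conj.measurable.comp h2))
    have h1 : Integrable (fun z : SO n × (E k × E k) => (1 : ℝ) * (G.χ z.2.1 * G.χ z.2.2))
        ((rotationMeasure n).prod (volume.prod volume)) :=
      (integrable_const (1 : ℝ)).mul_prod hχχ
    refine h1.mono' hm.aestronglyMeasurable (Filter.Eventually.of_forall fun z => ?_)
    rw [one_mul]
    exact hHn _ _
  -- expanding the square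
  have hexp : ∀ θ, ((κ θ * ‖G.fourier (r • D.coord (rotate θ η))‖ ^ 2 : ℝ) : ℂ) =
      ∫ z, H θ z ∂(volume.prod volume) := by
    intro θ
    simp only [H]
    rw [integral_const_mul, integral_prod_mul (W θ) (fun u => starRingEnd ℂ (W θ u)), integral_conj,
      RCLike.mul_conj]
    simp only [hW, ← G.fourier_eq]
    push_cast
    rfl
  have hkernel : ∀ z : E k × E k, ‖∫ θ, H θ z ∂(rotationMeasure n)‖ ≤
      G.χ z.1 * (C * M * (1 + r * ‖z.1 - z.2‖) ^ (-((k + 1 : ℕ) : ℝ))) := by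
    rintro ⟨u, u'⟩
    have hpos : 0 ≤ (1 + r * ‖u - u'‖) ^ (-((k + 1 : ℕ) : ℝ)) := by positivity
    by_cases h0 : G.χ u = 0 ∨ G.χ u' = 0
    · have : ∀ θ, H θ (u, u') = 0 := fun θ => by
        rw [← norm_le_zero_iff]
        refine (hHn θ (u, u')).trans_eq ?_
        rcases h0 with h | h <;> simp [h]
      simp only [this, integral_zero, norm_zero]
      exact mul_nonneg (G.χ_nonneg _) (by positivity)
    push Not at h0
    let b : E n := (D.ι u + D.ι' (G.ψ u)) - (D.ι u' + D.ι' (G.ψ u'))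
    have hb : D.coord b = (u - u', G.ψ u - G.ψ u') := by
      have h1 : ∀ w, D.coord (D.ι w + D.ι' (G.ψ w)) = (w, G.ψ w) := fun w =>
        D.glue.symm_apply_apply (w, G.ψ w)
      simp only [b, map_sub, h1, Prod.mk_sub_mk]
    have hHθ : ∀ θ, H θ (u, u') = (G.χ u * G.χ u' : ℝ) *
        (Complex.exp (Complex.I * ((-2 * Real.pi * r * inner ℝ (rotate θ η) b : ℝ) : ℂ)) *
        (awayCutoff c ((D.coord (rotate θ η)).2 l) : ℂ)) := by
      intro θ
      have hph : inner ℝ (rotate θ η) b = G.phase (D.coord (rotate θ η)) u -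
          G.phase (D.coord (rotate θ η)) u' := by
        simp only [b, inner_sub_right, phase]
        rw [D.inner_glue _ (u, G.ψ u), D.inner_glue _ (u', G.ψ u')]
      have hsm : ∀ w, G.phase (r • D.coord (rotate θ η)) w =
          r * G.phase (D.coord (rotate θ η)) w := fun w => by
        simp only [phase, Prod.smul_fst, Prod.smul_snd, real_inner_smul_left]
        ring
      simp only [H, hW, wave, map_mul, ← Complex.exp_conj, Complex.conj_ofReal, Complex.conj_I,
        hsm, hph, κ]
      rw [show (-2 * Real.pi * r * (G.phase (D.coord (rotate θ η)) u -
        G.phase (D.coord (rotate θ η)) u') : ℝ) =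
        (-2 * Real.pi : ℝ) * (r * G.phase (D.coord (rotate θ η)) u) -
        (-2 * Real.pi : ℝ) * (r * G.phase (D.coord (rotate θ η)) u') by ring, Complex.ofReal_sub,
        mul_sub, sub_eq_add_neg, Complex.exp_add]
      push_cast
      ring_nf
    simp_rw [hHθ]
    rw [integral_const_mul, norm_mul, Complex.norm_real,
      Real.norm_of_nonneg (mul_nonneg (G.χ_nonneg _) (G.χ_nonneg _)), mul_assoc]
    refine mul_le_mul_of_nonneg_left ?_ (G.χ_nonneg _)
    have h1 := hC η b r hr.le hη.le (by
      rw [hb]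
      exact G.norm_ψ_sub_le _ (G.mem_dom_of_χ_ne_zero h0.1) _ (G.mem_dom_of_χ_ne_zero h0.2))
    rw [hb] at h1
    have h2 : G.χ u' ≤ M := (le_abs_self _).trans (hM u')
    calc _ ≤ M * (C * (1 + r * ‖u - u'‖) ^ (-((k + 1 : ℕ) : ℝ))) :=
          mul_le_mul h2 h1 (norm_nonneg _) hM0
      _ = _ := by ring
  have hint0 : Integrable fun v : E k => (1 + ‖v‖) ^ (-((k + 1 : ℕ) : ℝ)) :=
    integrable_one_add_norm (by simp)
  have hinner : ∀ u : E k, Integrable fun v : E k =>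
      (1 + r * ‖u - v‖) ^ (-((k + 1 : ℕ) : ℝ)) := by
    intro u
    have := (integrable_comp_smul_iff volume
      (fun v : E k => (1 + ‖v‖) ^ (-((k + 1 : ℕ) : ℝ))) hr.ne').mpr hint0
    have := this.comp_sub_left u
    simpa only [norm_smul, Real.norm_of_nonneg hr.le] using this
  have hreal : ∫ θ, κ θ * ‖G.fourier (r • D.coord (rotate θ η))‖ ^ 2 ∂(rotationMeasure n) ≤
      ∫ u, G.χ u * (C * M * ((r ^ k)⁻¹ * I₀)) := by
    have h0 : 0 ≤ ∫ θ, κ θ * ‖G.fourier (r • D.coord (rotate θ η))‖ ^ 2 ∂(rotationMeasure n) :=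
      integral_nonneg fun θ => mul_nonneg (awayCutoff_nonneg _ _) (sq_nonneg _)
    have h1 : ((∫ θ, κ θ * ‖G.fourier (r • D.coord (rotate θ η))‖ ^ 2 ∂(rotationMeasure n) : ℝ) : ℂ)
        = ∫ z, (∫ θ, H θ z ∂(rotationMeasure n)) ∂(volume.prod volume) := by
      rw [← integral_complex_ofReal]
      simp_rw [hexp]
      exact integral_integral_swap hHi
    have hGi : Integrable (fun z : E k × E k => ∫ θ, H θ z ∂(rotationMeasure n))
        (volume.prod volume) := hHi.integral_prod_right
    calc _ = ‖((∫ θ, κ θ * ‖G.fourier (r • D.coord (rotate θ η))‖ ^ 2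
          ∂(rotationMeasure n) : ℝ) : ℂ)‖ := by rw [Complex.norm_real, Real.norm_of_nonneg h0]
      _ ≤ ∫ z, ‖∫ θ, H θ z ∂(rotationMeasure n)‖ ∂(volume.prod volume) := by
          rw [h1]; exact norm_integral_le_integral_norm _
      _ = ∫ u, ∫ v, ‖∫ θ, H θ (u, v) ∂(rotationMeasure n)‖ := integral_prod _ hGi.norm
      _ ≤ ∫ u, G.χ u * (C * M * ((r ^ k)⁻¹ * I₀)) := by
          refine integral_mono_of_nonneg (Filter.Eventually.of_forall fun u =>
            integral_nonneg fun v => norm_nonneg _) (G.integrable_χ.mul_const _)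
            (Filter.Eventually.of_forall fun u => ?_)
          calc ∫ v, ‖∫ θ, H θ (u, v) ∂(rotationMeasure n)‖
              ≤ ∫ v, G.χ u * (C * M * (1 + r * ‖u - v‖) ^ (-((k + 1 : ℕ) : ℝ))) :=
                integral_mono_of_nonneg (Filter.Eventually.of_forall fun v => norm_nonneg _)
                  (((hinner u).const_mul _).const_mul _)
                  (Filter.Eventually.of_forall fun v => hkernel (u, v))
            _ = _ := by
                rw [integral_const_mul, integral_const_mul, integral_one_add_mul_norm_rpow_neg hr]
  rw [integral_mul_const] at hreal
  calc _ ≤ r ^ k * ((∫ u, G.χ u) * (C * M * ((r ^ k)⁻¹ * I₀))) :=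
        mul_le_mul_of_nonneg_left hreal (by positivity)
    _ = _ := by
      have : r ^ k ≠ 0 := by positivity
      field_simp

/-- **Average decay** of the Fourier transform of a smooth density on a graph: its mean square
over the rotations of a frequency `ξ` is `O(|ξ|^(-k))`. -/
theorem exists_average_decay {n : ℕ} (D : OrthogonalSplitting n k m) (hk : 1 ≤ k)
    (hε : 0 ≤ ε) (hεn : 64 * n ^ 2 * ε ≤ 1) :
    ∃ C : ℝ, 0 ≤ C ∧ ∀ ξ : E n,
      (1 + ‖ξ‖) ^ k * ∫ θ, ‖G.fourier (D.coord (rotate θ ξ))‖ ^ 2 ∂(rotationMeasure n) ≤ C := by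
  have hkn : k ≤ n := by have := D.add_eq; omega
  have hn : 1 ≤ n := hk.trans hkn
  have hn' : (1 : ℝ) ≤ n := by exact_mod_cast hn
  have hkn' : (k : ℝ) ≤ n := by exact_mod_cast hkn
  -- every unit vector has a coordinate of absolute value at least `2 * c`
  set c : ℝ := 1 / (4 * n) with hc_def
  have hc : 0 < c := by positivity
  have hεc : 16 * n * ε ≤ c := by
    rw [hc_def, le_div_iff₀ (by positivity)]
    linarith
  have hεk : 16 * k * ε ≤ c := le_trans (by gcongr) hεc
  have hε8 : 8 * ε ≤ c := le_trans (by gcongr; linarith) hεc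
  choose A hA using fun l => G.exists_cutoff_average_sq_le D hk hc hε hεk l
  choose B hB using fun i => G.exists_fourier_le_of_le_abs hc hε8 i k
  set m₀ : ℝ := ∫ u, G.χ u with hm₀
  have hm0 : 0 ≤ m₀ := integral_nonneg G.χ_nonneg
  set S : ℝ := ∑ l, |A l| + (∑ i, |B i|) * m₀ with hS
  have hS0 : 0 ≤ S := by positivity
  refine ⟨2 ^ k * (m₀ ^ 2 + S), by positivity, fun ξ => ?_⟩
  have hcoord := D.continuous_coord_rotate ξ
  set J : ℝ := ∫ θ, ‖G.fourier (D.coord (rotate θ ξ))‖ ^ 2 ∂(rotationMeasure n) with hJ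
  have hFc : Continuous fun θ : SO n => ‖G.fourier (D.coord (rotate θ ξ))‖ ^ 2 :=
    (G.continuous_fourier.comp hcoord).norm.pow 2
  have hFi : Integrable (fun θ : SO n => ‖G.fourier (D.coord (rotate θ ξ))‖ ^ 2)
      (rotationMeasure n) :=
    hFc.integrable_of_hasCompactSupport (HasCompactSupport.of_compactSpace _)
  have hJ1 : J ≤ m₀ ^ 2 := by
    calc J ≤ ∫ _θ : SO n, m₀ ^ 2 ∂(rotationMeasure n) :=
          integral_mono hFi (integrable_const _) fun θ =>
            pow_le_pow_left₀ (norm_nonneg _) (G.norm_fourier_le _) 2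
      _ = m₀ ^ 2 := by simp
  have hJ0 : 0 ≤ J := integral_nonneg fun θ => sq_nonneg _
  have hJ2 : ‖ξ‖ ^ k * J ≤ S := by
    by_cases hξ : ξ = 0
    · rw [hξ, norm_zero, zero_pow (by omega), zero_mul]
      exact hS0
    set r := ‖ξ‖ with hr_def
    have hr : 0 < r := norm_pos_iff.mpr hξ
    set η : E n := r⁻¹ • ξ with hη_def
    have hη : ‖η‖ = 1 := norm_smul_inv_norm hξ
    have hrη : ∀ θ, D.coord (rotate θ ξ) = r • D.coord (rotate θ η) := fun θ => by
      rw [← map_smul, ← rotate_smul, hη_def, smul_inv_smul₀ hr.ne']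
    have hrotη := D.continuous_coord_rotate η
    have hpt : ∀ θ, ‖G.fourier (D.coord (rotate θ ξ))‖ ^ 2 ≤
        ∑ l, awayCutoff c ((D.coord (rotate θ η)).2 l) *
          ‖G.fourier (r • D.coord (rotate θ η))‖ ^ 2 + (r ^ k)⁻¹ * ((∑ i, |B i|) * m₀) := by
      intro θ
      rw [hrη]
      set F := ‖G.fourier (r • D.coord (rotate θ η))‖ with hF
      have hF0 : 0 ≤ F := norm_nonneg _
      have hterm : ∀ l, 0 ≤ awayCutoff c ((D.coord (rotate θ η)).2 l) * F ^ 2 := fun l =>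
        mul_nonneg (awayCutoff_nonneg _ _) (sq_nonneg _)
      by_cases hl : ∃ l, 2 * c ≤ |(D.coord (rotate θ η)).2 l|
      · obtain ⟨l, hl⟩ := hl
        have h1 := Finset.single_le_sum (fun l _ => hterm l) (Finset.mem_univ l)
        rw [awayCutoff_eq_one hc hl, one_mul] at h1
        have : 0 ≤ (r ^ k)⁻¹ * ((∑ i, |B i|) * m₀) := by positivity
        linarith
      · push Not at hl
        obtain ⟨i, hi⟩ := D.exists_le_abs_coord hn (by rw [norm_rotate, hη]) hl
        have h1 := hB i (D.coord (rotate θ η)) r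
          ((D.norm_coord_le _).trans (by rw [norm_rotate, hη])) hi
        rw [abs_of_pos hr, ← hF] at h1
        have h2 : B i ≤ ∑ i, |B i| := (le_abs_self _).trans
          (Finset.single_le_sum (f := fun i => |B i|) (fun _ _ => abs_nonneg _)
            (Finset.mem_univ i))
        have h3 : F ^ 2 ≤ (r ^ k)⁻¹ * ((∑ i, |B i|) * m₀) := by
          rw [← div_eq_inv_mul, le_div_iff₀' (by positivity)]
          calc r ^ k * F ^ 2 = (r ^ k * F) * F := by ring
            _ ≤ (∑ i, |B i|) * m₀ :=
              mul_le_mul (h1.trans h2) (G.norm_fourier_le _) hF0 (by positivity)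
        have := Finset.sum_nonneg fun l (_ : l ∈ Finset.univ) => hterm l
        linarith
    have hti : ∀ l, Integrable (fun θ : SO n => awayCutoff c ((D.coord (rotate θ η)).2 l) *
          ‖G.fourier (r • D.coord (rotate θ η))‖ ^ 2) (rotationMeasure n) := by
      intro l
      refine Continuous.integrable_of_hasCompactSupport ?_ (HasCompactSupport.of_compactSpace _)
      have h1 := D.continuous_awayCutoff_coord_rotate c η l
      exact h1.mul ((G.continuous_fourier.comp (hrotη.const_smul r)).norm.pow 2)
    have hint := integral_mono hFi ((integrable_finsetSum _ fun l _ => hti l).add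
      (integrable_const _)) hpt
    simp only [Pi.add_apply] at hint
    rw [integral_add (integrable_finsetSum _ fun l _ => hti l) (integrable_const _),
      integral_finsetSum _ fun l _ => hti l] at hint
    simp only [integral_const, probReal_univ, smul_eq_mul, one_mul] at hint
    calc r ^ k * J ≤ r ^ k * (∑ l, ∫ θ, awayCutoff c ((D.coord (rotate θ η)).2 l) *
          ‖G.fourier (r • D.coord (rotate θ η))‖ ^ 2 ∂(rotationMeasure n) +
          (r ^ k)⁻¹ * ((∑ i, |B i|) * m₀)) := mul_le_mul_of_nonneg_left hint (by positivity)
      _ = ∑ l, r ^ k * (∫ θ, awayCutoff c ((D.coord (rotate θ η)).2 l) *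
          ‖G.fourier (r • D.coord (rotate θ η))‖ ^ 2 ∂(rotationMeasure n)) +
          (∑ i, |B i|) * m₀ := by
        rw [mul_add, Finset.mul_sum, mul_inv_cancel_left₀ (by positivity)]
      _ ≤ S := by
        rw [hS]
        gcongr with l
        exact (hA l η r hr hη).trans (le_abs_self _)
  calc (1 + ‖ξ‖) ^ k * J ≤ 2 ^ (k - 1) * (1 ^ k + ‖ξ‖ ^ k) * J := by
        gcongr
        exact add_pow_le zero_le_one (norm_nonneg _) k
    _ ≤ 2 ^ k * (1 ^ k + ‖ξ‖ ^ k) * J := by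
        gcongr
        · norm_num
        · omega
    _ = 2 ^ k * (J + ‖ξ‖ ^ k * J) := by rw [one_pow]; ring
    _ ≤ 2 ^ k * (m₀ ^ 2 + S) := by gcongr

end GraphDensity

/-! ### Plancherel's theorem and convolution with rotated kernels -/

section Plancherel

open FourierTransform SchwartzMap

variable {V : Type*} [NormedAddCommGroup V] [InnerProductSpace ℝ V] [FiniteDimensional ℝ V]
  [MeasurableSpace V] [BorelSpace V]

/-- On `L¹ ∩ L²` the `L²` Fourier transform is given by the Fourier integral. -/
theorem fourier_toLp_ae_eq {f : V → ℂ} (h1 : Integrable f) (h2 : MemLp f 2) :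
    (𝓕 (h2.toLp f) : Lp ℂ 2 (volume : Measure V)) =ᵐ[volume] 𝓕 f := by
  set F : Lp ℂ 2 (volume : Measure V) := 𝓕 (h2.toLp f) with hF
  have hcont : Continuous (𝓕 f) :=
    VectorFourier.fourierIntegral_continuous Real.continuous_fourierChar
      (innerSL ℝ).continuous₂ h1
  refine ae_eq_of_integral_contDiff_smul_eq ((Lp.memLp F).locallyIntegrable (by norm_num))
    hcont.locallyIntegrable fun g hg hgc => ?_
  have hgC : HasCompactSupport fun x => (g x : ℂ) := hgc.comp_left Complex.ofReal_zero
  let φ : 𝓢(V, ℂ) := hgC.toSchwartzMap (Complex.ofRealCLM.contDiff.comp hg)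
  have hφ : ∀ x, φ x = g x := fun x => rfl
  have e1 : ∫ x, φ x • F x = ∫ x, (𝓕 φ) x • (h2.toLp f) x := by
    rw [← Lp.toTemperedDistribution_apply, hF, ← Lp.fourier_toTemperedDistribution_eq,
      TemperedDistribution.fourier_apply, Lp.toTemperedDistribution_apply]
  have e2 : ∫ x, (𝓕 φ) x • (h2.toLp f) x = ∫ x, (𝓕 φ) x • f x := by
    refine integral_congr_ae ?_
    filter_upwards [h2.coeFn_toLp] with x hx
    rw [hx]
  have e3 : ∫ x, (𝓕 φ) x • f x = ∫ x, φ x • 𝓕 f x := by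
    have := VectorFourier.integral_bilin_fourierIntegral_eq_flip (ContinuousLinearMap.mul ℂ ℂ)
      (μ := volume) (ν := volume) (L := innerₗ V) Real.continuous_fourierChar
      continuous_inner φ.integrable h1
    simpa using! this
  have e := e1.trans (e2.trans e3)
  simpa only [hφ, Complex.real_smul, smul_eq_mul] using e

/-- **Plancherel's theorem** for functions in `L¹ ∩ L²`. -/
theorem lintegral_enorm_fourier_sq {f : V → ℂ} (h1 : Integrable f) (h2 : MemLp f 2) :
    ∫⁻ ξ, ‖𝓕 f ξ‖ₑ ^ 2 = ∫⁻ x, ‖f x‖ₑ ^ 2 := by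
  have hn : eLpNorm (𝓕 f) 2 volume = eLpNorm f 2 volume := by
    rw [← eLpNorm_congr_ae (fourier_toLp_ae_eq h1 h2), ← eLpNorm_congr_ae h2.coeFn_toLp,
      ← Lp.enorm_def, ← Lp.enorm_def, ← ofReal_norm, ← ofReal_norm, Lp.norm_fourier_eq]
  have h : ∀ g : V → ℂ, ∫⁻ x, ‖g x‖ₑ ^ 2 = eLpNorm g 2 volume ^ 2 := fun g => by
    have := eLpNorm_nnreal_pow_eq_lintegral (f := g) (μ := (volume : Measure V)) (p := 2) (by simp)
    simpa using this.symm
  rw [h, h, hn]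

end Plancherel

section RotatedConvolution

open FourierTransform

variable {n : ℕ}

/-- The family of convolutions with the rotations of a kernel. -/
def rotConv (K : E n → ℂ) (f : E n → ℂ) (x : E n) (θ : SO n) : ℂ :=
  ∫ y, K (rotate θ y) * f (x - y)

theorem measurePreserving_rotate (θ : SO n) :
    MeasurePreserving (rotate θ : E n → E n) volume volume :=
  (rotateₗᵢ θ).measurePreserving

theorem measurable_rotate : Measurable fun z : SO n × E n => rotate z.1 z.2 :=
  continuous_rotate.measurable

theorem measurableEmbedding_rotate (θ : SO n) : MeasurableEmbedding (rotate θ : E n → E n) :=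
  (rotateₗᵢ θ).toHomeomorph.measurableEmbedding

theorem fourier_comp_rotate (K : E n → ℂ) (θ : SO n) (ξ : E n) :
    𝓕 (fun y => K (rotate θ y)) ξ = 𝓕 K (rotate θ ξ) := by
  rw [Real.fourier_eq, Real.fourier_eq,
    ← (measurePreserving_rotate θ).integral_comp (measurableEmbedding_rotate θ)
      (fun v => Real.fourierChar (-inner ℝ v (rotate θ ξ)) • K v)]
  simp_rw [inner_rotate_left, rotate_inv_rotate]

theorem memLp_two_of_bounded {V : Type*} [MeasurableSpace V] {μ : Measure V} {f : V → ℂ}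
    (h1 : Integrable f μ) {M : ℝ} (hM : ∀ x, ‖f x‖ ≤ M) : MemLp f 2 μ := by
  refine (memLp_two_iff_integrable_sq_norm h1.aestronglyMeasurable).mpr ?_
  refine (h1.norm.const_mul M).mono' (h1.aestronglyMeasurable.norm.pow 2)
    (Filter.Eventually.of_forall fun x => ?_)
  rw [Real.norm_of_nonneg (sq_nonneg _), sq]
  exact mul_le_mul_of_nonneg_right (hM x) (norm_nonneg _)

/-- The `L²` bound for convolutions with the rotations of a kernel only involves the mean square
over rotations of the Fourier transform of the kernel. -/
theorem lintegral_rotConv_sq_le {K f : E n → ℂ} (hK : Integrable K) {M : ℝ} (hKM : ∀ x, ‖K x‖ ≤ M)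
    (hf : Integrable f) (hf2 : MemLp f 2) {C : ℝ≥0∞}
    (hC : ∀ ξ, ∫⁻ θ, ‖𝓕 K (rotate θ ξ)‖ₑ ^ 2 ∂(rotationMeasure n) ≤ C) :
    ∫⁻ θ, (∫⁻ x, ‖rotConv K f x θ‖ₑ ^ 2) ∂(rotationMeasure n) ≤ C * ∫⁻ x, ‖f x‖ₑ ^ 2 := by
  have hKcont : Continuous (𝓕 K) :=
    VectorFourier.fourierIntegral_continuous Real.continuous_fourierChar
      (innerSL ℝ).continuous₂ hK
  have hfcont : Continuous (𝓕 f) :=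
    VectorFourier.fourierIntegral_continuous Real.continuous_fourierChar
      (innerSL ℝ).continuous₂ hf
  have hθ : ∀ θ, ∫⁻ x, ‖rotConv K f x θ‖ₑ ^ 2 = ∫⁻ ξ, ‖𝓕 K (rotate θ ξ)‖ₑ ^ 2 * ‖𝓕 f ξ‖ₑ ^ 2 := by
    intro θ
    have hKθ : Integrable fun y => K (rotate θ y) :=
      (measurePreserving_rotate θ).integrable_comp_of_integrable hK
    have hi : Integrable (fun x => rotConv K f x θ) :=
      hKθ.integrable_convolution (ContinuousLinearMap.mul ℂ ℂ) hf
    have hb : ∀ x, ‖rotConv K f x θ‖ ≤ M * ∫ y, ‖f y‖ := by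
      intro x
      calc ‖rotConv K f x θ‖ ≤ ∫ y, M * ‖f (x - y)‖ := by
            refine norm_integral_le_of_norm_le ((hf.norm.comp_sub_left x).const_mul M)
              (Filter.Eventually.of_forall fun y => ?_)
            rw [norm_mul]
            exact mul_le_mul_of_nonneg_right (hKM _) (norm_nonneg _)
        _ = M * ∫ y, ‖f y‖ := by
            rw [integral_const_mul, integral_sub_left_eq_self (fun y => ‖f y‖) volume x]
    rw [← lintegral_enorm_fourier_sq hi (memLp_two_of_bounded hi hb)]
    refine lintegral_congr fun ξ => ?_
    have := Real.fourier_mul_convolution_eq hKθ hf ξ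
    rw [fourier_comp_rotate] at this
    rw [← mul_pow, ← enorm_mul, ← this]
    rfl
  simp_rw [hθ]
  have hm : Measurable fun z : SO n × E n => ‖𝓕 K (rotate z.1 z.2)‖ₑ ^ 2 * ‖𝓕 f z.2‖ₑ ^ 2 := by
    have h1 : Measurable fun z : SO n × E n => 𝓕 K (rotate z.1 z.2) :=
      hKcont.measurable.comp measurable_rotate
    have h2 : Measurable fun z : SO n × E n => 𝓕 f z.2 := hfcont.measurable.comp measurable_snd
    exact (h1.enorm.pow_const 2).mul (h2.enorm.pow_const 2)
  rw [lintegral_lintegral_swap hm.aemeasurable, ← lintegral_enorm_fourier_sq hf hf2,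
    ← lintegral_const_mul _ (hfcont.measurable.enorm.pow_const 2)]
  refine lintegral_mono fun ξ => ?_
  have h1 : Measurable fun θ : SO n => ‖𝓕 K (rotate θ ξ)‖ₑ ^ 2 :=
    ((hKcont.comp (continuous_rotate_left ξ)).measurable.enorm.pow_const 2)
  rw [lintegral_mul_const _ h1]
  exact mul_le_mul_left (hC ξ) _

end RotatedConvolution

/-! ### A compactly supported kernel with vanishing moments -/

section Mollifier

open FourierTransform Polynomial

/-- Coefficients `c i`, `i ≤ N`, for which `∑ i, c i * x ^ i` equals `1` at `x = 1` and vanishes at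
`x = 2 ^ l`, `1 ≤ l < N + 1`. -/
theorem exists_dilation_coefficients (N : ℕ) :
    ∃ c : ℕ → ℝ, (∑ i ∈ Finset.range (N + 1), c i = 1) ∧
      ∀ l, 1 ≤ l → l < N + 1 → ∑ i ∈ Finset.range (N + 1), c i * ((2 : ℝ) ^ l) ^ i = 0 := by
  let P : ℝ[X] := ∏ l ∈ Finset.Icc 1 N, (C (1 - (2 : ℝ) ^ l)⁻¹ * (X - C ((2 : ℝ) ^ l)))
  have hdeg : P.natDegree < N + 1 := by
    refine Nat.lt_succ_of_le ((natDegree_prod_le _ _).trans ?_)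
    calc ∑ l ∈ Finset.Icc 1 N, (C (1 - (2 : ℝ) ^ l)⁻¹ * (X - C ((2 : ℝ) ^ l))).natDegree
        ≤ ∑ _l ∈ Finset.Icc 1 N, 1 := by
          refine Finset.sum_le_sum fun l _ => ?_
          exact (natDegree_C_mul_le _ _).trans (natDegree_X_sub_C_le _)
      _ = N := by simp
  have heval : ∀ x, P.eval x = ∑ i ∈ Finset.range (N + 1), P.coeff i * x ^ i := fun x =>
    eval_eq_sum_range' hdeg x
  refine ⟨P.coeff, ?_, fun l h1 h2 => ?_⟩
  · have := heval 1
    simp only [one_pow, mul_one] at this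
    rw [← this, eval_prod]
    refine Finset.prod_eq_one fun l hl => ?_
    have hl1 : l ≠ 0 := by have := (Finset.mem_Icc.mp hl).1; omega
    have : (1 : ℝ) < 2 ^ l := one_lt_pow₀ one_lt_two hl1
    simp only [eval_mul, eval_C, eval_sub, eval_X]
    exact inv_mul_cancel₀ (by linarith)
  · rw [← heval, eval_prod]
    refine Finset.prod_eq_zero (Finset.mem_Icc.mpr ⟨h1, Nat.lt_succ_iff.mp h2⟩) ?_
    simp

/-- A combination of dilated exponentials approximating `1` to high order at the origin. -/
theorem exists_norm_sum_exp_sub_one_le (N : ℕ) :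
    ∃ (c : ℕ → ℝ) (C : ℝ), 0 ≤ C ∧ ∀ s : ℝ,
      ‖∑ i ∈ Finset.range (N + 1), (c i : ℂ) * Complex.exp ((2 ^ i * s : ℝ) * Complex.I) - 1‖ ≤
        C * |s| ^ (N + 1) := by
  obtain ⟨c, hc1, hc0⟩ := exists_dilation_coefficients N
  set A : ℝ := ∑ i ∈ Finset.range (N + 1), |c i| with hA
  have hA0 : 0 ≤ A := Finset.sum_nonneg fun _ _ => abs_nonneg _
  set B : ℝ := ∑ i ∈ Finset.range (N + 1), |c i| * ((2 ^ i) ^ (N + 1) * Real.exp (2 ^ i)) with hB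
  have hB0 : 0 ≤ B := Finset.sum_nonneg fun _ _ => by positivity
  refine ⟨c, A + 1 + B, by positivity, fun s => ?_⟩
  rcases le_or_gt |s| 1 with hs | hs
  · have hz : ∀ i : ℕ, ‖((2 ^ i * s : ℝ) : ℂ) * Complex.I‖ = 2 ^ i * |s| := fun i => by
      rw [norm_mul, Complex.norm_I, mul_one, Complex.norm_real, norm_mul, Real.norm_eq_abs,
        Real.norm_eq_abs, abs_of_pos (by positivity : (0 : ℝ) < 2 ^ i)]
    -- the Taylor polynomials of the exponentials cancel
    have hpoly : ∑ i ∈ Finset.range (N + 1), (c i : ℂ) * ∑ l ∈ Finset.range (N + 1),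
        (((2 ^ i * s : ℝ) : ℂ) * Complex.I) ^ l / (l.factorial : ℂ) = 1 := by
      simp_rw [Finset.mul_sum]
      rw [Finset.sum_comm]
      have hterm : ∀ l ∈ Finset.range (N + 1), ∑ i ∈ Finset.range (N + 1),
          (c i : ℂ) * ((((2 ^ i * s : ℝ) : ℂ) * Complex.I) ^ l / (l.factorial : ℂ)) =
          if l = 0 then 1 else 0 := by
        intro l hl
        have h1 : ∀ i : ℕ, (c i : ℂ) * ((((2 ^ i * s : ℝ) : ℂ) * Complex.I) ^ l /
            (l.factorial : ℂ)) = ((c i * ((2 : ℝ) ^ l) ^ i : ℝ) : ℂ) *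
              (((s : ℂ) * Complex.I) ^ l / (l.factorial : ℂ)) := fun i => by
          push_cast
          rw [mul_assoc, mul_pow, ← pow_mul, ← pow_mul, mul_comm i l]
          ring
        simp_rw [h1]
        rw [← Finset.sum_mul, ← Complex.ofReal_sum]
        split_ifs with h
        · subst h
          simp [hc1]
        · rw [hc0 l (Nat.one_le_iff_ne_zero.mpr h) (Finset.mem_range.mp hl)]
          simp
      rw [Finset.sum_congr rfl hterm]
      simp
    rw [← hpoly, ← Finset.sum_sub_distrib]
    calc ‖∑ i ∈ Finset.range (N + 1), ((c i : ℂ) * Complex.exp ((2 ^ i * s : ℝ) * Complex.I) -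
          (c i : ℂ) * ∑ l ∈ Finset.range (N + 1),
            (((2 ^ i * s : ℝ) : ℂ) * Complex.I) ^ l / (l.factorial : ℂ))‖
        ≤ ∑ i ∈ Finset.range (N + 1), |c i| * ((2 ^ i) ^ (N + 1) * Real.exp (2 ^ i)) *
            |s| ^ (N + 1) := by
          refine norm_sum_le_of_le _ fun i _ => ?_
          rw [← mul_sub, norm_mul, Complex.norm_real, Real.norm_eq_abs, mul_assoc]
          refine mul_le_mul_of_nonneg_left ?_ (abs_nonneg _)
          refine (Complex.norm_exp_sub_sum_le_norm_mul_exp _ (N + 1)).trans ?_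
          rw [hz, mul_pow]
          have : Real.exp (2 ^ i * |s|) ≤ Real.exp (2 ^ i) :=
            Real.exp_le_exp.mpr (mul_le_of_le_one_right (by positivity) hs)
          calc _ ≤ (2 ^ i) ^ (N + 1) * |s| ^ (N + 1) * Real.exp (2 ^ i) := by gcongr
            _ = _ := by ring
      _ = B * |s| ^ (N + 1) := by rw [← Finset.sum_mul]
      _ ≤ (A + 1 + B) * |s| ^ (N + 1) := by
          gcongr
          linarith
  · calc _ ≤ ‖∑ i ∈ Finset.range (N + 1),
          (c i : ℂ) * Complex.exp ((2 ^ i * s : ℝ) * Complex.I)‖ + ‖(1 : ℂ)‖ := norm_sub_le _ _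
      _ ≤ A + 1 := by
          rw [norm_one]
          gcongr
          refine norm_sum_le_of_le _ fun i _ => ?_
          rw [norm_mul, Complex.norm_exp_ofReal_mul_I, mul_one, Complex.norm_real, Real.norm_eq_abs]
      _ ≤ (A + 1 + B) * 1 := by linarith
      _ ≤ (A + 1 + B) * |s| ^ (N + 1) := by
          gcongr
          exact one_le_pow₀ hs.le

variable {m : ℕ}

/-- The `L¹`-normalized dilation `v ↦ lᵐ Ψ (l v)`. -/
def dilate (l : ℝ) (Ψ : E m → ℂ) (v : E m) : ℂ := (l : ℂ) ^ m * Ψ (l • v)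

theorem integrable_dilate {l : ℝ} (hl : 0 < l) {Ψ : E m → ℂ} (h : Integrable Ψ) :
    Integrable (dilate l Ψ) :=
  ((integrable_comp_smul_iff volume Ψ hl.ne').mpr h).const_mul _

theorem measurable_dilate (l : ℝ) {Ψ : E m → ℂ} (h : Measurable Ψ) : Measurable (dilate l Ψ) := by
  unfold dilate
  fun_prop

theorem fourier_dilate {l : ℝ} (hl : 0 < l) (Ψ : E m → ℂ) (η : E m) :
    𝓕 (dilate l Ψ) η = 𝓕 Ψ (l⁻¹ • η) := by
  rw [Real.fourier_eq, Real.fourier_eq]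
  have h := Measure.integral_comp_smul (volume : Measure (E m))
    (fun v => Real.fourierChar (-inner ℝ v (l⁻¹ • η)) • Ψ v) l
  have h2 : ∀ v : E m, Real.fourierChar (-inner ℝ v η) • dilate l Ψ v =
      (l : ℂ) ^ m * (Real.fourierChar (-inner ℝ (l • v) (l⁻¹ • η)) • Ψ (l • v)) := fun v => by
    rw [real_inner_smul_left, real_inner_smul_right, mul_inv_cancel_left₀ hl.ne', dilate,
      Circle.smul_def, Circle.smul_def, smul_eq_mul, smul_eq_mul]
    ring
  simp_rw [h2]
  rw [integral_const_mul, h]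
  simp only [finrank_euclideanSpace, Fintype.card_fin, Complex.real_smul]
  rw [abs_of_pos (by positivity), ← mul_assoc]
  push_cast
  rw [mul_inv_cancel₀ (pow_ne_zero _ (by exact_mod_cast hl.ne')), one_mul]

/-- A bounded function supported in an annulus whose Fourier transform equals `1` up to high order
at the origin: that is, it has integral `1` and many vanishing moments. -/
theorem exists_moment_kernel (hm : 1 ≤ m) (N : ℕ) :
    ∃ Ψ : E m → ℂ, Measurable Ψ ∧ Integrable Ψ ∧ (∃ M : ℝ, ∀ v, ‖Ψ v‖ ≤ M) ∧
      (∃ L : ℕ, ∀ v, Ψ v ≠ 0 → 1 ≤ ‖v‖ ∧ ‖v‖ ≤ 2 ^ L) ∧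
      ∃ D : ℝ, ∀ η, ‖𝓕 Ψ η - 1‖ ≤ D * ‖η‖ ^ (N + 1) := by
  have : NeZero m := ⟨by omega⟩
  obtain ⟨c, C, hC0, hC⟩ := exists_norm_sum_exp_sub_one_le N
  let A : Set (E m) := Metric.closedBall 0 2 \ Metric.ball 0 1
  have hAm : MeasurableSet A := measurableSet_closedBall.diff measurableSet_ball
  have hAfin : volume A ≠ ⊤ :=
    ((measure_mono sdiff_subset).trans_lt measure_closedBall_lt_top).ne
  have hApos : 0 < volume A := by
    have hopen : IsOpen (Metric.ball (0 : E m) 2 \ Metric.closedBall 0 1) :=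
      Metric.isOpen_ball.sdiff Metric.isClosed_closedBall
    refine (hopen.measure_pos volume ?_).trans_le (measure_mono (sdiff_subset_sdiff
      Metric.ball_subset_closedBall Metric.ball_subset_closedBall))
    refine ⟨EuclideanSpace.single 0 (3 / 2), ?_, ?_⟩ <;> norm_num [PiLp.norm_single]
  set a : ℝ := (volume.real A)⁻¹ with ha
  have ha0 : 0 ≤ a := by positivity
  let Ψ₀ : E m → ℂ := A.indicator fun _ => (a : ℂ)
  have hΨ₀m : Measurable Ψ₀ := measurable_const.indicator hAm
  have hΨ₀i : Integrable Ψ₀ := (integrable_indicator_iff hAm).mpr (integrableOn_const hAfin)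
  have hΨ₀1 : ∫ v, Ψ₀ v = 1 := by
    rw [integral_indicator_const _ hAm, Complex.real_smul, ha, ← Complex.ofReal_mul,
      mul_inv_cancel₀, Complex.ofReal_one]
    exact (ENNReal.toReal_pos hApos.ne' hAfin).ne'
  let Ψ : E m → ℂ := fun v => ∑ i ∈ Finset.range (N + 1), (c i : ℂ) * dilate ((2 ^ i)⁻¹) Ψ₀ v
  have hpos : ∀ i : ℕ, (0 : ℝ) < (2 ^ i)⁻¹ := fun i => by positivity
  have hΨi : Integrable Ψ := integrable_finsetSum _ fun i _ =>
    (integrable_dilate (hpos i) hΨ₀i).const_mul _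
  refine ⟨Ψ, ?_, hΨi, ?_, ?_, ?_⟩
  · exact Finset.measurable_sum _ fun i _ => (measurable_dilate _ hΨ₀m).const_mul _
  · refine ⟨∑ i ∈ Finset.range (N + 1), |c i| * (((2 ^ i)⁻¹) ^ m * a), fun v => ?_⟩
    refine norm_sum_le_of_le _ fun i _ => ?_
    rw [norm_mul, Complex.norm_real, Real.norm_eq_abs, dilate, norm_mul, norm_pow,
      Complex.norm_real, Real.norm_of_nonneg (hpos i).le]
    gcongr
    refine (norm_indicator_le_norm_self _ _).trans_eq ?_
    rw [Complex.norm_real, Real.norm_of_nonneg ha0]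
  · refine ⟨N + 1, fun v hv => ?_⟩
    obtain ⟨i, hi, hi0⟩ := Finset.exists_ne_zero_of_sum_ne_zero hv
    have h1 : Ψ₀ ((2 ^ i : ℝ)⁻¹ • v) ≠ 0 := right_ne_zero_of_mul (right_ne_zero_of_mul hi0)
    have h2 : (2 ^ i : ℝ)⁻¹ • v ∈ A := by
      by_contra h
      exact h1 (indicator_of_notMem h _)
    obtain ⟨h3, h4⟩ := h2
    rw [mem_closedBall_zero_iff, norm_smul, Real.norm_of_nonneg (hpos i).le,
      inv_mul_le_iff₀ (by positivity)] at h3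
    rw [mem_ball_zero_iff, not_lt, norm_smul, Real.norm_of_nonneg (hpos i).le,
      le_inv_mul_iff₀ (by positivity), mul_one] at h4
    refine ⟨(one_le_pow₀ one_le_two).trans h4, h3.trans ?_⟩
    rw [← pow_succ]
    exact pow_le_pow_right₀ one_le_two (Nat.succ_le_of_lt (Finset.mem_range.mp hi))
  · refine ⟨C * (4 * Real.pi) ^ (N + 1), fun η => ?_⟩
    -- the Fourier transform is an average of the combinations of exponentials over `Ψ₀`
    have h1 : 𝓕 Ψ η - 1 = ∫ v, Ψ₀ v * (∑ i ∈ Finset.range (N + 1), (c i : ℂ) *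
        Complex.exp ((2 ^ i * (-2 * Real.pi * inner ℝ v η) : ℝ) * Complex.I) - 1) := by
      have hlin : 𝓕 Ψ η = ∑ i ∈ Finset.range (N + 1), (c i : ℂ) * 𝓕 Ψ₀ ((2 : ℝ) ^ i • η) := by
        have h2 : ∀ i, ∫ v, Real.fourierChar (-inner ℝ v η) • ((c i : ℂ) *
            dilate ((2 ^ i)⁻¹) Ψ₀ v) = (c i : ℂ) * 𝓕 Ψ₀ ((2 : ℝ) ^ i • η) := fun i => by
          rw [show (2 : ℝ) ^ i = ((2 ^ i : ℝ)⁻¹)⁻¹ by rw [inv_inv], ← fourier_dilate (hpos i),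
            Real.fourier_eq, ← integral_const_mul]
          refine integral_congr_ae (Filter.Eventually.of_forall fun v => ?_)
          simp only [Circle.smul_def, smul_eq_mul, inv_inv]
          ring
        rw [Real.fourier_eq]
        simp only [Ψ, Finset.smul_sum]
        rw [integral_finsetSum _ fun i _ => ?_]
        · exact Finset.sum_congr rfl fun i _ => h2 i
        · exact (Real.fourierIntegral_convergent_iff η).mpr
            ((integrable_dilate (hpos i) hΨ₀i).const_mul _)
      have hexpi : ∀ i : ℕ, Integrable fun v : E m => Ψ₀ v * ((c i : ℂ) *
          Complex.exp ((2 ^ i * (-2 * Real.pi * inner ℝ v η) : ℝ) * Complex.I)) := by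
        intro i
        refine (hΨ₀i.norm.mul_const |c i|).mono' ?_ (Filter.Eventually.of_forall fun v => ?_)
        · exact hΨ₀i.aestronglyMeasurable.mul (by fun_prop)
        · rw [norm_mul, norm_mul, Complex.norm_exp_ofReal_mul_I, mul_one, Complex.norm_real,
            Real.norm_eq_abs]
      simp_rw [mul_sub, mul_one, Finset.mul_sum]
      rw [integral_sub (integrable_finsetSum _ fun i _ => hexpi i) hΨ₀i, hΨ₀1,
        integral_finsetSum _ fun i _ => hexpi i, hlin]
      congr 1
      refine Finset.sum_congr rfl fun i _ => ?_
      rw [Real.fourier_eq', ← integral_const_mul]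
      refine integral_congr_ae (Filter.Eventually.of_forall fun v => ?_)
      simp only [real_inner_smul_right, smul_eq_mul]
      push_cast
      ring_nf
    rw [h1]
    calc _ ≤ ∫ v, A.indicator (fun _ => a * (C * (4 * Real.pi * ‖η‖) ^ (N + 1))) v := by
          refine norm_integral_le_of_norm_le ((integrable_indicator_iff hAm).mpr
            (integrableOn_const hAfin)) (Filter.Eventually.of_forall fun v => ?_)
          by_cases hv : v ∈ A
          · rw [indicator_of_mem hv, norm_mul, show Ψ₀ v = a from indicator_of_mem hv _,
              Complex.norm_real, Real.norm_of_nonneg ha0]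
            refine mul_le_mul_of_nonneg_left ((hC _).trans ?_) ha0
            have h3 : |(-2 * Real.pi * inner ℝ v η : ℝ)| ≤ 4 * Real.pi * ‖η‖ := by
              rw [abs_mul, abs_mul, abs_neg, abs_two, abs_of_pos Real.pi_pos]
              have h4 := abs_real_inner_le_norm v η
              have h5 : ‖v‖ ≤ 2 := mem_closedBall_zero_iff.mp hv.1
              have h6 : ‖v‖ * ‖η‖ ≤ 2 * ‖η‖ := by gcongr
              nlinarith [Real.pi_pos]
            gcongr
          · rw [indicator_of_notMem hv, show Ψ₀ v = 0 from indicator_of_notMem hv _, zero_mul,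
              norm_zero]
      _ = _ := by
          rw [integral_indicator_const _ hAm, smul_eq_mul, ha, mul_inv_cancel_left₀, mul_pow]
          · ring
          · exact (ENNReal.toReal_pos hApos.ne' hAfin).ne'

end Mollifier

/-! ### The analytic family of dyadic kernels -/

section DyadicFamily

open FourierTransform

variable {m : ℕ}

/-- The weight `2 ^ (-(j + 1) w)`. -/
def dyadicWeight (j : ℕ) (w : ℂ) : ℂ := Complex.exp (-(((j + 1 : ℕ) * Real.log 2 : ℝ) * w))

theorem norm_dyadicWeight (j : ℕ) (w : ℂ) :
    ‖dyadicWeight j w‖ = Real.exp (-(w.re * Real.log 2)) ^ (j + 1) := by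
  rw [dyadicWeight, Complex.norm_exp, ← Real.exp_nat_mul]
  congr 1
  rw [Complex.neg_re, Complex.re_ofReal_mul]
  push_cast
  ring

@[simp] theorem dyadicWeight_zero (j : ℕ) : dyadicWeight j 0 = 1 := by simp [dyadicWeight]

/-- The dyadic pieces of the approximate identity generated by `Ψ`. -/
def dyadicPiece (Ψ : E m → ℂ) (j : ℕ) (v : E m) : ℂ :=
  dilate (2 ^ (j + 1)) Ψ v - dilate (2 ^ j) Ψ v

/-- The analytic family of kernels on `ℝᵐ`: the dyadic pieces of the approximate identity up to
scale `2 ^ (-J)`, with weights `2 ^ (-(j + 1) w)`. At `w = 0` it is the approximate identity at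
scale `2 ^ (-J)`. -/
def dyadicKernel (Ψ : E m → ℂ) (J : ℕ) (w : ℂ) (v : E m) : ℂ :=
  Ψ v + ∑ j ∈ Finset.range J, dyadicWeight j w * dyadicPiece Ψ j v

theorem dyadicKernel_zero (Ψ : E m → ℂ) (J : ℕ) : dyadicKernel Ψ J 0 = dilate (2 ^ J) Ψ := by
  ext v
  simp only [dyadicKernel, dyadicPiece, dyadicWeight_zero, one_mul]
  rw [Finset.sum_range_sub (fun j => dilate (2 ^ j) Ψ v)]
  simp [dilate]

theorem measurable_dyadicPiece {Ψ : E m → ℂ} (h : Measurable Ψ) (j : ℕ) :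
    Measurable (dyadicPiece Ψ j) :=
  (measurable_dilate _ h).sub (measurable_dilate _ h)

theorem integrable_dyadicPiece {Ψ : E m → ℂ} (h : Integrable Ψ) (j : ℕ) :
    Integrable (dyadicPiece Ψ j) :=
  (integrable_dilate (by positivity) h).sub (integrable_dilate (by positivity) h)

theorem integrable_dyadicKernel {Ψ : E m → ℂ} (h : Integrable Ψ) (J : ℕ) (w : ℂ) :
    Integrable (dyadicKernel Ψ J w) :=
  h.add (integrable_finsetSum _ fun j _ => (integrable_dyadicPiece h j).const_mul _)

/-- A function supported in an annulus is nonzero at boundedly many dyadic dilates of a point. -/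
theorem sum_norm_dilates_le {Ψ : E m → ℂ} {M : ℝ} (hM : ∀ v, ‖Ψ v‖ ≤ M) {L : ℕ}
    (hL : ∀ v, Ψ v ≠ 0 → 1 ≤ ‖v‖ ∧ ‖v‖ ≤ 2 ^ L) (J : ℕ) (v : E m) :
    ∑ j ∈ Finset.range J, ‖Ψ ((2 : ℝ) ^ j • v)‖ ≤ (L + 1) * M := by
  classical
  have hM0 : 0 ≤ M := (norm_nonneg _).trans (hM 0)
  set S := (Finset.range J).filter fun j => Ψ ((2 : ℝ) ^ j • v) ≠ 0 with hS
  have hsum : ∑ j ∈ Finset.range J, ‖Ψ ((2 : ℝ) ^ j • v)‖ = ∑ j ∈ S, ‖Ψ ((2 : ℝ) ^ j • v)‖ := by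
    rw [hS, Finset.sum_filter]
    refine Finset.sum_congr rfl fun j _ => ?_
    split_ifs with h
    · rfl
    · rw [not_not.mp h, norm_zero]
  have hnorm : ∀ j : ℕ, ‖(2 : ℝ) ^ j • v‖ = 2 ^ j * ‖v‖ := fun j => by
    rw [norm_smul, Real.norm_of_nonneg (by positivity)]
  have hcard : S.card ≤ L + 1 := by
    rcases S.eq_empty_or_nonempty with h | h
    · simp [h]
    · have hsub : S ⊆ Finset.Icc (S.min' h) (S.min' h + L) := by
        intro j hj
        have hmin := S.min'_le j hj
        refine Finset.mem_Icc.mpr ⟨hmin, ?_⟩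
        have h1 := (hL _ (Finset.mem_filter.mp (S.min'_mem h)).2).1
        have h2 := (hL _ (Finset.mem_filter.mp hj).2).2
        rw [hnorm] at h1 h2
        by_contra! hlt
        obtain ⟨d, hd⟩ := Nat.exists_eq_add_of_lt hlt
        have h3 : (2 : ℝ) ^ j = 2 ^ L * 2 ^ (d + 1) * 2 ^ (S.min' h) := by
          rw [hd, ← pow_add, ← pow_add]; congr 1; omega
        have h4 : (1 : ℝ) < 2 ^ (d + 1) := one_lt_pow₀ one_lt_two (by omega)
        have h5 : (0 : ℝ) < 2 ^ L := by positivity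
        rw [h3] at h2
        have h6 : (2 : ℝ) ^ L * 2 ^ (d + 1) * 1 ≤ 2 ^ L * 2 ^ (d + 1) * (2 ^ (S.min' h) * ‖v‖) := by
          gcongr
        nlinarith
      have := Finset.card_le_card hsub
      rw [Nat.card_Icc] at this
      omega
  rw [hsum]
  calc ∑ j ∈ S, ‖Ψ ((2 : ℝ) ^ j • v)‖ ≤ ∑ _j ∈ S, M := Finset.sum_le_sum fun j _ => hM _
    _ = S.card * M := by simp
    _ ≤ (L + 1) * M := by
      gcongr
      exact_mod_cast hcard

/-- On the line `re w = m` the kernels are bounded, uniformly in the number of scales. -/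
theorem norm_dyadicKernel_le {Ψ : E m → ℂ} {M : ℝ} (hM : ∀ v, ‖Ψ v‖ ≤ M) {L : ℕ}
    (hL : ∀ v, Ψ v ≠ 0 → 1 ≤ ‖v‖ ∧ ‖v‖ ≤ 2 ^ L) (J : ℕ) {w : ℂ} (hw : w.re = m) (v : E m) :
    ‖dyadicKernel Ψ J w v‖ ≤ M + 2 * ((L + 1) * M) := by
  have hweight : ∀ j, ‖dyadicWeight j w‖ = ((2 ^ (j + 1)) ^ m)⁻¹ := fun j => by
    rw [norm_dyadicWeight, hw, Real.exp_neg, mul_comm, ← Real.rpow_def_of_pos two_pos,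
      Real.rpow_natCast, inv_pow, ← pow_mul, ← pow_mul, mul_comm]
  have hdil : ∀ j : ℕ, ‖dilate (2 ^ j) Ψ v‖ = (2 ^ j) ^ m * ‖Ψ ((2 : ℝ) ^ j • v)‖ := fun j => by
    rw [dilate, norm_mul, norm_pow, Complex.norm_real, Real.norm_of_nonneg (by positivity)]
  have hterm : ∀ j, ‖dyadicWeight j w * dyadicPiece Ψ j v‖ ≤
      ‖Ψ ((2 : ℝ) ^ (j + 1) • v)‖ + ‖Ψ ((2 : ℝ) ^ j • v)‖ := fun j => by
    rw [norm_mul, hweight, inv_mul_le_iff₀ (by positivity)]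
    refine (norm_sub_le _ _).trans ?_
    rw [hdil, hdil, mul_add]
    gcongr
    · norm_num
    · omega
  have hS := sum_norm_dilates_le hM hL (J + 1) v
  rw [Finset.sum_range_succ'] at hS
  have hS' := sum_norm_dilates_le hM hL J v
  calc ‖dyadicKernel Ψ J w v‖ ≤ ‖Ψ v‖ + ∑ j ∈ Finset.range J,
        (‖Ψ ((2 : ℝ) ^ (j + 1) • v)‖ + ‖Ψ ((2 : ℝ) ^ j • v)‖) :=
        (norm_add_le _ _).trans (add_le_add le_rfl (norm_sum_le_of_le _ fun j _ => hterm j))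
    _ ≤ M + 2 * ((L + 1) * M) := by
        rw [Finset.sum_add_distrib]
        have := hM v
        have := norm_nonneg (Ψ ((2 : ℝ) ^ 0 • v))
        linarith

/-- A two-sided geometric sum, peaked where `x * r ^ j` crosses `1`. -/
theorem exists_sum_min_le {r : ℝ} (hr : 1 < r) :
    ∃ C : ℝ, 0 ≤ C ∧ ∀ (J : ℕ) (x : ℝ), 0 < x →
      ∑ j ∈ Finset.range J, min (x * r ^ j) (x * r ^ j)⁻¹ ≤ C := by
  have hr0 : 0 < r := by linarith
  have hr1 : 0 < r - 1 := by linarith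
  set g : ℝ := r / (r - 1) with hg
  set c : ℝ := 1 / (r - 1) with hc
  have hg0 : 0 < g := by positivity
  have hc0 : 0 < c := by positivity
  have hgr : 1 + g / r = g := by rw [hg]; field_simp; ring
  have hcr : 1 - c * r = -c := by rw [hc]; field_simp; ring
  have hbig : ∀ (J : ℕ) (x : ℝ), 1 ≤ x →
      ∑ j ∈ Finset.range J, min (x * r ^ j) (x * r ^ j)⁻¹ ≤ g / x := by
    intro J
    induction J with
    | zero => intro x hx; simp; positivity
    | succ J ih =>
      intro x hx
      have hx0 : 0 < x := by linarith
      rw [Finset.sum_range_succ']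
      have h1 := ih (x * r) (one_le_mul_of_one_le_of_one_le hx hr.le)
      have h2 : ∀ j : ℕ, x * r ^ (j + 1) = x * r * r ^ j := fun j => by ring
      simp_rw [h2]
      calc _ ≤ g / (x * r) + x⁻¹ := by
            refine add_le_add h1 ?_
            rw [pow_zero, mul_one]
            exact min_le_right _ _
        _ = (1 + g / r) / x := by field_simp; ring
        _ = g / x := by rw [hgr]
  refine ⟨g + 1 + c, by positivity, fun J => ?_⟩
  have hsmall : ∀ (J : ℕ) (x : ℝ), 0 < x → x ≤ 1 →
      ∑ j ∈ Finset.range J, min (x * r ^ j) (x * r ^ j)⁻¹ ≤ g + 1 + c - c * x := by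
    intro J
    induction J with
    | zero => intro x hx hx1; simp; nlinarith
    | succ J ih =>
      intro x hx hx1
      rw [Finset.sum_range_succ']
      have h2 : ∀ j : ℕ, x * r ^ (j + 1) = x * r * r ^ j := fun j => by ring
      simp_rw [h2, pow_zero, mul_one]
      have h3 : min x x⁻¹ ≤ x := min_le_left _ _
      rcases le_or_gt (x * r) 1 with h | h
      · have := ih (x * r) (by positivity) h
        nlinarith
      · have h4 := hbig J (x * r) h.le
        have h5 : g / (x * r) ≤ g := div_le_self hg0.le h.le
        nlinarith
  intro x hx
  rcases le_or_gt x 1 with h | h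
  · refine (hsmall J x hx h).trans ?_
    nlinarith
  · refine (hbig J x h.le).trans ((div_le_self hg0.le h.le).trans ?_)
    linarith

/-- On the line `re w = -k / 2` the Fourier transforms of the kernels grow at most like
`|η| ^ (k / 2)`, uniformly in the number of scales. -/
theorem exists_norm_fourier_dyadicKernel_sq_le {Ψ : E m → ℂ} (hΨ : Integrable Ψ) {k : ℕ}
    (hk : 1 ≤ k) {D : ℝ} (hD : ∀ η, ‖𝓕 Ψ η - 1‖ ≤ D * ‖η‖ ^ k) :
    ∃ C : ℝ, 0 ≤ C ∧ ∀ (J : ℕ) (w : ℂ), w.re = -(k / 2 : ℝ) → ∀ η,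
      ‖𝓕 (dyadicKernel Ψ J w) η‖ ^ 2 ≤ C * (1 + ‖η‖) ^ k := by
  set r : ℝ := Real.exp (k / 2 * Real.log 2) with hr_def
  have hlog : 0 < Real.log 2 := Real.log_pos one_lt_two
  have hk0 : (0 : ℝ) < k := by exact_mod_cast hk
  have hr : 1 < r := Real.one_lt_exp_iff.mpr (by positivity)
  have hr0 : 0 < r := by linarith
  have hr2 : r ^ 2 = 2 ^ k := by
    rw [hr_def, ← Real.exp_nat_mul, ← Real.rpow_natCast 2 k, Real.rpow_def_of_pos two_pos]
    congr 1
    push_cast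
    ring
  obtain ⟨S, hS0, hS⟩ := exists_sum_min_le hr
  set A : ℝ := ∫ v, ‖Ψ v‖ with hA
  have hA0 : 0 ≤ A := integral_nonneg fun v => norm_nonneg _
  have hFA : ∀ η, ‖𝓕 Ψ η‖ ≤ A := fun η =>
    VectorFourier.norm_fourierIntegral_le_integral_norm _ _ _ _ _
  set B : ℝ := max (2 * A) (|D| * (1 + 2 ^ k)) with hB
  have hB0 : 0 ≤ B := le_max_of_le_left (by positivity)
  refine ⟨2 * (A ^ 2 + (B * S) ^ 2), by positivity, fun J w hw η => ?_⟩
  -- the multiplier of a dyadic piece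
  have hdiff : ∀ ζ : E m, ‖𝓕 Ψ ζ - 𝓕 Ψ ((2 : ℝ) • ζ)‖ ≤ B * min 1 (‖ζ‖ ^ k) := by
    intro ζ
    rcases min_cases 1 (‖ζ‖ ^ k) with ⟨h, -⟩ | ⟨h, -⟩ <;> rw [h]
    · calc _ ≤ ‖𝓕 Ψ ζ‖ + ‖𝓕 Ψ ((2 : ℝ) • ζ)‖ := norm_sub_le _ _
        _ ≤ 2 * A := by linarith [hFA ζ, hFA ((2 : ℝ) • ζ)]
        _ ≤ B * 1 := by rw [mul_one]; exact le_max_left _ _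
    · calc _ = ‖(𝓕 Ψ ζ - 1) - (𝓕 Ψ ((2 : ℝ) • ζ) - 1)‖ := by congr 1; ring
        _ ≤ ‖𝓕 Ψ ζ - 1‖ + ‖𝓕 Ψ ((2 : ℝ) • ζ) - 1‖ := norm_sub_le _ _
        _ ≤ |D| * ‖ζ‖ ^ k + |D| * (2 ^ k * ‖ζ‖ ^ k) := by
          have h1 := hD ((2 : ℝ) • ζ)
          rw [norm_smul, Real.norm_of_nonneg zero_le_two, mul_pow] at h1
          exact add_le_add ((hD ζ).trans (by gcongr; exact le_abs_self D))
            (h1.trans (by gcongr; exact le_abs_self D))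
        _ = |D| * (1 + 2 ^ k) * ‖ζ‖ ^ k := by ring
        _ ≤ B * ‖ζ‖ ^ k := by gcongr; exact le_max_right _ _
  have hpiece : ∀ j : ℕ, 𝓕 (dyadicPiece Ψ j) η =
      𝓕 Ψ (((2 : ℝ) ^ (j + 1))⁻¹ • η) - 𝓕 Ψ ((2 : ℝ) • ((2 : ℝ) ^ (j + 1))⁻¹ • η) := by
    intro j
    have h1 : ((2 : ℝ) • ((2 : ℝ) ^ (j + 1))⁻¹ • η) = ((2 : ℝ) ^ j)⁻¹ • η := by
      rw [smul_smul]
      congr 1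
      field_simp
      ring
    rw [h1, ← fourier_dilate (by positivity), ← fourier_dilate (by positivity), Real.fourier_eq,
      Real.fourier_eq, Real.fourier_eq, ← integral_sub]
    · refine integral_congr_ae (Filter.Eventually.of_forall fun v => ?_)
      simp only [dyadicPiece, smul_sub]
    · exact (Real.fourierIntegral_convergent_iff η).mpr (integrable_dilate (by positivity) hΨ)
    · exact (Real.fourierIntegral_convergent_iff η).mpr (integrable_dilate (by positivity) hΨ)
  have hsum : 𝓕 (dyadicKernel Ψ J w) η = 𝓕 Ψ η +
      ∑ j ∈ Finset.range J, dyadicWeight j w * 𝓕 (dyadicPiece Ψ j) η := by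
    have hi : ∀ j, Integrable fun v => dyadicWeight j w * dyadicPiece Ψ j v := fun j =>
      (integrable_dyadicPiece hΨ j).const_mul _
    have hi' : ∀ j, Integrable fun v => Real.fourierChar (-inner ℝ v η) •
        (dyadicWeight j w * dyadicPiece Ψ j v) := fun j =>
      (Real.fourierIntegral_convergent_iff η).mpr (hi j)
    rw [Real.fourier_eq]
    simp only [dyadicKernel, smul_add, Finset.smul_sum]
    rw [integral_add ((Real.fourierIntegral_convergent_iff η).mpr hΨ)
      (integrable_finsetSum _ fun j _ => hi' j), integral_finsetSum _ fun j _ => hi' j]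
    congr 1
    refine Finset.sum_congr rfl fun j _ => ?_
    rw [Real.fourier_eq, ← integral_const_mul]
    refine integral_congr_ae (Filter.Eventually.of_forall fun v => ?_)
    simp only [Circle.smul_def, smul_eq_mul]
    ring
  set σ : ℝ := Real.sqrt ‖η‖ ^ k with hσ
  have hσ0 : 0 ≤ σ := by positivity
  have hσ2 : σ ^ 2 = ‖η‖ ^ k := by
    rw [hσ, ← pow_mul, mul_comm, pow_mul, Real.sq_sqrt (norm_nonneg _)]
  have hterm : ∀ j, ‖dyadicWeight j w * 𝓕 (dyadicPiece Ψ j) η‖ ≤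
      B * (r ^ (j + 1) * min 1 (σ ^ 2 / (r ^ (j + 1)) ^ 2)) := by
    intro j
    have h1 : ‖dyadicWeight j w‖ = r ^ (j + 1) := by
      rw [norm_dyadicWeight, hw, hr_def]
      congr 2
      ring
    have h2 : ‖((2 : ℝ) ^ (j + 1))⁻¹ • η‖ ^ k = σ ^ 2 / (r ^ (j + 1)) ^ 2 := by
      rw [norm_smul, mul_pow, hσ2, ← pow_mul r, mul_comm (j + 1) 2, pow_mul, hr2, norm_inv,
        Real.norm_of_nonneg (by positivity), inv_pow, ← pow_mul, ← pow_mul, mul_comm k,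
        inv_mul_eq_div]
    rw [norm_mul, h1, hpiece, mul_left_comm]
    refine mul_le_mul_of_nonneg_left ((hdiff _).trans_eq ?_) (by positivity)
    rw [h2]
  have hbound : ‖𝓕 (dyadicKernel Ψ J w) η‖ ≤ A + B * S * σ := by
    rw [hsum]
    refine (norm_add_le _ _).trans (add_le_add (hFA η) ?_)
    refine (norm_sum_le_of_le _ fun j _ => hterm j).trans ?_
    rcases hσ0.eq_or_lt with h0 | hσpos
    · simp [← h0]
    · have h1 : ∀ j : ℕ, B * (r ^ (j + 1) * min 1 (σ ^ 2 / (r ^ (j + 1)) ^ 2)) =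
          B * σ * min (r / σ * r ^ j) (r / σ * r ^ j)⁻¹ := fun j => by
        have h2 : r / σ * r ^ j = r ^ (j + 1) / σ := by ring
        rw [h2, mul_assoc, mul_min_of_nonneg _ _ (by positivity), mul_min_of_nonneg _ _ hσ0]
        congr 2
        · field_simp
        · rw [inv_div]; field_simp
      simp_rw [h1]
      rw [← Finset.mul_sum]
      calc _ ≤ B * σ * S := mul_le_mul_of_nonneg_left (hS J _ (by positivity)) (by positivity)
        _ = B * S * σ := by ring
  calc ‖𝓕 (dyadicKernel Ψ J w) η‖ ^ 2 ≤ (A + B * S * σ) ^ 2 := by gcongr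
    _ ≤ 2 * (A ^ 2 + (B * S * σ) ^ 2) := by nlinarith [sq_nonneg (A - B * S * σ)]
    _ = 2 * (A ^ 2 * 1 + (B * S) ^ 2 * ‖η‖ ^ k) := by rw [mul_pow, hσ2, mul_one]
    _ ≤ 2 * (A ^ 2 * (1 + ‖η‖) ^ k + (B * S) ^ 2 * (1 + ‖η‖) ^ k) := by
        have h1 : (1 : ℝ) ≤ (1 + ‖η‖) ^ k := one_le_pow₀ (by linarith [norm_nonneg η])
        have h2 : ‖η‖ ^ k ≤ (1 + ‖η‖) ^ k := by
          gcongr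
          linarith
        gcongr
    _ = 2 * (A ^ 2 + (B * S) ^ 2) * (1 + ‖η‖) ^ k := by ring

end DyadicFamily

/-! ### Densities on graphs smeared in the normal directions -/

section PatchKernel

open FourierTransform

variable {n k m : ℕ}

/-- Orthogonal coordinates preserve Lebesgue measure. -/
theorem OrthogonalSplitting.measurePreserving_coord (D : OrthogonalSplitting n k m) :
    MeasurePreserving D.coord volume volume := by
  let L : E n ≃ₗᵢ[ℝ] WithLp 2 (E k × E m) :=
    { toLinearEquiv := D.coord.toLinearEquiv.trans (WithLp.linearEquiv 2 ℝ (E k × E m)).symm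
      norm_map' := fun x => by
        have h : ∀ w : E k × E m, ‖WithLp.toLp 2 w‖ = √(‖w.1‖ ^ 2 + ‖w.2‖ ^ 2) := fun w => by
          rw [WithLp.prod_norm_eq_of_L2]
          rfl
        exact (h (D.coord x)).trans (by rw [D.norm_sq_coord, Real.sqrt_sq (norm_nonneg _)]) }
  exact (WithLp.volume_preserving_ofLp (E k) (E m)).comp L.measurePreserving

theorem OrthogonalSplitting.measurableEmbedding_coord (D : OrthogonalSplitting n k m) :
    MeasurableEmbedding D.coord :=
  D.coord.toHomeomorph.measurableEmbedding

namespace GraphDensity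

variable {ε : ℝ} (G : GraphDensity k m ε) (D : OrthogonalSplitting n k m)

/-- The density `χ du` on the graph of `ψ`, smeared in the normal directions by the kernel `κ`. -/
def patchKernel (κ : E m → ℂ) (y : E n) : ℂ :=
  (G.χ (D.coord y).1 : ℂ) * κ ((D.coord y).2 - G.ψ (D.coord y).1)

/-- The smeared density in orthogonal coordinates. -/
def patchKernelCoord (κ : E m → ℂ) (w : E k × E m) : ℂ :=
  (G.χ w.1 : ℂ) * κ (w.2 - G.ψ w.1)

theorem patchKernel_eq (κ : E m → ℂ) (y : E n) :
    G.patchKernel D κ y = G.patchKernelCoord κ (D.coord y) := rfl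

theorem measurable_patchKernelCoord {κ : E m → ℂ} (hκ : Measurable κ) :
    Measurable (G.patchKernelCoord κ) := by
  have h1 := G.measurable_ψ
  have h2 := G.contDiff_χ.continuous.measurable
  unfold patchKernelCoord
  fun_prop

theorem measurable_patchKernel {κ : E m → ℂ} (hκ : Measurable κ) :
    Measurable (G.patchKernel D κ) :=
  (G.measurable_patchKernelCoord hκ).comp D.coord.continuous.measurable

theorem integrable_patchKernelCoord {κ : E m → ℂ} (hκ : Integrable κ) :
    Integrable (G.patchKernelCoord κ) := by
  have h1 : MeasurePreserving (fun w : E k × E m => (w.1, w.2 - G.ψ w.1))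
      (volume.prod volume) (volume.prod volume) := by
    refine (MeasurePreserving.id volume).skew_product (g := fun u v => v - G.ψ u) ?_ ?_
    · have := G.measurable_ψ
      unfold Function.uncurry
      fun_prop
    · exact Filter.Eventually.of_forall fun u =>
        (measurePreserving_sub_right volume (G.ψ u)).map_eq
  have h2 : Integrable (fun w : E k × E m => (G.χ w.1 : ℂ) * κ w.2) (volume.prod volume) :=
    G.integrable_χ.ofReal.mul_prod hκ
  have h3 := h1.integrable_comp_of_integrable h2
  exact h3

theorem exists_χ_le : ∃ M, 0 ≤ M ∧ ∀ u, G.χ u ≤ M := by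
  obtain ⟨M, hM⟩ := G.contDiff_χ.continuous.bounded_above_of_compact_support G.hasCompactSupport_χ
  exact ⟨M, (norm_nonneg _).trans (hM 0), fun u => (le_abs_self _).trans (hM u)⟩

theorem norm_patchKernel_le {M : ℝ} (hM0 : 0 ≤ M) (hM : ∀ u, G.χ u ≤ M) {κ : E m → ℂ} {C : ℝ}
    (hC : ∀ v, ‖κ v‖ ≤ C) (y : E n) : ‖G.patchKernel D κ y‖ ≤ M * C := by
  rw [patchKernel, norm_mul, Complex.norm_real, Real.norm_of_nonneg (G.χ_nonneg _)]
  exact mul_le_mul (hM _) (hC _) (norm_nonneg _) hM0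

theorem exists_norm_ψ_le : ∃ B, 0 ≤ B ∧ ∀ u, G.χ u ≠ 0 → ‖u‖ ≤ B ∧ ‖G.ψ u‖ ≤ B := by
  have hc : ContinuousOn G.ψ (tsupport G.χ) :=
    G.contDiffOn_ψ.continuousOn.mono G.tsupport_χ_subset
  obtain ⟨B₁, hB₁⟩ := G.hasCompactSupport_χ.isCompact.exists_bound_of_continuousOn hc
  obtain ⟨B₂, hB₂⟩ := G.hasCompactSupport_χ.isCompact.isBounded.exists_norm_le
  refine ⟨max 0 (max B₁ B₂), le_max_left _ _, fun u hu => ⟨?_, ?_⟩⟩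
  · exact (hB₂ u (subset_tsupport _ hu)).trans ((le_max_right _ _).trans (le_max_right _ _))
  · exact (hB₁ u (subset_tsupport _ hu)).trans ((le_max_left _ _).trans (le_max_right _ _))

/-- The smeared density has bounded support. -/
theorem exists_norm_le_of_patchKernel_ne_zero (R : ℝ) : ∃ R', ∀ κ : E m → ℂ,
    (∀ v, κ v ≠ 0 → ‖v‖ ≤ R) → ∀ y, G.patchKernel D κ y ≠ 0 → ‖y‖ ≤ R' := by
  obtain ⟨B, hB0, hB⟩ := G.exists_norm_ψ_le
  refine ⟨B + (R + B), fun κ hR y hy => ?_⟩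
  have h1 : G.χ (D.coord y).1 ≠ 0 := fun h => hy (by simp [patchKernel, h])
  have h2 : κ ((D.coord y).2 - G.ψ (D.coord y).1) ≠ 0 := right_ne_zero_of_mul hy
  have h3 : ‖(D.coord y).2‖ ≤ R + B := by
    calc ‖(D.coord y).2‖ = ‖((D.coord y).2 - G.ψ (D.coord y).1) + G.ψ (D.coord y).1‖ := by
          rw [sub_add_cancel]
      _ ≤ R + B := (norm_add_le _ _).trans (add_le_add (hR _ h2) (hB _ h1).2)
  calc ‖y‖ = ‖D.ι (D.coord y).1 + D.ι' (D.coord y).2‖ := by rw [D.ι_coord_add]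
    _ ≤ ‖(D.coord y).1‖ + ‖(D.coord y).2‖ := by
        refine (norm_add_le _ _).trans ?_
        rw [D.ι.norm_map, D.ι'.norm_map]
    _ ≤ B + (R + B) := add_le_add (hB _ h1).1 h3

/-- The Fourier transform of the smeared density is a product. -/
theorem fourier_patchKernel {κ : E m → ℂ} (hκ : Integrable κ) (ξ : E n) :
    𝓕 (G.patchKernel D κ) ξ = 𝓕 κ (D.coord ξ).2 * G.fourier (D.coord ξ) := by
  have hinner : ∀ y : E n, inner ℝ y ξ =
      inner ℝ (D.coord ξ).1 (D.coord y).1 + inner ℝ (D.coord ξ).2 (D.coord y).2 := fun y => by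
    rw [← D.inner_glue, D.ι_coord_add, real_inner_comm]
  set ζ := D.coord ξ
  obtain ⟨F, hF⟩ : ∃ F : E k × E m → ℂ, ∀ w, F w =
      Real.fourierChar (-(inner ℝ ζ.1 w.1 + inner ℝ ζ.2 w.2)) • G.patchKernelCoord κ w :=
    ⟨_, fun _ => rfl⟩
  have hFi : Integrable F (volume.prod volume) := by
    have h0 : Integrable (G.patchKernelCoord κ) (volume.prod volume) :=
      G.integrable_patchKernelCoord hκ
    rw [show F = fun w => Real.fourierChar (-(inner ℝ ζ.1 w.1 + inner ℝ ζ.2 w.2)) •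
      G.patchKernelCoord κ w from funext hF]
    refine h0.mono ?_ (Filter.Eventually.of_forall fun w => by simp)
    have hc : Continuous fun w : E k × E m =>
        (Real.fourierChar (-(inner ℝ ζ.1 w.1 + inner ℝ ζ.2 w.2)) : ℂ) := by fun_prop
    exact hc.aestronglyMeasurable.smul h0.aestronglyMeasurable
  have h1 : 𝓕 (G.patchKernel D κ) ξ = ∫ w, F w ∂(volume.prod volume) := by
    rw [Real.fourier_eq]
    simp_rw [hinner, patchKernel_eq]
    simp_rw [← hF]
    exact D.measurePreserving_coord.integral_comp D.measurableEmbedding_coord F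
  rw [h1, integral_prod _ hFi, mul_comm, G.fourier_eq, ← integral_mul_const]
  refine integral_congr_ae (Filter.Eventually.of_forall fun u => ?_)
  have h2 : ∀ v, F (u, v) = G.wave ζ u *
      (Real.fourierChar (-(inner ℝ (v - G.ψ u) ζ.2)) • κ (v - G.ψ u)) := by
    intro v
    rw [hF]
    simp only [patchKernelCoord, wave, phase, Circle.smul_def, smul_eq_mul,
      Real.fourierChar_apply]
    rw [show ((2 * Real.pi * -(inner ℝ ζ.1 u + inner ℝ ζ.2 v) : ℝ) : ℂ) * Complex.I =
      Complex.I * ((-2 * Real.pi : ℝ) * (inner ℝ ζ.1 u + inner ℝ ζ.2 (G.ψ u) : ℝ)) +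
      ((2 * Real.pi * -(inner ℝ (v - G.ψ u) ζ.2) : ℝ) : ℂ) * Complex.I by
        rw [inner_sub_left, real_inner_comm ζ.2 v, real_inner_comm ζ.2 (G.ψ u)]
        push_cast; ring, Complex.exp_add]
    ring
  simp_rw [h2]
  rw [integral_const_mul, Real.fourier_eq,
    integral_sub_right_eq_self (fun v => Real.fourierChar (-(inner ℝ v ζ.2)) • κ v)]

/-- If the Fourier transform of `κ` grows at most like `|η| ^ (k / 2)`, this is compensated by the
average decay of the Fourier transform of the density on the graph. -/
theorem exists_lintegral_fourier_patchKernel_sq_le (hk : 1 ≤ k) (hε : 0 ≤ ε)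
    (hεn : 64 * n ^ 2 * ε ≤ 1) : ∃ C : ℝ, 0 ≤ C ∧ ∀ (κ : E m → ℂ) (A : ℝ), Integrable κ → 0 ≤ A →
      (∀ η, ‖𝓕 κ η‖ ^ 2 ≤ A * (1 + ‖η‖) ^ k) → ∀ ξ : E n,
        ∫⁻ θ, ‖𝓕 (G.patchKernel D κ) (rotate θ ξ)‖ₑ ^ 2 ∂(rotationMeasure n) ≤
          ENNReal.ofReal (A * C) := by
  obtain ⟨C, hC0, hC⟩ := G.exists_average_decay D hk hε hεn
  refine ⟨C, hC0, fun κ A hκ hA hκA ξ => ?_⟩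
  set J : ℝ := ∫ θ, ‖G.fourier (D.coord (rotate θ ξ))‖ ^ 2 ∂(rotationMeasure n) with hJ
  have hint : Integrable (fun θ : SO n => ‖G.fourier (D.coord (rotate θ ξ))‖ ^ 2)
      (rotationMeasure n) := by
    refine Integrable.mono' (integrable_const ((∫ u, G.χ u) ^ 2)) ?_
      (Filter.Eventually.of_forall fun θ => ?_)
    · exact ((G.continuous_fourier.comp (D.continuous_coord_rotate ξ)).norm.pow
        2).aestronglyMeasurable
    · rw [Real.norm_of_nonneg (sq_nonneg _)]
      exact pow_le_pow_left₀ (norm_nonneg _) (G.norm_fourier_le _) 2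
  have hpt : ∀ θ, ‖𝓕 (G.patchKernel D κ) (rotate θ ξ)‖ₑ ^ 2 ≤
      ENNReal.ofReal (A * (1 + ‖ξ‖) ^ k * ‖G.fourier (D.coord (rotate θ ξ))‖ ^ 2) := by
    intro θ
    rw [G.fourier_patchKernel D hκ, ← ofReal_norm, ← ENNReal.ofReal_pow (norm_nonneg _), norm_mul,
      mul_pow]
    refine ENNReal.ofReal_le_ofReal (mul_le_mul_of_nonneg_right ?_ (sq_nonneg _))
    refine (hκA _).trans ?_
    have : ‖(D.coord (rotate θ ξ)).2‖ ≤ ‖ξ‖ :=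
      (D.norm_coord_snd_le _).trans_eq (norm_rotate θ ξ)
    gcongr
  calc _ ≤ ∫⁻ θ, ENNReal.ofReal (A * (1 + ‖ξ‖) ^ k * ‖G.fourier (D.coord (rotate θ ξ))‖ ^ 2)
        ∂(rotationMeasure n) := lintegral_mono hpt
    _ = ENNReal.ofReal (A * (1 + ‖ξ‖) ^ k * J) := by
        rw [← ofReal_integral_eq_lintegral_ofReal (hint.const_mul _), integral_const_mul]
        exact Filter.Eventually.of_forall fun θ => by positivity
    _ ≤ ENNReal.ofReal (A * C) := by
        rw [mul_assoc]
        exact ENNReal.ofReal_le_ofReal (mul_le_mul_of_nonneg_left (hC ξ) hA)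

end GraphDensity

end PatchKernel

/-! ### Three lines for integrals of complex powers -/

section AnalyticInterpolation

variable {Ω : Type*} [MeasurableSpace Ω] {ν : Measure Ω}

theorem norm_cpow_le_of_le {x B : ℝ} (hx : 0 ≤ x) (hxB : x ≤ B) (hB : 1 ≤ B) {s : ℂ} {r : ℝ}
    (hs : 0 < s.re) (hsr : s.re ≤ r) : ‖(x : ℂ) ^ s‖ ≤ B ^ r := by
  rw [Complex.norm_cpow_eq_rpow_re_of_nonneg hx hs.ne']
  exact (Real.rpow_le_rpow hx hxB hs.le).trans (Real.rpow_le_rpow_of_exponent_le hB hsr)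

/-- The derivative of `s ↦ x ^ s` is bounded for `x` in a bounded interval, locally uniformly in
the half plane `0 < re s`. -/
theorem norm_log_mul_cpow_le {x B : ℝ} (hx : 0 ≤ x) (hxB : x ≤ B) (hB : 1 ≤ B) {s : ℂ} {r r' : ℝ}
    (hr : 0 < r) (hs : r ≤ s.re) (hsr : s.re ≤ r') :
    ‖(x : ℂ) ^ s * Complex.log x‖ ≤ 1 / r + B ^ r' * B := by
  have hs0 : 0 < s.re := hr.trans_le hs
  have hBr : 0 ≤ B ^ r' * B := by positivity
  rcases hx.eq_or_lt with rfl | hx0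
  · have : s ≠ 0 := fun h => by simp [h] at hs0
    simp only [Complex.ofReal_zero, Complex.zero_cpow this, zero_mul, norm_zero]
    positivity
  rw [norm_mul, Complex.norm_cpow_eq_rpow_re_of_nonneg hx hs0.ne', ← Complex.ofReal_log hx,
    Complex.norm_real, Real.norm_eq_abs]
  rcases le_total x 1 with h1 | h1
  · have h2 : |Real.log x * x ^ r| < 1 / r := Real.abs_log_mul_self_rpow_lt x r hx0 h1 hr
    rw [abs_mul, abs_of_nonneg (Real.rpow_nonneg hx r)] at h2
    have h3 : x ^ s.re ≤ x ^ r := Real.rpow_le_rpow_of_exponent_ge hx0 h1 hs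
    calc x ^ s.re * |Real.log x| ≤ x ^ r * |Real.log x| := by gcongr
      _ = |Real.log x| * x ^ r := mul_comm _ _
      _ ≤ 1 / r + B ^ r' * B := by linarith
  · have h2 : |Real.log x| ≤ B := by
      rw [abs_of_nonneg (Real.log_nonneg h1)]
      exact (Real.log_le_self hx).trans hxB
    have h3 : x ^ s.re ≤ B ^ r' := (Real.rpow_le_rpow hx hxB hs0.le).trans
      (Real.rpow_le_rpow_of_exponent_le hB hsr)
    have h4 : 0 < 1 / r := by positivity
    calc x ^ s.re * |Real.log x| ≤ B ^ r' * B := by gcongr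
      _ ≤ 1 / r + B ^ r' * B := by linarith

theorem measurable_ofReal_cpow {M : Ω → ℝ} (hM : Measurable M) (s : ℂ) :
    Measurable fun τ => (M τ : ℂ) ^ s :=
  (Complex.measurable_ofReal.comp hM).pow_const s

theorem integrable_mul_ofReal_cpow {A : Ω → ℂ} (hA : Integrable A ν) {M : Ω → ℝ}
    (hM : Measurable M) (hM0 : ∀ τ, 0 ≤ M τ) {B : ℝ} (hB : 1 ≤ B) (hMB : ∀ τ, M τ ≤ B) {s : ℂ}
    (hs : 0 < s.re) : Integrable (fun τ => A τ * (M τ : ℂ) ^ s) ν := by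
  refine (hA.norm.mul_const (B ^ s.re)).mono'
    (hA.aestronglyMeasurable.mul (measurable_ofReal_cpow hM s).aestronglyMeasurable)
    (Filter.Eventually.of_forall fun τ => ?_)
  rw [norm_mul]
  gcongr
  exact norm_cpow_le_of_le (hM0 τ) (hMB τ) hB hs le_rfl

theorem norm_integral_mul_ofReal_cpow_le {A : Ω → ℂ} (hA : Integrable A ν) {M : Ω → ℝ}
    (hM0 : ∀ τ, 0 ≤ M τ) {B : ℝ} (hB : 1 ≤ B) (hMB : ∀ τ, M τ ≤ B) {s : ℂ}
    (hs : 0 < s.re) {r : ℝ} (hr : s.re ≤ r) :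
    ‖∫ τ, A τ * (M τ : ℂ) ^ s ∂ν‖ ≤ (∫ τ, ‖A τ‖ ∂ν) * B ^ r := by
  rw [← integral_mul_const]
  refine norm_integral_le_of_norm_le (hA.norm.mul_const _) (Filter.Eventually.of_forall fun τ => ?_)
  rw [norm_mul]
  gcongr
  exact norm_cpow_le_of_le (hM0 τ) (hMB τ) hB hs hr

theorem differentiableAt_integral_mul_ofReal_cpow {A : Ω → ℂ} (hA : Integrable A ν) {M : Ω → ℝ}
    (hM : Measurable M) (hM0 : ∀ τ, 0 ≤ M τ) {B : ℝ} (hB : 1 ≤ B) (hMB : ∀ τ, M τ ≤ B) {s : ℂ}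
    (hs : 0 < s.re) : DifferentiableAt ℂ (fun s : ℂ => ∫ τ, A τ * (M τ : ℂ) ^ s ∂ν) s := by
  have hball : ∀ z ∈ Metric.ball s (s.re / 2), s.re / 2 ≤ z.re ∧ z.re ≤ 2 * s.re := by
    intro z hz
    have h1 : |z.re - s.re| < s.re / 2 := by
      rw [← Complex.sub_re]
      exact (Complex.abs_re_le_norm _).trans_lt (mem_ball_iff_norm.mp hz)
    rw [abs_lt] at h1
    constructor <;> linarith
  have hopen : Metric.ball s (s.re / 2) ∈ nhds s := Metric.ball_mem_nhds _ (by positivity)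
  refine (hasDerivAt_integral_of_dominated_loc_of_deriv_le (F := fun z τ => A τ * (M τ : ℂ) ^ z)
    (F' := fun z τ => A τ * ((M τ : ℂ) ^ z * Complex.log (M τ)))
    (bound := fun τ => ‖A τ‖ * (1 / (s.re / 2) + B ^ (2 * s.re) * B)) hopen ?_ ?_ ?_ ?_ ?_
    ?_).2.differentiableAt
  · exact Filter.Eventually.of_forall fun z => hA.aestronglyMeasurable.mul
      (measurable_ofReal_cpow hM z).aestronglyMeasurable
  · exact integrable_mul_ofReal_cpow hA hM hM0 hB hMB hs
  · exact hA.aestronglyMeasurable.mul ((measurable_ofReal_cpow hM s).mul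
      (Complex.measurable_log.comp (Complex.measurable_ofReal.comp hM))).aestronglyMeasurable
  · refine Filter.Eventually.of_forall fun τ z hz => ?_
    rw [norm_mul]
    gcongr
    exact norm_log_mul_cpow_le (hM0 τ) (hMB τ) hB (by positivity) (hball z hz).1 (hball z hz).2
  · exact hA.norm.mul_const _
  · refine Filter.Eventually.of_forall fun τ z hz => HasDerivAt.const_mul _ ?_
    have hz0 : z ≠ 0 := fun h => by
      have := (hball z hz).1
      rw [h, Complex.zero_re] at this
      linarith
    simpa using (hasDerivAt_id z).const_cpow (c := (M τ : ℂ)) (Or.inr hz0)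

/-- The three lines theorem for an analytic family of integrals, in which the size of the integrand
varies with an exponent `p (1 - z / 2)`. -/
theorem norm_sum_integral_cpow_le_interp {ι : Type*} (I : Finset ι) {A : ι → Ω → ℂ}
    (hA : ∀ i ∈ I, Integrable (A i) ν) {M : Ω → ℝ} (hM : Measurable M) (hM0 : ∀ τ, 0 ≤ M τ) {B : ℝ}
    (hB : 1 ≤ B) (hMB : ∀ τ, M τ ≤ B) {W : ι → ℂ → ℂ} (hW : ∀ i ∈ I, Differentiable ℂ (W i))
    {Wb : ι → ℝ} (hWb : ∀ i ∈ I, ∀ z : ℂ, 0 ≤ z.re → z.re ≤ 1 → ‖W i z‖ ≤ Wb i) {p : ℝ}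
    (hp : 0 < p) {a b t : ℝ} (ht0 : 0 ≤ t) (ht1 : t ≤ 1)
    (ha : ∀ z : ℂ, z.re = 0 →
      ‖∑ i ∈ I, W i z * ∫ τ, A i τ * (M τ : ℂ) ^ ((p : ℂ) * (1 - z / 2)) ∂ν‖ ≤ a)
    (hb : ∀ z : ℂ, z.re = 1 →
      ‖∑ i ∈ I, W i z * ∫ τ, A i τ * (M τ : ℂ) ^ ((p : ℂ) * (1 - z / 2)) ∂ν‖ ≤ b) :
    ‖∑ i ∈ I, W i t * ∫ τ, A i τ * (M τ : ℂ) ^ ((p : ℂ) * (1 - (t : ℂ) / 2)) ∂ν‖ ≤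
      a ^ (1 - t) * b ^ t := by
  have hre : ∀ z : ℂ, ((p : ℂ) * (1 - z / 2)).re = p * (1 - z.re / 2) := fun z => by
    rw [Complex.re_ofReal_mul]
    simp
  have hpos : ∀ z : ℂ, z.re ≤ 1 → 0 < ((p : ℂ) * (1 - z / 2)).re := fun z hz => by
    rw [hre]
    have : 0 < 1 - z.re / 2 := by linarith
    positivity
  have hdiff : ∀ z : ℂ, z.re ≤ 1 → DifferentiableAt ℂ (fun z : ℂ => ∑ i ∈ I,
      W i z * ∫ τ, A i τ * (M τ : ℂ) ^ ((p : ℂ) * (1 - z / 2)) ∂ν) z := by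
    intro z hz
    refine DifferentiableAt.fun_sum fun i hi => ((hW i hi) z).mul ?_
    have h1 := differentiableAt_integral_mul_ofReal_cpow (hA i hi) hM hM0 hB hMB (hpos z hz)
    exact DifferentiableAt.comp z (f := fun z : ℂ => (p : ℂ) * (1 - z / 2)) h1 (by fun_prop)
  have hcl : closure (Complex.HadamardThreeLines.verticalStrip 0 1) ⊆ {z : ℂ | z.re ≤ 1} := by
    refine closure_minimal (fun z hz => le_of_lt hz.2) ?_
    exact isClosed_le Complex.continuous_re continuous_const
  have key := Complex.HadamardThreeLines.norm_le_interp_of_mem_verticalClosedStrip₀₁'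
    (fun z : ℂ => ∑ i ∈ I, W i z * ∫ τ, A i τ * (M τ : ℂ) ^ ((p : ℂ) * (1 - z / 2)) ∂ν)
    (z := (t : ℂ)) (a := a) (b := b) ⟨ht0, ht1⟩ ?_ ?_ (fun z hz => ha z hz) (fun z hz => hb z hz)
  · rwa [Complex.ofReal_re] at key
  · refine DifferentiableOn.diffContOnCl fun z hz => ?_
    exact (hdiff z (hcl hz)).differentiableWithinAt
  · refine ⟨∑ i ∈ I, Wb i * ((∫ τ, ‖A i τ‖ ∂ν) * B ^ p), ?_⟩
    rintro _ ⟨z, hz, rfl⟩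
    have hz0 : 0 ≤ z.re := hz.1
    have hz1 : z.re ≤ 1 := hz.2
    refine norm_sum_le_of_le _ fun i hi => ?_
    rw [norm_mul]
    refine mul_le_mul (hWb i hi z hz0 hz1) (norm_integral_mul_ofReal_cpow_le (hA i hi) hM0 hB hMB
      (hpos z hz1) ?_) (norm_nonneg _) ((norm_nonneg _).trans (hWb i hi z hz0 hz1))
    rw [hre]
    nlinarith

end AnalyticInterpolation

/-! ### The endpoint estimates -/

section RotatedForms

open FourierTransform

variable {n : ℕ}

/-- The product of Lebesgue measure and Haar measure. -/
abbrev rigidMeasure (n : ℕ) : Measure (E n × SO n) := volume.prod (rotationMeasure n)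

theorem integrable_of_bounded_of_support {Ω : Type*} [MeasurableSpace Ω] {ν : Measure Ω}
    {g : Ω → ℂ} (hg : AEStronglyMeasurable g ν) {M : ℝ} (hM : ∀ τ, ‖g τ‖ ≤ M) {T : Set Ω}
    (hT : ν T ≠ ⊤) (hgT : ∀ τ, g τ ≠ 0 → τ ∈ T) : Integrable g ν := by
  rw [← integrableOn_iff_integrable_of_support_subset (s := T) hgT]
  exact Measure.integrableOn_of_bounded hT hg (Filter.Eventually.of_forall hM)

theorem rigidMeasure_closedBall_lt_top (R : ℝ) :
    rigidMeasure n {z | ‖z.1‖ ≤ R} ≠ ⊤ := by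
  have h : {z : E n × SO n | ‖z.1‖ ≤ R} = Metric.closedBall 0 R ×ˢ univ := by
    ext z; simp
  rw [h, Measure.prod_prod]
  exact ENNReal.mul_ne_top (measure_closedBall_lt_top).ne (measure_ne_top _ _)

theorem measurable_rotConv_integrand {K : E n → ℂ} (hK : Measurable K) {f : E n → ℂ}
    (hf : Measurable f) :
    Measurable fun τ : (E n × SO n) × E n => K (rotate τ.1.2 τ.2) * f (τ.1.1 - τ.2) := by
  have h1 : Measurable fun τ : (E n × SO n) × E n => rotate τ.1.2 τ.2 := by
    have h3 : Measurable fun τ : (E n × SO n) × E n => (τ.1.2, τ.2) := by fun_prop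
    have h4 := measurable_rotate.comp h3
    exact h4
  have h2 : Measurable fun τ : (E n × SO n) × E n => τ.1.1 - τ.2 := by fun_prop
  exact (hK.comp h1).mul (hf.comp h2)

theorem measurable_rotConv {K : E n → ℂ} (hK : Measurable K) {f : E n → ℂ} (hf : Measurable f) :
    Measurable fun z : E n × SO n => rotConv K f z.1 z.2 :=
  ((measurable_rotConv_integrand hK hf).stronglyMeasurable.integral_prod_right
    (ν := (volume : Measure (E n)))).measurable

theorem norm_rotConv_le {K f : E n → ℂ} {M : ℝ} (hM : ∀ y, ‖K y‖ ≤ M) (hf : Integrable f)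
    (x : E n) (θ : SO n) : ‖rotConv K f x θ‖ ≤ M * ∫ y, ‖f y‖ := by
  calc ‖rotConv K f x θ‖ ≤ ∫ y, M * ‖f (x - y)‖ := by
        refine norm_integral_le_of_norm_le ((hf.norm.comp_sub_left x).const_mul M)
          (Filter.Eventually.of_forall fun y => ?_)
        rw [norm_mul]
        exact mul_le_mul_of_nonneg_right (hM _) (norm_nonneg _)
    _ = M * ∫ y, ‖f y‖ := by
        rw [integral_const_mul, integral_sub_left_eq_self (fun y => ‖f y‖) volume x]

theorem norm_le_of_rotConv_ne_zero {K f : E n → ℂ} {R₁ R₂ : ℝ} (h₁ : ∀ y, K y ≠ 0 → ‖y‖ ≤ R₁)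
    (h₂ : ∀ y, f y ≠ 0 → ‖y‖ ≤ R₂) {x : E n} {θ : SO n} (h : rotConv K f x θ ≠ 0) :
    ‖x‖ ≤ R₁ + R₂ := by
  by_contra! hx
  refine h (integral_eq_zero_of_ae (Filter.Eventually.of_forall fun y => ?_))
  by_contra hne
  have h3 := h₁ _ (left_ne_zero_of_mul hne)
  have h4 := h₂ _ (right_ne_zero_of_mul hne)
  rw [norm_rotate] at h3
  have : ‖x‖ ≤ ‖y‖ + ‖x - y‖ := by
    calc ‖x‖ = ‖y + (x - y)‖ := by rw [add_sub_cancel]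
      _ ≤ _ := norm_add_le _ _
  linarith

theorem integrable_kernel_mul {κ : E n → ℂ} (hκ : Measurable κ) {M R : ℝ} (hM : ∀ y, ‖κ y‖ ≤ M)
    (hR : ∀ y, κ y ≠ 0 → ‖y‖ ≤ R) {S : E n × SO n → ℂ} (hS : Measurable S) (hS1 : ∀ z, ‖S z‖ ≤ 1)
    {R' : ℝ} (hSR : ∀ z, S z ≠ 0 → ‖z.1‖ ≤ R') :
    Integrable (fun τ : (E n × SO n) × E n => κ (rotate τ.1.2 τ.2) * S τ.1)
      ((rigidMeasure n).prod volume) := by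
  have hm : Measurable fun τ : (E n × SO n) × E n => κ (rotate τ.1.2 τ.2) := by
    have h1 := measurable_rotConv_integrand hκ (f := fun _ => 1) measurable_const
    simpa using h1
  refine integrable_of_bounded_of_support (M := M) (T := {z | ‖z.1‖ ≤ R'} ×ˢ Metric.closedBall 0 R)
    (hm.mul (hS.comp measurable_fst)).aestronglyMeasurable (fun τ => ?_) ?_ fun τ hτ => ?_
  · rw [norm_mul]
    calc _ ≤ M * 1 := mul_le_mul (hM _) (hS1 _) (norm_nonneg _) ((norm_nonneg _).trans (hM 0))
      _ = M := mul_one M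
  · rw [Measure.prod_prod]
    exact ENNReal.mul_ne_top (rigidMeasure_closedBall_lt_top R') measure_closedBall_lt_top.ne
  · refine ⟨hSR _ (right_ne_zero_of_mul hτ), ?_⟩
    have := hR _ (left_ne_zero_of_mul hτ)
    rw [norm_rotate] at this
    simpa using this

theorem ofReal_mul_cpow {x y : ℝ} (hx : 0 ≤ x) (hy : 0 ≤ y) (s : ℂ) :
    ((x * y : ℝ) : ℂ) ^ s = (x : ℂ) ^ s * (y : ℂ) ^ s := by
  rw [Complex.ofReal_mul, Complex.mul_cpow_ofReal_nonneg hx hy]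

theorem enorm_ofReal_cpow {x : ℝ} (hx : 0 ≤ x) {s : ℂ} (hs : 0 < s.re) :
    ‖(x : ℂ) ^ s‖ₑ = ENNReal.ofReal x ^ s.re := by
  rw [← ofReal_norm, Complex.norm_cpow_eq_rpow_re_of_nonneg hx hs.ne',
    ENNReal.ofReal_rpow_of_nonneg hx hs.le]

/-- The endpoint estimate for bounded kernels. -/
theorem enorm_integral_kernel_le_of_bounded {K : E n → ℂ} {C : ℝ} (hKC : ∀ y, ‖K y‖ ≤ C)
    {S : E n × SO n → ℂ} (hS1 : ∀ z, ‖S z‖ ≤ 1)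
    {f : E n → ℝ} (hf : Measurable f) (hf0 : ∀ y, 0 ≤ f y) {g : E n × SO n → ℝ} (hg : Measurable g)
    (hg0 : ∀ z, 0 ≤ g z) {s : ℂ} (hs : 0 < s.re) :
    ‖∫ τ, (K (rotate τ.1.2 τ.2) * S τ.1) * ((f (τ.1.1 - τ.2) * g τ.1 : ℝ) : ℂ) ^ s
        ∂((rigidMeasure n).prod volume)‖ₑ ≤
      ENNReal.ofReal C * ((∫⁻ y, ENNReal.ofReal (f y) ^ s.re) *
        ∫⁻ z, ENNReal.ofReal (g z) ^ s.re ∂(rigidMeasure n)) := by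
  have hfm : Measurable fun y => ENNReal.ofReal (f y) ^ s.re := hf.ennreal_ofReal.pow_const _
  have hgm : Measurable fun z => ENNReal.ofReal (g z) ^ s.re := hg.ennreal_ofReal.pow_const _
  have hsub : Measurable fun τ : (E n × SO n) × E n => τ.1.1 - τ.2 := by fun_prop
  have hfm' : Measurable fun τ : (E n × SO n) × E n => ENNReal.ofReal (f (τ.1.1 - τ.2)) ^ s.re :=
    hfm.comp hsub
  have hfg : Measurable fun τ : (E n × SO n) × E n => ENNReal.ofReal (f (τ.1.1 - τ.2)) ^ s.re *
      ENNReal.ofReal (g τ.1) ^ s.re := hfm'.mul (hgm.comp measurable_fst)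
  calc _ ≤ ∫⁻ τ, ENNReal.ofReal C * (ENNReal.ofReal (f (τ.1.1 - τ.2)) ^ s.re *
        ENNReal.ofReal (g τ.1) ^ s.re) ∂((rigidMeasure n).prod volume) := by
        refine (enorm_integral_le_lintegral_enorm _).trans (lintegral_mono fun τ => ?_)
        rw [enorm_mul, enorm_mul, ofReal_mul_cpow (hf0 _) (hg0 _), enorm_mul,
          enorm_ofReal_cpow (hf0 _) hs, enorm_ofReal_cpow (hg0 _) hs]
        refine mul_le_mul' ?_ le_rfl
        calc ‖K (rotate τ.1.2 τ.2)‖ₑ * ‖S τ.1‖ₑ ≤ ENNReal.ofReal C * 1 := by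
              refine mul_le_mul' ?_ ?_
              · rw [← ofReal_norm]; exact ENNReal.ofReal_le_ofReal (hKC _)
              · rw [← ofReal_norm, ← ENNReal.ofReal_one]; exact ENNReal.ofReal_le_ofReal (hS1 _)
          _ = _ := mul_one _
    _ = _ := by
        rw [lintegral_const_mul _ hfg,
          lintegral_prod _ hfg.aemeasurable]
        congr 1
        have h1 : ∀ z : E n × SO n, ∫⁻ y, ENNReal.ofReal (f (z.1 - y)) ^ s.re *
            ENNReal.ofReal (g z) ^ s.re =
            (∫⁻ y, ENNReal.ofReal (f y) ^ s.re) * ENNReal.ofReal (g z) ^ s.re := fun z => by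
          have h2 : Measurable fun y => z.1 - y := by fun_prop
          have h3 : Measurable fun y => ENNReal.ofReal (f (z.1 - y)) ^ s.re := hfm.comp h2
          rw [lintegral_mul_const _ h3,
            lintegral_sub_left_eq_self (fun y => ENNReal.ofReal (f y) ^ s.re)]
        simp_rw [h1]
        rw [lintegral_const_mul _ hgm]

/-- The form is the pairing of `S * g` with the convolutions of `f` with the rotations of the kernel,
where the weights `f` and `g` are raised to a complex power. -/
theorem integral_kernel_eq_integral_rotConv {K : E n → ℂ} (hK : Measurable K) {M R : ℝ}
    (hM : ∀ y, ‖K y‖ ≤ M) (hR : ∀ y, K y ≠ 0 → ‖y‖ ≤ R)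
    {S : E n × SO n → ℂ} (hS : Measurable S) (hS1 : ∀ z, ‖S z‖ ≤ 1) {R' : ℝ}
    (hSR : ∀ z, S z ≠ 0 → ‖z.1‖ ≤ R') {B : ℝ} (hB : 1 ≤ B)
    {f : E n → ℝ} (hf : Measurable f) (hf0 : ∀ y, 0 ≤ f y) (hfB : ∀ y, f y ≤ B)
    {g : E n × SO n → ℝ} (hg : Measurable g) (hg0 : ∀ z, 0 ≤ g z) (hgB : ∀ z, g z ≤ B)
    {s : ℂ} (hs : 0 < s.re) :
    ∫ τ, (K (rotate τ.1.2 τ.2) * S τ.1) * ((f (τ.1.1 - τ.2) * g τ.1 : ℝ) : ℂ) ^ s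
      ∂((rigidMeasure n).prod volume) =
    ∫ z, (S z * (g z : ℂ) ^ s) * rotConv K (fun y => (f y : ℂ) ^ s) z.1 z.2 ∂(rigidMeasure n) := by
  have hsub : Measurable fun τ : (E n × SO n) × E n => τ.1.1 - τ.2 := by fun_prop
  have hint := integrable_mul_ofReal_cpow (integrable_kernel_mul hK hM hR hS hS1 hSR)
    (M := fun τ => f (τ.1.1 - τ.2) * g τ.1) ((hf.comp hsub).mul (hg.comp measurable_fst))
    (fun τ => mul_nonneg (hf0 _) (hg0 _)) (B := B * B) (by nlinarith)
    (fun τ => mul_le_mul (hfB _) (hgB _) (hg0 _) (by linarith)) hs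
  rw [integral_prod _ hint]
  refine integral_congr_ae (Filter.Eventually.of_forall fun z => ?_)
  simp only [rotConv]
  rw [← integral_const_mul]
  refine integral_congr_ae (Filter.Eventually.of_forall fun y => ?_)
  simp only
  rw [ofReal_mul_cpow (hf0 _) (hg0 _)]
  ring

/-- The endpoint estimate for kernels whose Fourier transform has bounded mean squares over
rotations. -/
theorem enorm_integral_kernel_le_of_fourier {K : E n → ℂ} (hK : Measurable K) {M R : ℝ}
    (hM : ∀ y, ‖K y‖ ≤ M) (hR : ∀ y, K y ≠ 0 → ‖y‖ ≤ R) {C : ℝ≥0∞}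
    (hC : ∀ ξ, ∫⁻ θ, ‖𝓕 K (rotate θ ξ)‖ₑ ^ 2 ∂(rotationMeasure n) ≤ C ^ 2)
    {S : E n × SO n → ℂ} (hS : Measurable S) (hS1 : ∀ z, ‖S z‖ ≤ 1) {R' : ℝ}
    (hSR : ∀ z, S z ≠ 0 → ‖z.1‖ ≤ R') {B : ℝ} (hB : 1 ≤ B)
    {f : E n → ℝ} (hf : Measurable f) (hf0 : ∀ y, 0 ≤ f y) (hfB : ∀ y, f y ≤ B) {Rf : ℝ}
    (hfR : ∀ y, f y ≠ 0 → ‖y‖ ≤ Rf)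
    {g : E n × SO n → ℝ} (hg : Measurable g) (hg0 : ∀ z, 0 ≤ g z) (hgB : ∀ z, g z ≤ B)
    {s : ℂ} (hs : 0 < s.re) {p : ℝ} (hp : 2 * s.re = p) :
    ‖∫ τ, (K (rotate τ.1.2 τ.2) * S τ.1) * ((f (τ.1.1 - τ.2) * g τ.1 : ℝ) : ℂ) ^ s
        ∂((rigidMeasure n).prod volume)‖ₑ ≤
      C * ((∫⁻ y, ENNReal.ofReal (f y) ^ p) *
        ∫⁻ z, ENNReal.ofReal (g z) ^ p ∂(rigidMeasure n)) ^ (1 / 2 : ℝ) := by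
  have hs0 : s ≠ 0 := fun h => by simp [h] at hs
  set φ : E n → ℂ := fun y => (f y : ℂ) ^ s with hφ
  have hφm : Measurable φ := measurable_ofReal_cpow hf s
  have hφB : ∀ y, ‖φ y‖ ≤ B ^ s.re := fun y => norm_cpow_le_of_le (hf0 y) (hfB y) hB hs le_rfl
  have hφi : Integrable φ := by
    refine integrable_of_bounded_of_support hφm.aestronglyMeasurable hφB
      (T := Metric.closedBall 0 Rf) measure_closedBall_lt_top.ne fun y hy => ?_
    have : f y ≠ 0 := fun h => hy (by simp [hφ, h, hs0])
    simpa using hfR y this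
  have hKi : Integrable K := integrable_of_bounded_of_support hK.aestronglyMeasurable hM
    (T := Metric.closedBall 0 R) measure_closedBall_lt_top.ne fun y hy => by simpa using hR y hy
  set ρ : E n × SO n → ℂ := fun z => rotConv K φ z.1 z.2 with hρ
  have hρm : Measurable ρ := measurable_rotConv hK hφm
  have hgm : Measurable fun z => (g z : ℂ) ^ s := measurable_ofReal_cpow hg s
  have hhalf : ∀ {x : ℝ}, 0 ≤ x → ‖(x : ℂ) ^ s‖ₑ ^ (2 : ℝ) = ENNReal.ofReal x ^ p := by
    intro x hx
    rw [enorm_ofReal_cpow hx hs, ← ENNReal.rpow_mul, mul_comm, hp]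
  have hρ2 : ∫⁻ z, ‖ρ z‖ₑ ^ (2 : ℝ) ∂(rigidMeasure n) ≤
      C ^ 2 * ∫⁻ y, ENNReal.ofReal (f y) ^ p := by
    rw [lintegral_prod_symm _ (hρm.enorm.pow_const _).aemeasurable]
    have h1 := lintegral_rotConv_sq_le hKi hM hφi (memLp_two_of_bounded hφi hφB) hC
    have h2 : ∫⁻ y, ‖φ y‖ₑ ^ 2 = ∫⁻ y, ENNReal.ofReal (f y) ^ p :=
      lintegral_congr fun y => by rw [← hhalf (hf0 y), ENNReal.rpow_two]
    rw [h2] at h1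
    simpa only [ENNReal.rpow_two] using h1
  rw [integral_kernel_eq_integral_rotConv hK hM hR hS hS1 hSR hB hf hf0 hfB hg hg0 hgB hs]
  calc _ ≤ ∫⁻ z, ‖(g z : ℂ) ^ s‖ₑ * ‖ρ z‖ₑ ∂(rigidMeasure n) := by
        refine (enorm_integral_le_lintegral_enorm _).trans (lintegral_mono fun z => ?_)
        rw [enorm_mul, enorm_mul]
        refine mul_le_mul' ?_ le_rfl
        calc ‖S z‖ₑ * ‖(g z : ℂ) ^ s‖ₑ ≤ 1 * ‖(g z : ℂ) ^ s‖ₑ := by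
              refine mul_le_mul' ?_ le_rfl
              rw [← ofReal_norm, ← ENNReal.ofReal_one]; exact ENNReal.ofReal_le_ofReal (hS1 _)
          _ = _ := one_mul _
    _ ≤ (∫⁻ z, ‖(g z : ℂ) ^ s‖ₑ ^ (2 : ℝ) ∂(rigidMeasure n)) ^ (1 / 2 : ℝ) *
        (∫⁻ z, ‖ρ z‖ₑ ^ (2 : ℝ) ∂(rigidMeasure n)) ^ (1 / 2 : ℝ) :=
        ENNReal.lintegral_mul_le_Lp_mul_Lq _ Real.HolderConjugate.two_two
          hgm.enorm.aemeasurable hρm.enorm.aemeasurable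
    _ ≤ (∫⁻ z, ENNReal.ofReal (g z) ^ p ∂(rigidMeasure n)) ^ (1 / 2 : ℝ) *
        (C ^ 2 * ∫⁻ y, ENNReal.ofReal (f y) ^ p) ^ (1 / 2 : ℝ) := by
        refine mul_le_mul' (le_of_eq ?_) (ENNReal.rpow_le_rpow hρ2 (by norm_num))
        congr 1
        exact lintegral_congr fun z => hhalf (hg0 z)
    _ = _ := by
        rw [ENNReal.mul_rpow_of_nonneg _ _ (by norm_num : (0 : ℝ) ≤ 1 / 2),
          ENNReal.mul_rpow_of_nonneg _ _ (by norm_num : (0 : ℝ) ≤ 1 / 2), ← ENNReal.rpow_two,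
          ← ENNReal.rpow_mul]
        norm_num
        ring

end RotatedForms

/-! ### Complex interpolation for rotated kernels -/

section SteinInterpolation

open FourierTransform

variable {n : ℕ}

/-- The numerical content of the duality argument: the interpolated bound for the form, tested on
the extremal function, is the bound for the operator. -/
theorem rpow_inv_le_of_le_interp {P Q C₀ C₁ p q t : ℝ} (hP : 0 ≤ P) (hQ : 0 ≤ Q) (hC₀ : 0 ≤ C₀)
    (hC₁ : 0 ≤ C₁) (hpt : p * (1 - t / 2) = 1) (hpq : p.HolderConjugate q) (ht0 : 0 ≤ t)
    (ht1 : t ≤ 1) (h : Q ≤ (C₀ * (P * Q)) ^ (1 - t) * (C₁ * (P * Q) ^ (1 / 2 : ℝ)) ^ t) :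
    Q ^ (1 / q) ≤ C₀ ^ (1 - t) * C₁ ^ t * P ^ (1 / p) := by
  have hp0 : 0 < p := hpq.pos
  have hq0 : 0 < q := hpq.symm.pos
  have hpt' : 1 - t / 2 = 1 / p := by rw [eq_div_iff hp0.ne']; linarith
  rcases hQ.eq_or_lt with rfl | hQ0
  · rw [Real.zero_rpow (by positivity)]; positivity
  have h1 : (C₀ * (P * Q)) ^ (1 - t) * (C₁ * (P * Q) ^ (1 / 2 : ℝ)) ^ t =
      C₀ ^ (1 - t) * C₁ ^ t * P ^ (1 / p) * Q ^ (1 / p) := by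
    rw [Real.mul_rpow hC₀ (by positivity), Real.mul_rpow hC₁ (by positivity),
      ← Real.rpow_mul (by positivity), mul_mul_mul_comm,
      ← Real.rpow_add_of_nonneg (by positivity) (by linarith) (by positivity),
      show 1 - t + 1 / 2 * t = 1 / p by rw [← hpt']; ring, Real.mul_rpow hP hQ]
    ring
  have h2 : Q ^ (1 / q) * Q ^ (1 / p) = Q := by
    rw [← Real.rpow_add hQ0, one_div, one_div, add_comm, hpq.inv_add_inv_eq_one, Real.rpow_one]
  have h3 : 0 < Q ^ (1 / p) := by positivity
  refine le_of_mul_le_mul_right ?_ h3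
  rw [h2, ← h1]
  exact h

/-- **Complex interpolation** for convolutions with the rotations of the members of an analytic
family of kernels, bounded on one side of the strip, and with Fourier transforms of bounded mean
square over rotations on the other side. -/
theorem lintegral_rotConv_rpow_le {N : ℕ} {κ : ℕ → E n → ℂ} (hκ : ∀ i, Measurable (κ i))
    {Mκ : ℕ → ℝ} (hκM : ∀ i y, ‖κ i y‖ ≤ Mκ i) {R : ℝ} (hκR : ∀ i y, κ i y ≠ 0 → ‖y‖ ≤ R)
    {W : ℕ → ℂ → ℂ} (hW : ∀ i, Differentiable ℂ (W i)) {Wb : ℕ → ℝ}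
    (hWb : ∀ i, ∀ z : ℂ, 0 ≤ z.re → z.re ≤ 1 → ‖W i z‖ ≤ Wb i) {C₀ C₁ : ℝ} (hC₀ : 0 ≤ C₀)
    (hC₁ : 0 ≤ C₁)
    (h0 : ∀ z : ℂ, z.re = 0 → ∀ y, ‖∑ i ∈ Finset.range N, W i z * κ i y‖ ≤ C₀)
    (h1 : ∀ z : ℂ, z.re = 1 → ∀ ξ, ∫⁻ θ, ‖𝓕 (fun y => ∑ i ∈ Finset.range N, W i z * κ i y)
      (rotate θ ξ)‖ₑ ^ 2 ∂(rotationMeasure n) ≤ ENNReal.ofReal C₁ ^ 2)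
    {p q t : ℝ} (ht0 : 0 ≤ t) (ht1 : t ≤ 1) (hpt : p * (1 - t / 2) = 1)
    (hpq : p.HolderConjugate q) {f : E n → ℝ} (hf : Measurable f) (hf0 : ∀ y, 0 ≤ f y) {Bf Rf : ℝ}
    (hfB : ∀ y, f y ≤ Bf) (hfR : ∀ y, f y ≠ 0 → ‖y‖ ≤ Rf) :
    (∫⁻ z, ‖rotConv (fun y => ∑ i ∈ Finset.range N, W i t * κ i y) (fun y => (f y : ℂ)) z.1 z.2‖ₑ
        ^ q ∂(rigidMeasure n)) ^ (1 / q) ≤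
      ENNReal.ofReal (C₀ ^ (1 - t) * C₁ ^ t) * (∫⁻ y, ENNReal.ofReal (f y) ^ p) ^ (1 / p) := by
  have hp0 : 0 < p := hpq.pos
  have hq0 : 0 < q := hpq.symm.pos
  have hq1 : 0 < q - 1 := by linarith [hpq.symm.lt]
  have hqp : (q - 1) * p = q := by
    have := hpq.sub_one_mul_conj; have := hpq.symm.sub_one_mul_conj; linarith
  obtain ⟨K, hK⟩ : ∃ K : ℂ → E n → ℂ, ∀ z, K z = fun y => ∑ i ∈ Finset.range N, W i z * κ i y :=
    ⟨_, fun _ => rfl⟩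
  have hKm : ∀ z, Measurable (K z) := fun z => by
    rw [hK]; exact Finset.measurable_sum _ fun i _ => (hκ i).const_mul _
  have hKb : ∀ z, ∃ M, ∀ y, ‖K z y‖ ≤ M := fun z => by
    refine ⟨∑ i ∈ Finset.range N, ‖W i z‖ * Mκ i, fun y => ?_⟩
    rw [hK]
    refine norm_sum_le_of_le _ fun i _ => ?_
    rw [norm_mul]
    exact mul_le_mul_of_nonneg_left (hκM i y) (norm_nonneg _)
  have hKR : ∀ z y, K z y ≠ 0 → ‖y‖ ≤ R := fun z y hy => by
    rw [hK] at hy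
    obtain ⟨i, _, hi⟩ := Finset.exists_ne_zero_of_sum_ne_zero hy
    exact hκR i y (right_ne_zero_of_mul hi)
  have hfm : Measurable fun y => (f y : ℂ) := Complex.measurable_ofReal.comp hf
  have hfi : Integrable fun y => (f y : ℂ) := by
    refine integrable_of_bounded_of_support hfm.aestronglyMeasurable (M := Bf) (fun y => ?_)
      (T := Metric.closedBall 0 Rf) measure_closedBall_lt_top.ne fun y hy => ?_
    · rw [Complex.norm_real, Real.norm_of_nonneg (hf0 y)]; exact hfB y
    · simpa using hfR y (by exact_mod_cast hy)
  rw [← hK]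
  set h : E n × SO n → ℂ := fun z => rotConv (K t) (fun y => (f y : ℂ)) z.1 z.2 with hh
  have hhm : Measurable h := measurable_rotConv (hKm t) hfm
  obtain ⟨Bh, hBh⟩ : ∃ Bh, ∀ z, ‖h z‖ ≤ Bh := by
    obtain ⟨M, hM⟩ := hKb t
    exact ⟨_, fun z => norm_rotConv_le hM hfi z.1 z.2⟩
  have hhR : ∀ z, h z ≠ 0 → ‖z.1‖ ≤ R + Rf := fun z hz =>
    norm_le_of_rotConv_ne_zero (hKR t) (fun y hy => hfR y (by exact_mod_cast hy)) hz
  -- the extremal function for the dual norm of `h` is `S * g`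
  set S : E n × SO n → ℂ := fun z => (starRingEnd ℂ) (h z) * ((‖h z‖⁻¹ : ℝ) : ℂ) with hS
  set g : E n × SO n → ℝ := fun z => ‖h z‖ ^ (q - 1) with hg
  have hSm : Measurable S := (Complex.continuous_conj.measurable.comp hhm).mul
    (Complex.measurable_ofReal.comp hhm.norm.inv)
  have hS1 : ∀ z, ‖S z‖ ≤ 1 := fun z => by
    simp only [hS]
    rw [norm_mul, RCLike.norm_conj, Complex.norm_real, norm_inv, norm_norm]
    exact mul_inv_le_one
  have hSR : ∀ z, S z ≠ 0 → ‖z.1‖ ≤ R + Rf := fun z hz => hhR z fun h0 => hz (by simp [hS, h0])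
  have hgm : Measurable g := hhm.norm.pow_const _
  have hg0 : ∀ z, 0 ≤ g z := fun z => Real.rpow_nonneg (norm_nonneg _) _
  have hgB : ∀ z, g z ≤ Bh ^ (q - 1) := fun z => Real.rpow_le_rpow (norm_nonneg _) (hBh z) hq1.le
  set B : ℝ := max 1 (max Bf (Bh ^ (q - 1))) with hB_def
  have hB1 : 1 ≤ B := le_max_left _ _
  have hfB' : ∀ y, f y ≤ B := fun y => (hfB y).trans ((le_max_left _ _).trans (le_max_right _ _))
  have hgB' : ∀ z, g z ≤ B := fun z => (hgB z).trans ((le_max_right _ _).trans (le_max_right _ _))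
  have hgp : ∀ z, ENNReal.ofReal (g z) ^ p = ‖h z‖ₑ ^ q := fun z => by
    rw [ENNReal.ofReal_rpow_of_nonneg (hg0 z) hp0.le, ← Real.rpow_mul (norm_nonneg _), hqp,
      ← ENNReal.ofReal_rpow_of_nonneg (norm_nonneg _) hq0.le, ofReal_norm]
  set Pe := ∫⁻ y, ENNReal.ofReal (f y) ^ p with hPe
  set Qe := ∫⁻ z, ‖h z‖ₑ ^ q ∂(rigidMeasure n) with hQe
  have hQg : ∫⁻ z, ENNReal.ofReal (g z) ^ p ∂(rigidMeasure n) = Qe := lintegral_congr hgp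
  have hPfin : Pe ≠ ⊤ := by
    have : Pe ≤ ∫⁻ _y in Metric.closedBall (0 : E n) Rf, ENNReal.ofReal Bf ^ p := by
      rw [hPe, ← lintegral_indicator measurableSet_closedBall]
      refine lintegral_mono fun y => ?_
      by_cases hy : f y = 0
      · simp [hy, hp0]
      · rw [indicator_of_mem (by simpa using hfR y hy)]
        exact ENNReal.rpow_le_rpow (ENNReal.ofReal_le_ofReal (hfB y)) hp0.le
    refine ne_top_of_le_ne_top ?_ this
    rw [setLIntegral_const]
    exact ENNReal.mul_ne_top (ENNReal.rpow_ne_top_of_nonneg hp0.le ENNReal.ofReal_ne_top)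
      measure_closedBall_lt_top.ne
  have hQi : Integrable (fun z => ((‖h z‖ ^ q : ℝ) : ℂ)) (rigidMeasure n) := by
    refine integrable_of_bounded_of_support
      (Complex.measurable_ofReal.comp (hhm.norm.pow_const q)).aestronglyMeasurable
      (M := Bh ^ q) (fun z => ?_) (rigidMeasure_closedBall_lt_top (R + Rf)) fun z hz => ?_
    · rw [Complex.norm_real, Real.norm_of_nonneg (by positivity)]
      exact Real.rpow_le_rpow (norm_nonneg _) (hBh z) hq0.le
    · exact hhR z fun h0 => hz (by simp [h0, hq0.ne'])
  have hQi' : Integrable (fun z => ‖h z‖ ^ q) (rigidMeasure n) := by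
    simpa using hQi.re
  set Q : ℝ := ∫ z, ‖h z‖ ^ q ∂(rigidMeasure n) with hQ
  have hQ0 : 0 ≤ Q := integral_nonneg fun z => by positivity
  have hQQ : Qe = ENNReal.ofReal Q := by
    rw [hQ, ofReal_integral_eq_lintegral_ofReal hQi' (Filter.Eventually.of_forall fun z => by
      positivity)]
    refine lintegral_congr fun z => ?_
    rw [← ENNReal.ofReal_rpow_of_nonneg (norm_nonneg _) hq0.le, ofReal_norm]
  set P : ℝ := Pe.toReal with hP
  have hPP : Pe = ENNReal.ofReal P := (ENNReal.ofReal_toReal hPfin).symm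
  have hP0 : 0 ≤ P := ENNReal.toReal_nonneg
  have hre : ∀ z : ℂ, ((p : ℂ) * (1 - z / 2)).re = p * (1 - z.re / 2) := fun z => by
    rw [Complex.re_ofReal_mul]
    simp
  have hsub : Measurable fun τ : (E n × SO n) × E n => τ.1.1 - τ.2 := by fun_prop
  have hMm : Measurable fun τ : (E n × SO n) × E n => f (τ.1.1 - τ.2) * g τ.1 :=
    (hf.comp hsub).mul (hgm.comp measurable_fst)
  have hM0 : ∀ τ : (E n × SO n) × E n, 0 ≤ f (τ.1.1 - τ.2) * g τ.1 := fun τ =>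
    mul_nonneg (hf0 _) (hg0 _)
  have hMB : ∀ τ : (E n × SO n) × E n, f (τ.1.1 - τ.2) * g τ.1 ≤ B * B := fun τ =>
    mul_le_mul (hfB' _) (hgB' _) (hg0 _) (by linarith)
  have hAi : ∀ i, Integrable (fun τ : (E n × SO n) × E n => κ i (rotate τ.1.2 τ.2) * S τ.1)
      ((rigidMeasure n).prod volume) := fun i =>
    integrable_kernel_mul (hκ i) (hκM i) (hκR i) hSm hS1 hSR
  have hsum : ∀ z s : ℂ, 0 < s.re → ∑ i ∈ Finset.range N, W i z *
      ∫ τ, (κ i (rotate τ.1.2 τ.2) * S τ.1) * ((f (τ.1.1 - τ.2) * g τ.1 : ℝ) : ℂ) ^ s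
        ∂((rigidMeasure n).prod volume) =
      ∫ τ, (K z (rotate τ.1.2 τ.2) * S τ.1) * ((f (τ.1.1 - τ.2) * g τ.1 : ℝ) : ℂ) ^ s
        ∂((rigidMeasure n).prod volume) := by
    intro z s hs
    simp_rw [← integral_const_mul]
    rw [← integral_finsetSum _ fun i _ => (integrable_mul_ofReal_cpow (hAi i) hMm hM0
      (by nlinarith) hMB hs).const_mul _]
    refine integral_congr_ae (Filter.Eventually.of_forall fun τ => ?_)
    simp only [hK, Finset.sum_mul]
    exact Finset.sum_congr rfl fun i _ => by ring
  have hspos : ∀ z : ℂ, z.re ≤ 1 → 0 < ((p : ℂ) * (1 - z / 2)).re := fun z hz => by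
    rw [hre]
    have : 0 < 1 - z.re / 2 := by linarith
    positivity
  have hmain := norm_sum_integral_cpow_le_interp (Finset.range N) (fun i _ => hAi i) hMm hM0
    (by nlinarith : 1 ≤ B * B) hMB (fun i _ => hW i) (fun i _ => hWb i) hp0 ht0 ht1
    (a := C₀ * (P * Q)) (b := C₁ * (P * Q) ^ (1 / 2 : ℝ)) ?_ ?_
  · have hst : (p : ℂ) * (1 - (t : ℂ) / 2) = 1 := by exact_mod_cast hpt
    have hval : ∑ i ∈ Finset.range N, W i t * ∫ τ, (κ i (rotate τ.1.2 τ.2) * S τ.1) *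
        ((f (τ.1.1 - τ.2) * g τ.1 : ℝ) : ℂ) ^ ((p : ℂ) * (1 - (t : ℂ) / 2))
          ∂((rigidMeasure n).prod volume) = (Q : ℂ) := by
      obtain ⟨M, hM⟩ := hKb t
      rw [hst, hsum _ _ (by simp), integral_kernel_eq_integral_rotConv (hKm t) hM (hKR t) hSm hS1
        hSR hB1 hf hf0 hfB' hgm hg0 hgB' (by simp), hQ, ← integral_complex_ofReal]
      refine integral_congr_ae (Filter.Eventually.of_forall fun z => ?_)
      simp only [Complex.cpow_one]
      change S z * (g z : ℂ) * h z = _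
      by_cases h0 : h z = 0
      · simp [h0, hq0.ne']
      · have hn : 0 < ‖h z‖ := norm_pos_iff.mpr h0
        have e1 : S z * (g z : ℂ) * h z =
            (h z * (starRingEnd ℂ) (h z)) * ((‖h z‖⁻¹ * ‖h z‖ ^ (q - 1) : ℝ) : ℂ) := by
          simp only [hS, hg]
          push_cast
          ring
        rw [e1, Complex.mul_conj, Complex.normSq_eq_norm_sq, ← Complex.ofReal_mul]
        congr 1
        rw [Real.rpow_sub_one hn.ne']
        field_simp
    rw [hval, Complex.norm_real, Real.norm_of_nonneg hQ0] at hmain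
    have := rpow_inv_le_of_le_interp hP0 hQ0 hC₀ hC₁ hpt hpq ht0 ht1 hmain
    rw [hQQ, hPP, ENNReal.ofReal_rpow_of_nonneg hQ0 (by positivity),
      ENNReal.ofReal_rpow_of_nonneg hP0 (by positivity), ← ENNReal.ofReal_mul (by positivity)]
    exact ENNReal.ofReal_le_ofReal this
  · intro z hz
    rw [hsum z _ (hspos z (by linarith))]
    have hb := enorm_integral_kernel_le_of_bounded (K := K z) (C := C₀)
      (fun y => by rw [hK]; exact h0 z hz y) hS1 hf hf0 hgm hg0 (hspos z (by linarith))
    rw [hre, hz, zero_div, sub_zero, mul_one, hQg, ← hPe, hPP, hQQ, ← ENNReal.ofReal_mul hP0,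
      ← ENNReal.ofReal_mul hC₀, ← ofReal_norm] at hb
    exact (ENNReal.ofReal_le_ofReal_iff (by positivity)).mp hb
  · intro z hz
    rw [hsum z _ (hspos z (by linarith))]
    obtain ⟨M, hM⟩ := hKb z
    have hb := enorm_integral_kernel_le_of_fourier (hKm z) hM (hKR z) (C := ENNReal.ofReal C₁)
      (fun ξ => by rw [hK]; exact h1 z hz ξ) hSm hS1 hSR hB1 hf hf0 hfB' hfR hgm hg0 hgB'
      (hspos z (by linarith)) (p := p) (by rw [hre, hz]; ring)
    rw [hQg, ← hPe, hPP, hQQ, ← ENNReal.ofReal_mul hP0,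
      ENNReal.ofReal_rpow_of_nonneg (by positivity) (by positivity),
      ← ENNReal.ofReal_mul hC₁, ← ofReal_norm] at hb
    exact (ENNReal.ofReal_le_ofReal_iff (by positivity)).mp hb

end SteinInterpolation

/-! ### Uniform bounds for smeared densities -/

section SmearedPatch

open FourierTransform

variable {n k m : ℕ} {ε : ℝ}

theorem norm_dilate_two_pow_le {Ψ : E m → ℂ} {M : ℝ} (hM : ∀ v, ‖Ψ v‖ ≤ M) (j : ℕ) (v : E m) :
    ‖dilate (2 ^ j) Ψ v‖ ≤ (2 ^ j) ^ m * M := by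
  rw [dilate, norm_mul, norm_pow, Complex.norm_real, Real.norm_of_nonneg (by positivity)]
  gcongr
  exact hM _

theorem norm_le_of_dilate_two_pow_ne_zero {Ψ : E m → ℂ} {R : ℝ} (hR : ∀ v, Ψ v ≠ 0 → ‖v‖ ≤ R)
    {j : ℕ} {v : E m} (hv : dilate (2 ^ j) Ψ v ≠ 0) : ‖v‖ ≤ R := by
  have h1 := hR _ (right_ne_zero_of_mul hv)
  rw [norm_smul, Real.norm_of_nonneg (by positivity)] at h1
  have h2 : (1 : ℝ) ≤ 2 ^ j := one_le_pow₀ one_le_two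
  nlinarith [norm_nonneg v]

theorem norm_dyadicPiece_le {Ψ : E m → ℂ} {M : ℝ} (hM : ∀ v, ‖Ψ v‖ ≤ M) (j : ℕ) (v : E m) :
    ‖dyadicPiece Ψ j v‖ ≤ (2 ^ (j + 1)) ^ m * M + (2 ^ j) ^ m * M :=
  (norm_sub_le _ _).trans (add_le_add (norm_dilate_two_pow_le hM _ v)
    (norm_dilate_two_pow_le hM _ v))

theorem norm_le_of_dyadicPiece_ne_zero {Ψ : E m → ℂ} {R : ℝ} (hR : ∀ v, Ψ v ≠ 0 → ‖v‖ ≤ R)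
    {j : ℕ} {v : E m} (hv : dyadicPiece Ψ j v ≠ 0) : ‖v‖ ≤ R := by
  by_cases h : dilate (2 ^ j) Ψ v = 0
  · refine norm_le_of_dilate_two_pow_ne_zero hR (j := j + 1) fun h' => hv ?_
    rw [dyadicPiece, h, h', sub_zero]
  · exact norm_le_of_dilate_two_pow_ne_zero hR h

theorem differentiable_dyadicWeight (j : ℕ) : Differentiable ℂ (dyadicWeight j) := by
  unfold dyadicWeight
  fun_prop

theorem norm_dyadicWeight_le {j : ℕ} {w : ℂ} {c : ℝ} (hw : -c ≤ w.re) :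
    ‖dyadicWeight j w‖ ≤ Real.exp (c * Real.log 2) ^ (j + 1) := by
  rw [norm_dyadicWeight]
  refine pow_le_pow_left₀ (Real.exp_nonneg _) (Real.exp_le_exp.mpr ?_) _
  nlinarith [Real.log_pos one_lt_two]

theorem GraphDensity.patchKernel_dyadicKernel (G : GraphDensity k m ε)
    (D : OrthogonalSplitting n k m) (Ψ : E m → ℂ) (J : ℕ) (w : ℂ) (y : E n) :
    G.patchKernel D (dyadicKernel Ψ J w) y = G.patchKernel D Ψ y +
      ∑ j ∈ Finset.range J, dyadicWeight j w * G.patchKernel D (dyadicPiece Ψ j) y := by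
  simp only [patchKernel, dyadicKernel, mul_add, Finset.mul_sum]
  congr 1
  exact Finset.sum_congr rfl fun j _ => by ring

/-- The bound for the smeared densities, uniform in the scale of the smearing. The two sides of
the strip are the lines `re w = m` and `re w = -k / 2` of the family of dyadic kernels, and the
point `w = 0` divides it in the ratio that gives the exponents of the theorem. -/
theorem GraphDensity.exists_lintegral_rotConv_dilate_le (G : GraphDensity k m ε)
    (D : OrthogonalSplitting n k m) (hk : 1 ≤ k) (hm : 1 ≤ m) (hε : 0 ≤ ε)
    (hεn : 64 * n ^ 2 * ε ≤ 1) {p q : ℝ} (hp : p = (2 * n - k : ℝ) / n)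
    (hpq : p.HolderConjugate q) {Ψ : E m → ℂ}
    (hΨm : Measurable Ψ) (hΨi : Integrable Ψ) {M : ℝ} (hΨM : ∀ v, ‖Ψ v‖ ≤ M) {L : ℕ}
    (hΨL : ∀ v, Ψ v ≠ 0 → 1 ≤ ‖v‖ ∧ ‖v‖ ≤ 2 ^ L) {A : ℝ}
    (hΨA : ∀ η, ‖𝓕 Ψ η - 1‖ ≤ A * ‖η‖ ^ k) :
    ∃ C : ℝ, 0 ≤ C ∧ ∀ (J : ℕ) (f : E n → ℝ) (Bf Rf : ℝ), Measurable f → (∀ y, 0 ≤ f y) →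
      (∀ y, f y ≤ Bf) → (∀ y, f y ≠ 0 → ‖y‖ ≤ Rf) →
      (∫⁻ z, ‖rotConv (G.patchKernel D (dilate (2 ^ J) Ψ)) (fun y => (f y : ℂ)) z.1 z.2‖ₑ
        ^ q ∂(rigidMeasure n)) ^ (1 / q) ≤
      ENNReal.ofReal C * (∫⁻ y, ENNReal.ofReal (f y) ^ p) ^ (1 / p) := by
  have hM0 : 0 ≤ M := (norm_nonneg _).trans (hΨM 0)
  have hkm : (k : ℝ) + m = n := by exact_mod_cast D.add_eq
  have hk' : (1 : ℝ) ≤ k := by exact_mod_cast hk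
  have hm' : (1 : ℝ) ≤ m := by exact_mod_cast hm
  obtain ⟨Mχ, hMχ0, hMχ⟩ := G.exists_χ_le
  obtain ⟨C₂, hC₂0, hC₂⟩ := G.exists_lintegral_fourier_patchKernel_sq_le D hk hε hεn
  obtain ⟨C₃, hC₃0, hC₃⟩ := exists_norm_fourier_dyadicKernel_sq_le hΨi hk hΨA
  obtain ⟨R', hR'⟩ := G.exists_norm_le_of_patchKernel_ne_zero D (2 ^ L)
  set t : ℝ := 2 * m / (n + m) with ht
  have ht0 : 0 ≤ t := by positivity
  have ht1 : t ≤ 1 := by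
    rw [ht, div_le_one (by linarith)]; linarith
  have hpt : p * (1 - t / 2) = 1 := by
    rw [hp, ht]
    have h1 : (n : ℝ) ≠ 0 := by linarith
    have h2 : (n : ℝ) + m ≠ 0 := by linarith
    field_simp
    linear_combination (-(n : ℝ)) * hkm
  have hΨR : ∀ v, Ψ v ≠ 0 → ‖v‖ ≤ 2 ^ L := fun v hv => (hΨL v hv).2
  set w : ℂ → ℂ := fun z => m * (1 - z) - (k / 2 : ℝ) * z with hw
  have hwre : ∀ z : ℂ, (w z).re = m * (1 - z.re) - k / 2 * z.re := fun z => by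
    simp only [hw]
    rw [Complex.sub_re, Complex.re_ofReal_mul, ← Complex.ofReal_natCast, Complex.re_ofReal_mul]
    simp
  have hwt : w t = 0 := by
    have : (m : ℝ) * (1 - t) - k / 2 * t = 0 := by
      rw [ht]
      have h2 : (n : ℝ) + m ≠ 0 := by linarith
      field_simp
      rw [← hkm]
      ring
    simp only [hw]
    exact_mod_cast this
  have hwd : Differentiable ℂ w := by fun_prop
  refine ⟨(Mχ * (M + 2 * ((L + 1) * M))) ^ (1 - t) * (√(C₃ * C₂)) ^ t, by positivity,
    fun J f Bf Rf hf hf0 hfB hfR => ?_⟩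
  let κ : ℕ → E n → ℂ := fun i => match i with
    | 0 => G.patchKernel D Ψ
    | j + 1 => G.patchKernel D (dyadicPiece Ψ j)
  let W : ℕ → ℂ → ℂ := fun i => match i with
    | 0 => fun _ => 1
    | j + 1 => fun z => dyadicWeight j (w z)
  let Mκ : ℕ → ℝ := fun i => match i with
    | 0 => Mχ * M
    | j + 1 => Mχ * ((2 ^ (j + 1)) ^ m * M + (2 ^ j) ^ m * M)
  let Wb : ℕ → ℝ := fun i => match i with
    | 0 => 1
    | j + 1 => Real.exp (k / 2 * Real.log 2) ^ (j + 1)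
  have hsum : ∀ z y, ∑ i ∈ Finset.range (J + 1), W i z * κ i y =
      G.patchKernel D (dyadicKernel Ψ J (w z)) y := by
    intro z y
    rw [G.patchKernel_dyadicKernel, Finset.sum_range_succ', add_comm]
    simp only [W, κ, one_mul]
  have key := lintegral_rotConv_rpow_le (N := J + 1) (κ := κ) (Mκ := Mκ) (R := R') (W := W)
    (Wb := Wb) (C₀ := Mχ * (M + 2 * ((L + 1) * M))) (C₁ := √(C₃ * C₂)) (p := p) (q := q) (t := t)
    (f := f) (Bf := Bf) (Rf := Rf) ?_ ?_ ?_ ?_ ?_ (by positivity) (by positivity) ?_ ?_ ht0 ht1 hpt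
    hpq hf hf0 hfB hfR
  · simp only [hsum, hwt, dyadicKernel_zero] at key
    exact key
  · rintro (_ | j)
    · exact G.measurable_patchKernel D hΨm
    · exact G.measurable_patchKernel D (measurable_dyadicPiece hΨm j)
  · rintro (_ | j) y
    · exact G.norm_patchKernel_le D hMχ0 hMχ hΨM y
    · exact G.norm_patchKernel_le D hMχ0 hMχ (norm_dyadicPiece_le hΨM j) y
  · rintro (_ | j) y hy
    · exact hR' _ hΨR y hy
    · exact hR' _ (fun v hv => norm_le_of_dyadicPiece_ne_zero hΨR hv) y hy
  · rintro (_ | j)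
    · exact differentiable_const _
    · exact (differentiable_dyadicWeight j).comp hwd
  · rintro (_ | j) z hz0 hz1
    · exact norm_one.le
    · refine norm_dyadicWeight_le ?_
      rw [hwre]
      nlinarith
  · intro z hz y
    rw [hsum]
    refine G.norm_patchKernel_le D hMχ0 hMχ (norm_dyadicKernel_le hΨM hΨL J ?_) y
    rw [hwre, hz]; ring
  · intro z hz ξ
    simp only [hsum]
    rw [← ENNReal.ofReal_pow (Real.sqrt_nonneg _), Real.sq_sqrt (by positivity)]
    refine hC₂ _ C₃ (integrable_dyadicKernel hΨi J (w z)) hC₃0 (hC₃ J (w z) ?_) ξ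
    rw [hwre, hz]; ring

end SmearedPatch

/-! ### Averages of continuous functions over a patch -/

section PatchAverage

open FourierTransform Filter

variable {n k m : ℕ} {ε : ℝ}

theorem measurable_sub_rotate {X : Type*} [MeasurableSpace X] {φ : X → E n} (hφ : Measurable φ) :
    Measurable fun τ : (E n × SO n) × X => τ.1.1 - rotate τ.1.2⁻¹ (φ τ.2) := by
  have h3 : Measurable fun τ : (E n × SO n) × X => (τ.1.2⁻¹, φ τ.2) := by
    have h4 : Measurable fun τ : (E n × SO n) × X => τ.1.2 := by fun_prop
    exact h4.inv.prodMk (hφ.comp measurable_snd)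
  have h4 := measurable_rotate.comp h3
  have h5 : Measurable fun τ : (E n × SO n) × X => τ.1.1 := by fun_prop
  have h6 := h5.sub h4
  exact h6

section NullSets

variable {X : Type*} [MeasurableSpace X] {τ : Measure X} [SFinite τ] {φ : X → E n} {P : E n → Prop}

/-- Almost every translate of a null set is a null set for a given s-finite measure. -/
theorem ae_ae_sub_rotate_right (hφ : Measurable φ) (hP : ∀ᵐ y, P y) (θ : SO n) :
    ∀ᵐ x, ∀ᵐ u ∂τ, P (x - rotate θ⁻¹ (φ u)) := by
  obtain ⟨N, hPN, hNm, hN0⟩ := exists_measurable_superset_of_null (ae_iff.mp hP)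
  have hsub : Measurable fun w : E n × X => w.1 - rotate θ⁻¹ (φ w.2) :=
    (measurable_sub_rotate hφ).comp
      ((measurable_fst.prodMk (measurable_const (a := θ))).prodMk measurable_snd)
  have hmeas : Measurable fun w : E n × X =>
      N.indicator (fun _ => (1 : ℝ≥0∞)) (w.1 - rotate θ⁻¹ (φ w.2)) :=
    (measurable_const.indicator hNm).comp hsub
  have hnull : ∫⁻ x, (∫⁻ u, N.indicator (fun _ => (1 : ℝ≥0∞)) (x - rotate θ⁻¹ (φ u)) ∂τ) = 0 := by
    rw [lintegral_lintegral_swap hmeas.aemeasurable]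
    refine (lintegral_congr fun u => ?_).trans lintegral_zero
    rw [lintegral_sub_right_eq_self (fun x => N.indicator (fun _ => (1 : ℝ≥0∞)) x),
      lintegral_indicator hNm, setLIntegral_one, hN0]
  rw [lintegral_eq_zero_iff' hmeas.lintegral_prod_right'.aemeasurable] at hnull
  filter_upwards [hnull] with x hx
  have hmx : Measurable fun u => N.indicator (fun _ => (1 : ℝ≥0∞)) (x - rotate θ⁻¹ (φ u)) :=
    hmeas.comp measurable_prodMk_left
  rw [Pi.zero_apply, lintegral_eq_zero_iff' hmx.aemeasurable] at hx
  filter_upwards [hx] with u hu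
  by_contra hne
  have : x - rotate θ⁻¹ (φ u) ∈ N := hPN hne
  simp [indicator_of_mem this] at hu

theorem ae_ae_sub_rotate (hφ : Measurable φ) (hP : ∀ᵐ y, P y) :
    ∀ᵐ z ∂(rigidMeasure n), ∀ᵐ u ∂τ, P (z.1 - rotate z.2⁻¹ (φ u)) := by
  obtain ⟨N, hPN, hNm, hN0⟩ := exists_measurable_superset_of_null (ae_iff.mp hP)
  have hNae : ∀ᵐ y, y ∉ N := measure_eq_zero_iff_ae_notMem.mp hN0
  have hset : MeasurableSet {z : E n × SO n | ∀ᵐ u ∂τ, z.1 - rotate z.2⁻¹ (φ u) ∉ N} := by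
    have h1 : MeasurableSet {w : (E n × SO n) × X | w.1.1 - rotate w.1.2⁻¹ (φ w.2) ∈ N} :=
      measurable_sub_rotate hφ hNm
    have h2 := measurable_measure_prodMk_left (ν := τ) h1
    have h3 : {z : E n × SO n | ∀ᵐ u ∂τ, z.1 - rotate z.2⁻¹ (φ u) ∉ N} =
        (fun z => τ (Prod.mk z ⁻¹'
          {w : (E n × SO n) × X | w.1.1 - rotate w.1.2⁻¹ (φ w.2) ∈ N})) ⁻¹' {0} := by
      ext z
      simp only [Set.mem_ofPred_eq, mem_preimage, mem_singleton_iff, ae_iff, not_not]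
      rfl
    rw [h3]
    exact h2 (measurableSet_singleton 0)
  have hswap : ∀ᵐ w ∂((rotationMeasure n).prod (volume : Measure (E n))),
      w.swap ∈ {z : E n × SO n | ∀ᵐ u ∂τ, z.1 - rotate z.2⁻¹ (φ u) ∉ N} := by
    refine (Measure.ae_prod_iff_ae_ae (measurable_swap hset)).mpr (Eventually.of_forall fun θ => ?_)
    exact ae_ae_sub_rotate_right hφ hNae θ
  have hz : ∀ᵐ z ∂(rigidMeasure n), ∀ᵐ u ∂τ, z.1 - rotate z.2⁻¹ (φ u) ∉ N := by
    rw [rigidMeasure, ← Measure.prod_swap]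
    exact (ae_map_iff measurable_swap.aemeasurable hset).mpr hswap
  filter_upwards [hz] with z hz
  filter_upwards [hz] with u hu
  by_contra hne
  exact hu (hPN hne)

end NullSets

namespace GraphDensity

variable (G : GraphDensity k m ε) (D : OrthogonalSplitting n k m)

/-- The parametrization of the graph of `ψ` by `ℝᵏ`. -/
def param (u : E k) : E n := D.ι u + D.ι' (G.ψ u)

theorem measurable_param : Measurable (G.param D) :=
  (D.ι.continuous.measurable).add (D.ι'.continuous.measurable.comp G.measurable_ψ)

/-- Averages of nonnegative functions over translates of the rotated patch. -/
def average (F : E n → ℝ≥0∞) (z : E n × SO n) : ℝ≥0∞ :=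
  ∫⁻ u, ENNReal.ofReal (G.χ u) * F (z.1 - rotate z.2⁻¹ (G.param D u))

theorem measurable_sub_rotate_param :
    Measurable fun τ : (E n × SO n) × E k => τ.1.1 - rotate τ.1.2⁻¹ (G.param D τ.2) :=
  measurable_sub_rotate (G.measurable_param D)

theorem measurable_average_integrand {F : E n → ℝ≥0∞} (hF : Measurable F) :
    Measurable fun τ : (E n × SO n) × E k =>
      ENNReal.ofReal (G.χ τ.2) * F (τ.1.1 - rotate τ.1.2⁻¹ (G.param D τ.2)) := by
  have h1 := hF.comp (G.measurable_sub_rotate_param D)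
  have h2 : Measurable fun τ : (E n × SO n) × E k => G.χ τ.2 :=
    G.contDiff_χ.continuous.measurable.comp measurable_snd
  exact h2.ennreal_ofReal.mul h1

theorem measurable_average {F : E n → ℝ≥0∞} (hF : Measurable F) : Measurable (G.average D F) :=
  (G.measurable_average_integrand D hF).lintegral_prod_right

/-- Convolution with the rotations of the smeared density, in the coordinates of the patch. -/
theorem rotConv_patchKernel_dilate {Ψ : E m → ℂ} (hΨ : Integrable Ψ)
    {f : E n → ℂ} (hf : Continuous f) (hfc : HasCompactSupport f) (J : ℕ) (x : E n) (θ : SO n) :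
    rotConv (G.patchKernel D (dilate (2 ^ J) Ψ)) f x θ =
      ∫ w : E k × E m, ((G.χ w.1 : ℂ) * Ψ w.2) *
        f (x - rotate θ⁻¹ (G.param D w.1 + D.ι' (((2 : ℝ) ^ J)⁻¹ • w.2))) ∂(volume.prod volume) := by
  obtain ⟨M, hM⟩ := hf.bounded_above_of_compact_support hfc
  have hrot : Continuous fun y => f (x - rotate θ⁻¹ y) :=
    hf.comp (continuous_const.sub (rotateₗᵢ θ⁻¹).continuous)
  have h1 : rotConv (G.patchKernel D (dilate (2 ^ J) Ψ)) f x θ =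
      ∫ y, G.patchKernelCoord (dilate (2 ^ J) Ψ) (D.coord y) * f (x - rotate θ⁻¹ y) := by
    rw [rotConv, ← (measurePreserving_rotate θ).integral_comp (measurableEmbedding_rotate θ)
      (fun y => G.patchKernelCoord (dilate (2 ^ J) Ψ) (D.coord y) * f (x - rotate θ⁻¹ y))]
    refine integral_congr_ae (Eventually.of_forall fun y => ?_)
    simp only [rotate_inv_rotate, patchKernel_eq]
  have h2 : ∫ y, G.patchKernelCoord (dilate (2 ^ J) Ψ) (D.coord y) * f (x - rotate θ⁻¹ y) =
      ∫ w : E k × E m, G.patchKernelCoord (dilate (2 ^ J) Ψ) w * f (x - rotate θ⁻¹ (D.glue w))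
        ∂(volume.prod volume) := by
    have h3 := D.measurePreserving_coord.integral_comp D.measurableEmbedding_coord
      (fun w => G.patchKernelCoord (dilate (2 ^ J) Ψ) w * f (x - rotate θ⁻¹ (D.glue w)))
    rw [← Measure.volume_eq_prod, ← h3]
    refine integral_congr_ae (Eventually.of_forall fun y => ?_)
    simp only [OrthogonalSplitting.coord, ContinuousLinearEquiv.apply_symm_apply]
  have hi1 : Integrable (fun w : E k × E m => G.patchKernelCoord (dilate (2 ^ J) Ψ) w *
      f (x - rotate θ⁻¹ (D.glue w))) (volume.prod volume) := by
    have h4 : Integrable (G.patchKernelCoord (dilate (2 ^ J) Ψ)) (volume.prod volume) :=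
      G.integrable_patchKernelCoord (integrable_dilate (by positivity) hΨ)
    refine h4.mul_bdd (c := M) ?_ (Eventually.of_forall fun w => hM _)
    exact (hrot.comp D.glue.continuous).aestronglyMeasurable
  have hi2 : Integrable (fun w : E k × E m => ((G.χ w.1 : ℂ) * Ψ w.2) *
      f (x - rotate θ⁻¹ (G.param D w.1 + D.ι' (((2 : ℝ) ^ J)⁻¹ • w.2)))) (volume.prod volume) := by
    refine (G.integrable_χ.ofReal.mul_prod hΨ).mul_bdd (c := M) ?_ (Eventually.of_forall fun w =>
      hM _)
    have h5 : Measurable fun w : E k × E m => G.param D w.1 + D.ι' (((2 : ℝ) ^ J)⁻¹ • w.2) := by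
      have h6 : Continuous fun w : E k × E m => D.ι' (((2 : ℝ) ^ J)⁻¹ • w.2) := by fun_prop
      exact ((G.measurable_param D).comp measurable_fst).add h6.measurable
    exact (hrot.measurable.comp h5).aestronglyMeasurable
  rw [h1, h2, integral_prod _ hi1, integral_prod _ hi2]
  refine integral_congr_ae (Eventually.of_forall fun u => ?_)
  simp only
  set H : E m → ℂ := fun v => ((G.χ u : ℂ) * Ψ v) *
    f (x - rotate θ⁻¹ (G.param D u + D.ι' (((2 : ℝ) ^ J)⁻¹ • v))) with hH
  have h7 : ∀ v, G.patchKernelCoord (dilate (2 ^ J) Ψ) (u, v) *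
      f (x - rotate θ⁻¹ (D.glue (u, v))) =
      (((2 : ℝ) ^ J : ℝ) : ℂ) ^ m * H ((2 : ℝ) ^ J • (v - G.ψ u)) := by
    intro v
    have h8 : G.param D u + D.ι' (((2 : ℝ) ^ J)⁻¹ • ((2 : ℝ) ^ J • (v - G.ψ u))) =
        D.glue (u, v) := by
      rw [inv_smul_smul₀ (by positivity), D.glue_apply, param, map_sub]
      abel
    simp only [hH, h8, patchKernelCoord, dilate]
    ring
  simp_rw [h7]
  rw [integral_const_mul, integral_sub_right_eq_self (fun v => H ((2 : ℝ) ^ J • v)),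
    Measure.integral_comp_smul]
  have h9 : |(((2 : ℝ) ^ J) ^ Module.finrank ℝ (E m))⁻¹| = (((2 : ℝ) ^ J) ^ m)⁻¹ := by
    rw [abs_of_nonneg (by positivity)]
    simp
  rw [h9, Complex.real_smul, ← mul_assoc]
  push_cast
  rw [mul_inv_cancel₀ (pow_ne_zero _ (pow_ne_zero _ two_ne_zero)), one_mul]

/-- As the scale of the smearing tends to zero, the smeared averages converge. -/
theorem tendsto_rotConv_patchKernel_dilate {Ψ : E m → ℂ} (hΨ : Integrable Ψ)
    (hΨ1 : ∫ v, Ψ v = 1) {f : E n → ℂ} (hf : Continuous f) (hfc : HasCompactSupport f)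
    (x : E n) (θ : SO n) :
    Tendsto (fun J : ℕ => rotConv (G.patchKernel D (dilate (2 ^ J) Ψ)) f x θ) atTop
      (nhds (∫ u, (G.χ u : ℂ) * f (x - rotate θ⁻¹ (G.param D u)))) := by
  obtain ⟨M, hM⟩ := hf.bounded_above_of_compact_support hfc
  have hrot : Continuous fun y => f (x - rotate θ⁻¹ y) :=
    hf.comp (continuous_const.sub (rotateₗᵢ θ⁻¹).continuous)
  have hlim : ∫ u, (G.χ u : ℂ) * f (x - rotate θ⁻¹ (G.param D u)) =
      ∫ w : E k × E m, ((G.χ w.1 : ℂ) * Ψ w.2) * f (x - rotate θ⁻¹ (G.param D w.1))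
        ∂(volume.prod volume) := by
    have h1 := integral_prod_mul (μ := (volume : Measure (E k))) (ν := (volume : Measure (E m)))
      (fun u => (G.χ u : ℂ) * f (x - rotate θ⁻¹ (G.param D u))) Ψ
    rw [hΨ1, mul_one] at h1
    rw [← h1]
    exact integral_congr_ae (Eventually.of_forall fun w => by simp only; ring)
  simp_rw [G.rotConv_patchKernel_dilate D hΨ hf hfc, hlim]
  have hint : Integrable (fun w : E k × E m => (G.χ w.1 : ℂ) * Ψ w.2) (volume.prod volume) :=
    G.integrable_χ.ofReal.mul_prod hΨ
  refine tendsto_integral_of_dominated_convergence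
    (fun w => ‖(G.χ w.1 : ℂ) * Ψ w.2‖ * M) (fun J => ?_) (hint.norm.mul_const M) (fun J => ?_) ?_
  · have h5 : Measurable fun w : E k × E m => G.param D w.1 + D.ι' (((2 : ℝ) ^ J)⁻¹ • w.2) := by
      have h6 : Continuous fun w : E k × E m => D.ι' (((2 : ℝ) ^ J)⁻¹ • w.2) := by fun_prop
      exact ((G.measurable_param D).comp measurable_fst).add h6.measurable
    exact hint.aestronglyMeasurable.mul (hrot.measurable.comp h5).aestronglyMeasurable
  · refine Eventually.of_forall fun w => ?_
    rw [norm_mul]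
    exact mul_le_mul_of_nonneg_left (hM _) (norm_nonneg _)
  · refine Eventually.of_forall fun w => Tendsto.const_mul _ ?_
    have h1 : Tendsto (fun J : ℕ => ((2 : ℝ) ^ J)⁻¹) atTop (nhds 0) :=
      tendsto_inv_atTop_zero.comp (tendsto_pow_atTop_atTop_of_one_lt one_lt_two)
    have h2 : Continuous fun a : ℝ => f (x - rotate θ⁻¹ (G.param D w.1 + D.ι' (a • w.2))) := by
      have h3 : Continuous fun a : ℝ => G.param D w.1 + D.ι' (a • w.2) := by fun_prop
      exact hrot.comp h3
    have h4 := (h2.tendsto 0).comp h1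
    simpa [Function.comp_def] using h4

theorem enorm_integral_eq_average {f : E n → ℝ} (hf : Continuous f) (hf0 : ∀ y, 0 ≤ f y)
    (hfc : HasCompactSupport f) (z : E n × SO n) :
    ‖∫ u, (G.χ u : ℂ) * (f (z.1 - rotate z.2⁻¹ (G.param D u)) : ℂ)‖ₑ =
      G.average D (fun y => ENNReal.ofReal (f y)) z := by
  obtain ⟨M, hM⟩ := hf.bounded_above_of_compact_support hfc
  have hm : Measurable fun u => f (z.1 - rotate z.2⁻¹ (G.param D u)) := by
    have h1 : Continuous fun y => f (z.1 - rotate z.2⁻¹ y) :=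
      hf.comp (continuous_const.sub (rotateₗᵢ z.2⁻¹).continuous)
    exact h1.measurable.comp (G.measurable_param D)
  have hi : Integrable fun u => G.χ u * f (z.1 - rotate z.2⁻¹ (G.param D u)) :=
    G.integrable_χ.mul_bdd (c := M) hm.aestronglyMeasurable (Eventually.of_forall fun u => hM _)
  have h0 : ∀ u, 0 ≤ G.χ u * f (z.1 - rotate z.2⁻¹ (G.param D u)) := fun u =>
    mul_nonneg (G.χ_nonneg u) (hf0 _)
  have h1 : ∫ u, (G.χ u : ℂ) * (f (z.1 - rotate z.2⁻¹ (G.param D u)) : ℂ) =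
      ((∫ u, G.χ u * f (z.1 - rotate z.2⁻¹ (G.param D u)) : ℝ) : ℂ) := by
    rw [← integral_complex_ofReal]
    exact integral_congr_ae (Eventually.of_forall fun u => by push_cast; rfl)
  rw [h1, ← ofReal_norm, Complex.norm_real, Real.norm_of_nonneg (integral_nonneg h0),
    ofReal_integral_eq_lintegral_ofReal hi (Eventually.of_forall h0)]
  exact lintegral_congr fun u => ENNReal.ofReal_mul (G.χ_nonneg u)

/-- The bound for averages of continuous functions over a patch. -/
theorem exists_lintegral_average_le_of_continuous (hk : 1 ≤ k) (hm : 1 ≤ m) (hε : 0 ≤ ε)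
    (hεn : 64 * n ^ 2 * ε ≤ 1) {p q : ℝ} (hp : p = (2 * n - k : ℝ) / n)
    (hpq : p.HolderConjugate q) :
    ∃ C : ℝ, 0 ≤ C ∧ ∀ f : E n → ℝ, Continuous f → HasCompactSupport f → (∀ y, 0 ≤ f y) →
      (∫⁻ z, G.average D (fun y => ENNReal.ofReal (f y)) z ^ q ∂(rigidMeasure n)) ^ (1 / q) ≤
      ENNReal.ofReal C * (∫⁻ y, ENNReal.ofReal (f y) ^ p) ^ (1 / p) := by
  obtain ⟨N, rfl⟩ : ∃ N, k = N + 1 := ⟨k - 1, by omega⟩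
  obtain ⟨Ψ, hΨm, hΨi, ⟨M, hΨM⟩, ⟨L, hΨL⟩, A, hΨA⟩ := exists_moment_kernel hm N
  obtain ⟨C, hC0, hC⟩ := G.exists_lintegral_rotConv_dilate_le D hk hm hε hεn hp hpq hΨm hΨi hΨM
    hΨL hΨA
  have hΨ1 : ∫ v, Ψ v = 1 := by
    have h1 := hΨA 0
    rw [norm_zero, zero_pow (by omega), mul_zero] at h1
    have h2 := sub_eq_zero.mp (norm_le_zero_iff.mp h1)
    rw [Real.fourier_eq] at h2
    simpa using h2
  have hq0 : 0 < q := hpq.symm.pos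
  refine ⟨C, hC0, fun f hf hfc hf0 => ?_⟩
  obtain ⟨Bf, hBf⟩ := hf.bounded_above_of_compact_support hfc
  obtain ⟨Rf, hRf⟩ := hfc.isCompact.isBounded.exists_norm_le
  set RHS := ENNReal.ofReal C * (∫⁻ y, ENNReal.ofReal (f y) ^ p) ^ (1 / p) with hRHS
  have hbound : ∀ J : ℕ, ∫⁻ z, ‖rotConv (G.patchKernel D (dilate (2 ^ J) Ψ))
      (fun y => (f y : ℂ)) z.1 z.2‖ₑ ^ q ∂(rigidMeasure n) ≤ RHS ^ q := fun J => by
    have h1 := hC J f Bf Rf hf.measurable hf0 (fun y => (le_abs_self _).trans (hBf y))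
      fun y hy => hRf y (subset_tsupport _ hy)
    have h2 := ENNReal.rpow_le_rpow h1 hq0.le
    rwa [← ENNReal.rpow_mul, one_div_mul_cancel hq0.ne', ENNReal.rpow_one] at h2
  have hfC : Continuous fun y => (f y : ℂ) := Complex.continuous_ofReal.comp hf
  have hfcC : HasCompactSupport fun y => (f y : ℂ) := hfc.comp_left Complex.ofReal_zero
  have hlim : ∀ z : E n × SO n, G.average D (fun y => ENNReal.ofReal (f y)) z ^ q =
      liminf (fun J : ℕ => ‖rotConv (G.patchKernel D (dilate (2 ^ J) Ψ))
        (fun y => (f y : ℂ)) z.1 z.2‖ₑ ^ q) atTop := fun z => by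
    rw [← G.enorm_integral_eq_average D hf hf0 hfc z]
    have h1 := G.tendsto_rotConv_patchKernel_dilate D hΨi hΨ1 hfC hfcC z.1 z.2
    exact (((ENNReal.continuous_rpow_const (y := q)).tendsto _).comp
      ((continuous_enorm.tendsto _).comp h1)).liminf_eq.symm
  have hmain : ∫⁻ z, G.average D (fun y => ENNReal.ofReal (f y)) z ^ q ∂(rigidMeasure n) ≤
      RHS ^ q := by
    simp_rw [hlim]
    refine (lintegral_liminf_le fun J => ?_).trans ?_
    · exact (measurable_rotConv (G.measurable_patchKernel D (measurable_dilate _ hΨm))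
        hfC.measurable).enorm.pow_const _
    · exact liminf_le_of_le ⟨0, by simp⟩ fun b hb => by
        obtain ⟨J, hJ⟩ := hb.exists
        exact hJ.trans (hbound J)
  have h3 := ENNReal.rpow_le_rpow hmain (z := 1 / q) (by positivity)
  rwa [← ENNReal.rpow_mul, mul_one_div_cancel hq0.ne', ENNReal.rpow_one] at h3

end GraphDensity

end PatchAverage

/-! ### Averages of `Lᵖ` functions over a patch -/

section PatchBound

open Filter

variable {n k m : ℕ} {ε : ℝ}

namespace GraphDensity

variable (G : GraphDensity k m ε) (D : OrthogonalSplitting n k m)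

/-- The bound for averages over a patch. -/
theorem exists_lintegral_average_le (hk : 1 ≤ k) (hm : 1 ≤ m) (hε : 0 ≤ ε)
    (hεn : 64 * n ^ 2 * ε ≤ 1) {p q : ℝ} (hp : p = (2 * n - k : ℝ) / n)
    (hpq : p.HolderConjugate q) :
    ∃ C : ℝ, 0 ≤ C ∧ ∀ f : E n → ℂ, MemLp f (ENNReal.ofReal p) volume →
      (∫⁻ z, G.average D (fun y => ‖f y‖ₑ) z ^ q ∂(rigidMeasure n)) ^ (1 / q) ≤
      ENNReal.ofReal C * eLpNorm f (ENNReal.ofReal p) volume := by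
  obtain ⟨C, hC0, hC⟩ := G.exists_lintegral_average_le_of_continuous D hk hm hε hεn hp hpq
  have hp0 : 0 < p := hpq.pos
  have hq0 : 0 < q := hpq.symm.pos
  have hp1 : 1 ≤ ENNReal.ofReal p := by
    rw [← ENNReal.ofReal_one]; exact ENNReal.ofReal_le_ofReal hpq.lt.le
  refine ⟨C, hC0, fun f hf => ?_⟩
  set N := eLpNorm f (ENNReal.ofReal p) volume with hN
  have hδ : ∀ j : ℕ, ((j : ℝ≥0∞) + 1)⁻¹ ≠ 0 := fun j =>
    ENNReal.inv_ne_zero.mpr (ENNReal.add_ne_top.mpr ⟨ENNReal.natCast_ne_top j, ENNReal.one_ne_top⟩)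
  choose g hgc hgε hgcont hgL using fun j : ℕ =>
    hf.exists_hasCompactSupport_eLpNorm_sub_le ENNReal.ofReal_ne_top (hδ j)
  have hδ0 : Tendsto (fun j : ℕ => ((j : ℝ≥0∞) + 1)⁻¹) atTop (nhds 0) := by
    have h1 := (tendsto_add_atTop_iff_nat 1).mpr ENNReal.tendsto_inv_nat_nhds_zero
    simpa using h1
  have hconv : Tendsto (fun j => eLpNorm (g j - f) (ENNReal.ofReal p) volume) atTop (nhds 0) :=
    tendsto_of_tendsto_of_tendsto_of_le_of_le tendsto_const_nhds hδ0 (fun _ => zero_le)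
      fun j => by simpa only [eLpNorm_sub_comm] using hgε j
  obtain ⟨ns, hns, hae⟩ := (tendstoInMeasure_of_tendsto_eLpNorm
    (by positivity : ENNReal.ofReal p ≠ 0) (fun j => (hgL j).1) hf.1 hconv).exists_seq_tendsto_ae
  have hgN : ∀ j, eLpNorm (g j) (ENNReal.ofReal p) volume ≤ N + ((j : ℝ≥0∞) + 1)⁻¹ := fun j => by
    have h1 : g j = f + (g j - f) := by abel
    calc eLpNorm (g j) (ENNReal.ofReal p) volume = eLpNorm (f + (g j - f)) (ENNReal.ofReal p) volume := by
          rw [← h1]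
      _ ≤ N + eLpNorm (g j - f) (ENNReal.ofReal p) volume :=
          eLpNorm_add_le hf.1 ((hgL j).1.sub hf.1) hp1
      _ ≤ _ := by
          gcongr
          simpa only [eLpNorm_sub_comm] using hgε j
  have hbound : ∀ j, ∫⁻ z, G.average D (fun y => ‖g j y‖ₑ) z ^ q ∂(rigidMeasure n) ≤
      (ENNReal.ofReal C * (N + ((j : ℝ≥0∞) + 1)⁻¹)) ^ q := fun j => by
    have h1 := hC (fun y => ‖g j y‖) (hgcont j).norm (hgc j).norm fun y => norm_nonneg _
    simp only [ofReal_norm] at h1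
    have h2 : (∫⁻ y, ‖g j y‖ₑ ^ p) ^ (1 / p) = eLpNorm (g j) (ENNReal.ofReal p) volume := by
      rw [eLpNorm_eq_lintegral_rpow_enorm_toReal (by positivity) ENNReal.ofReal_ne_top,
        ENNReal.toReal_ofReal hp0.le]
    rw [h2] at h1
    have h3 := ENNReal.rpow_le_rpow (h1.trans (mul_le_mul' le_rfl (hgN j))) hq0.le
    rwa [← ENNReal.rpow_mul, one_div_mul_cancel hq0.ne', ENNReal.rpow_one] at h3
  have hlimC : Tendsto (fun i => (ENNReal.ofReal C * (N + ((ns i : ℝ≥0∞) + 1)⁻¹)) ^ q) atTop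
      (nhds ((ENNReal.ofReal C * N) ^ q)) := by
    have h1 : Tendsto (fun i => N + ((ns i : ℝ≥0∞) + 1)⁻¹) atTop (nhds (N + 0)) :=
      tendsto_const_nhds.add (hδ0.comp hns.tendsto_atTop)
    rw [add_zero] at h1
    have h2 := ENNReal.Tendsto.const_mul (a := ENNReal.ofReal C) h1 (Or.inr ENNReal.ofReal_ne_top)
    exact ((ENNReal.continuous_rpow_const (y := q)).tendsto _).comp h2
  have hpt : ∀ᵐ z ∂(rigidMeasure n), G.average D (fun y => ‖f y‖ₑ) z ^ q ≤
      liminf (fun i => G.average D (fun y => ‖g (ns i) y‖ₑ) z ^ q) atTop := by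
    filter_upwards [ae_ae_sub_rotate (τ := volume) (G.measurable_param D) hae] with z hz
    have h1 : G.average D (fun y => ‖f y‖ₑ) z ≤
        liminf (fun i => G.average D (fun y => ‖g (ns i) y‖ₑ) z) atTop := by
      have h2 : G.average D (fun y => ‖f y‖ₑ) z = ∫⁻ u, liminf (fun i => ENNReal.ofReal (G.χ u) *
          ‖g (ns i) (z.1 - rotate z.2⁻¹ (G.param D u))‖ₑ) atTop := by
        refine lintegral_congr_ae ?_
        filter_upwards [hz] with u hu
        refine (Tendsto.liminf_eq ?_).symm
        exact ENNReal.Tendsto.const_mul ((continuous_enorm.tendsto _).comp hu)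
          (Or.inr ENNReal.ofReal_ne_top)
      rw [h2]
      refine lintegral_liminf_le fun i => ?_
      exact (G.measurable_average_integrand D (hgcont (ns i)).measurable.enorm).comp
        measurable_prodMk_left
    calc _ ≤ (liminf (fun i => G.average D (fun y => ‖g (ns i) y‖ₑ) z) atTop) ^ q :=
          ENNReal.rpow_le_rpow h1 hq0.le
      _ = _ := (ENNReal.orderIsoRpow q hq0).liminf_apply
  have hmain : ∫⁻ z, G.average D (fun y => ‖f y‖ₑ) z ^ q ∂(rigidMeasure n) ≤
      (ENNReal.ofReal C * N) ^ q := by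
    calc _ ≤ ∫⁻ z, liminf (fun i => G.average D (fun y => ‖g (ns i) y‖ₑ) z ^ q) atTop
          ∂(rigidMeasure n) := lintegral_mono_ae hpt
      _ ≤ liminf (fun i => ∫⁻ z, G.average D (fun y => ‖g (ns i) y‖ₑ) z ^ q ∂(rigidMeasure n))
          atTop := lintegral_liminf_le fun i =>
            (G.measurable_average D (hgcont (ns i)).measurable.enorm).pow_const _
      _ ≤ liminf (fun i => (ENNReal.ofReal C * (N + ((ns i : ℝ≥0∞) + 1)⁻¹)) ^ q) atTop :=
          liminf_le_liminf (Eventually.of_forall fun i => hbound (ns i))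
      _ = _ := hlimC.liminf_eq
  have h3 := ENNReal.rpow_le_rpow hmain (z := 1 / q) (by positivity)
  rwa [← ENNReal.rpow_mul, mul_one_div_cancel hq0.ne', ENNReal.rpow_one] at h3

end GraphDensity

end PatchBound

/-! ### Smooth surfaces as graphs -/

section SurfaceGeometry

open Topology

variable {n k m : ℕ}

theorem IsSmoothSurface.measurableSet {S : Set (E n)} (hS : IsSmoothSurface k S) :
    MeasurableSet S := by
  have h : ∀ p ∈ S, ∃ V : Set (E n), IsOpen V ∧ p ∈ V ∧ MeasurableSet (S ∩ V) := by
    intro p hp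
    obtain ⟨V, U, Φ, hV, hpV, hU, hΦ, -, hemb, himg⟩ := hS p hp
    refine ⟨V, hV, hpV, ?_⟩
    rw [← himg]
    exact hU.measurableSet.image_of_continuousOn_injOn hΦ.continuousOn
      (injOn_iff_injective.mpr hemb.injective)
  choose! V hVo hpV hVm using h
  obtain ⟨t, htS, htc, hcov⟩ := TopologicalSpace.countable_cover_nhdsWithin (s := S) (f := V)
    fun p hp => mem_nhdsWithin_of_mem_nhds ((hVo p hp).mem_nhds (hpV p hp))
  have : S = ⋃ p ∈ t, S ∩ V p := by
    rw [← inter_iUnion₂, inter_eq_self_of_subset_left hcov]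
  rw [this]
  exact MeasurableSet.biUnion htc fun p hp => hVm p (htS hp)

/-- The orthogonal splitting along the range of an injective linear map. -/
theorem exists_orthogonalSplitting (hkm : k + m = n) {A : E k →ₗ[ℝ] E n}
    (hA : Function.Injective A) :
    ∃ D : OrthogonalSplitting n k m, ∀ u, (D.coord (A u)).2 = 0 := by
  set T := LinearMap.range A with hT
  have hTk : Module.finrank ℝ T = k := by
    rw [hT, LinearMap.finrank_range_of_inj hA]; simp
  have hTm : Module.finrank ℝ Tᗮ = m := by
    have h1 := Submodule.finrank_add_finrank_orthogonal T
    rw [hTk, finrank_euclideanSpace_fin] at h1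
    omega
  let b : T ≃ₗᵢ[ℝ] E k := ((stdOrthonormalBasis ℝ T).reindex (finCongr hTk)).repr
  let b' : Tᗮ ≃ₗᵢ[ℝ] E m := ((stdOrthonormalBasis ℝ Tᗮ).reindex (finCongr hTm)).repr
  let D : OrthogonalSplitting n k m :=
    { ι := T.subtypeₗᵢ.comp b.symm.toLinearIsometry
      ι' := Tᗮ.subtypeₗᵢ.comp b'.symm.toLinearIsometry
      inner_ι_ι' := fun u v =>
        Submodule.inner_right_of_mem_orthogonal (b.symm u).2 (b'.symm v).2
      add_eq := hkm }
  refine ⟨D, fun u => ?_⟩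
  have h1 : D.glue (b ⟨A u, LinearMap.mem_range_self A u⟩, 0) = A u := by
    rw [D.glue_apply, map_zero, add_zero]
    change ((b.symm (b ⟨A u, LinearMap.mem_range_self A u⟩) : T) : E n) = A u
    rw [b.symm_apply_apply]
  rw [← h1, OrthogonalSplitting.coord, ContinuousLinearEquiv.symm_apply_apply]

/-- A smooth function on a ball with Lipschitz constant `ε` gives a graph, with a density equal to
`1` near the centre of the ball. -/
theorem exists_graphDensity_of_contDiffOn {w₀ : E k} {r ε : ℝ} (hr : 0 < r)
    {ψ₀ : E k → E m} (hψ₀ : ContDiffOn ℝ ∞ ψ₀ (Metric.ball w₀ r))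
    (hLip : ∀ w ∈ Metric.ball w₀ r, ∀ w' ∈ Metric.ball w₀ r, ‖ψ₀ w - ψ₀ w'‖ ≤ ε * ‖w - w'‖) :
    ∃ G : GraphDensity k m ε, G.dom = Metric.ball w₀ r ∧
      (∀ w ∈ Metric.ball w₀ r, G.ψ w = ψ₀ w) ∧ ∀ w ∈ Metric.ball w₀ (r / 4), G.χ w = 1 := by
  classical
  let χ : ContDiffBump w₀ := ⟨r / 4, r / 2, by positivity, by linarith⟩
  have hψ : ∀ w ∈ Metric.ball w₀ r, (Metric.ball w₀ r).indicator ψ₀ w = ψ₀ w :=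
    fun w hw => indicator_of_mem hw _
  -- the extension by zero is a globally measurable choice of the function
  let G : GraphDensity k m ε :=
    { dom := Metric.ball w₀ r
      ψ := (Metric.ball w₀ r).indicator ψ₀
      χ := χ
      isOpen_dom := Metric.isOpen_ball
      measurable_ψ := by
        rw [← piecewise_eq_indicator]
        exact hψ₀.continuousOn.measurable_piecewise continuousOn_const
          Metric.isOpen_ball.measurableSet
      contDiffOn_ψ := hψ₀.congr hψ
      norm_ψ_sub_le := fun w hw w' hw' => by
        rw [hψ w hw, hψ w' hw']
        exact hLip w hw w' hw'
      contDiff_χ := χ.contDiff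
      hasCompactSupport_χ := χ.hasCompactSupport
      tsupport_χ_subset := by
        rw [χ.tsupport_eq]
        exact Metric.closedBall_subset_ball (by change r / 2 < r; linarith)
      χ_nonneg := fun w => χ.nonneg }
  exact ⟨G, rfl, hψ, fun w hw => χ.one_of_mem_closedBall (Metric.ball_subset_closedBall hw)⟩

/-- Near each of its points, a smooth surface is contained in the graph of a function over the
tangent plane with small Lipschitz constant. -/
theorem IsSmoothSurface.exists_graphDensity {S : Set (E n)} (hS : IsSmoothSurface k S)
    (hkm : k + m = n) {ε : ℝ} (hε : 0 < ε) {p : E n} (hp : p ∈ S) :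
    ∃ (V : Set (E n)) (D : OrthogonalSplitting n k m) (G : GraphDensity k m ε) (W : Set (E k)),
      IsOpen V ∧ p ∈ V ∧ MeasurableSet W ∧ W ⊆ G.dom ∧ (∀ u ∈ W, 1 ≤ G.χ u) ∧
        S ∩ V ⊆ G.param D '' W := by
  obtain ⟨V, U, Φ, hV, hpV, hU, hΦ, hinj, hemb, himg⟩ := hS p hp
  obtain ⟨u₀, hu₀, rfl⟩ : p ∈ Φ '' U := by rw [himg]; exact ⟨hp, hpV⟩
  obtain ⟨D, hD⟩ := exists_orthogonalSplitting hkm (A := (fderiv ℝ Φ u₀ : E k →ₗ[ℝ] E n))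
    (hinj u₀ hu₀)
  have hΦat : ∀ u ∈ U, ContDiffAt ℝ ∞ Φ u := fun u hu => hΦ.contDiffAt (hU.mem_nhds hu)
  let P₁ : E n →L[ℝ] E k := (ContinuousLinearMap.fst ℝ (E k) (E m)).comp
    (D.coord : E n →L[ℝ] E k × E m)
  let P₂ : E n →L[ℝ] E m := (ContinuousLinearMap.snd ℝ (E k) (E m)).comp
    (D.coord : E n →L[ℝ] E k × E m)
  have hP : ∀ x, D.ι (P₁ x) + D.ι' (P₂ x) = x := D.ι_coord_add
  -- the projection of the surface to its tangent plane is locally invertible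
  let ϖ : E k → E k := fun u => P₁ (Φ u)
  have hϖ : ∀ u ∈ U, ContDiffAt ℝ ∞ ϖ u := fun u hu => P₁.contDiff.contDiffAt.comp u (hΦat u hu)
  have hϖd : ∀ u ∈ U, HasFDerivAt ϖ (fderiv ℝ ϖ u) u := fun u hu =>
    ((hϖ u hu).differentiableAt (by simp)).hasFDerivAt
  have hϖd₀ : fderiv ℝ ϖ u₀ = P₁.comp (fderiv ℝ Φ u₀) :=
    (P₁.hasFDerivAt.comp u₀ ((hΦat u₀ hu₀).differentiableAt (by simp)).hasFDerivAt).fderiv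
  have hinj₀ : Function.Injective (fderiv ℝ ϖ u₀ : E k →ₗ[ℝ] E k) := by
    rw [injective_iff_map_eq_zero]
    intro v hv
    have h1 : P₁ (fderiv ℝ Φ u₀ v) = 0 := by
      rw [hϖd₀] at hv; exact hv
    have h2 : P₂ (fderiv ℝ Φ u₀ v) = 0 := hD v
    have h3 := hP (fderiv ℝ Φ u₀ v)
    rw [h1, h2, map_zero, map_zero, add_zero] at h3
    exact hinj u₀ hu₀ (by rw [← h3, map_zero])
  let L₀ : E k ≃L[ℝ] E k := (LinearEquiv.ofInjectiveEndo _ hinj₀).toContinuousLinearEquiv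
  have hL₀ : (L₀ : E k →L[ℝ] E k) = fderiv ℝ ϖ u₀ := by ext v; rfl
  have hL₀d : HasFDerivAt ϖ (L₀ : E k →L[ℝ] E k) u₀ := by rw [hL₀]; exact hϖd u₀ hu₀
  obtain ⟨e, he, hu₀e⟩ : ∃ e : OpenPartialHomeomorph (E k) (E k),
      (e : E k → E k) = ϖ ∧ u₀ ∈ e.source :=
    ⟨(hϖ u₀ hu₀).toOpenPartialHomeomorph ϖ hL₀d (by simp), rfl,
      (hϖ u₀ hu₀).mem_toOpenPartialHomeomorph_source hL₀d (by simp)⟩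
  have hinv : ∀ u ∈ e.source, e.symm (ϖ u) = u := fun u hu => by rw [← he]; exact e.left_inv hu
  have hcd : ContinuousOn (fderiv ℝ ϖ) U := by
    have h1 : ContDiffOn ℝ ∞ ϖ U := fun u hu => (hϖ u hu).contDiffWithinAt
    exact h1.continuousOn_fderiv_of_isOpen hU (by simp)
  let U₁ : Set (E k) := e.source ∩
    (U ∩ fderiv ℝ ϖ ⁻¹' range ((↑) : (E k ≃L[ℝ] E k) → E k →L[ℝ] E k))
  have hU₁ : IsOpen U₁ :=
    e.open_source.inter (hcd.isOpen_inter_preimage hU ContinuousLinearEquiv.isOpen)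
  have hu₀U₁ : u₀ ∈ U₁ := ⟨hu₀e, hu₀, L₀, hL₀⟩
  let dom₀ : Set (E k) := e.target ∩ e.symm ⁻¹' U₁
  have hdom₀ : IsOpen dom₀ := e.symm.isOpen_inter_preimage hU₁
  set w₀ := ϖ u₀ with hw₀
  have hsymm : e.symm w₀ = u₀ := hinv u₀ hu₀e
  have hw₀d : w₀ ∈ dom₀ := ⟨by rw [hw₀, ← he]; exact e.map_source hu₀e, by rw [mem_preimage, hsymm]; exact hu₀U₁⟩
  have hgs : ∀ w ∈ dom₀, ContDiffAt ℝ ∞ e.symm w := by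
    intro w hw
    obtain ⟨L, hL⟩ := hw.2.2.2
    refine e.contDiffAt_symm hw.1 (f₀' := L) ?_ (by rw [he]; exact hϖ _ hw.2.2.1)
    rw [hL, he]
    exact hϖd _ hw.2.2.1
  let ψ₀ : E k → E m := fun w => P₂ (Φ (e.symm w))
  have hψ₀ : ∀ w ∈ dom₀, ContDiffAt ℝ ∞ ψ₀ w := fun w hw =>
    P₂.contDiff.contDiffAt.comp w ((hΦat _ hw.2.2.1).comp w (hgs w hw))
  have hψ₀d : fderiv ℝ ψ₀ w₀ = 0 := by
    have h1 : HasFDerivAt Φ (fderiv ℝ Φ u₀) (e.symm w₀) := by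
      rw [hsymm]; exact ((hΦat u₀ hu₀).differentiableAt (by simp)).hasFDerivAt
    have h2 := ((hgs w₀ hw₀d).differentiableAt (by simp)).hasFDerivAt
    have h3 : HasFDerivAt ψ₀ (P₂.comp ((fderiv ℝ Φ u₀).comp (fderiv ℝ e.symm w₀))) w₀ :=
      P₂.hasFDerivAt.comp w₀ (h1.comp w₀ h2)
    rw [h3.fderiv]
    ext1 v
    exact hD _
  obtain ⟨s, hs, hLip⟩ := ((hψ₀ w₀ hw₀d).of_le (by simp)).exists_lipschitzOnWith_of_nnnorm_lt
    (⟨ε, hε.le⟩ : ℝ≥0) (by rw [hψ₀d, nnnorm_zero]; exact hε)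
  obtain ⟨r, hr0, hr⟩ := Metric.isOpen_iff.mp (isOpen_interior.inter hdom₀) w₀
    ⟨mem_interior_iff_mem_nhds.mpr hs, hw₀d⟩
  let dom : Set (E k) := Metric.ball w₀ r
  have hdom₁ : ∀ w ∈ dom, w ∈ dom₀ := fun w hw => (hr hw).2
  have hdom₂ : ∀ w ∈ dom, w ∈ s := fun w hw => interior_subset (hr hw).1
  obtain ⟨G, hGdom, hGψ, hGχ⟩ := exists_graphDensity_of_contDiffOn (ε := ε) hr0
    (fun w hw => (hψ₀ w (hdom₁ w hw)).contDiffWithinAt) fun w hw w' hw' => by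
      rw [← dist_eq_norm, ← dist_eq_norm]
      exact hLip.dist_le_mul w (hdom₂ w hw) w' (hdom₂ w' hw')
  let W : Set (E k) := Metric.ball w₀ (r / 4)
  have hWdom : W ⊆ dom := Metric.ball_subset_ball (by linarith)
  have hϖc : ContinuousOn ϖ U := fun u hu => (hϖ u hu).continuousAt.continuousWithinAt
  let U₂ : Set (E k) := e.source ∩ (U ∩ ϖ ⁻¹' W)
  have hU₂ : IsOpen U₂ :=
    e.open_source.inter (hϖc.isOpen_inter_preimage hU Metric.isOpen_ball)
  obtain ⟨V₂, hV₂, hV₂U⟩ := hemb.isInducing.isOpen_iff.mp (hU₂.preimage continuous_subtype_val :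
    IsOpen ((↑) ⁻¹' U₂ : Set U))
  have hV₂mem : ∀ u (hu : u ∈ U), Φ u ∈ V₂ ↔ u ∈ U₂ := fun u hu => by
    have : (⟨u, hu⟩ : U) ∈ (fun u : U => Φ u) ⁻¹' V₂ ↔ (⟨u, hu⟩ : U) ∈ ((↑) ⁻¹' U₂ : Set U) := by
      rw [hV₂U]
    exact this
  have hw₀W : ϖ u₀ ∈ W := Metric.mem_ball_self (by positivity)
  have hu₀U₂ : u₀ ∈ U₂ := ⟨hu₀e, hu₀, hw₀W⟩
  refine ⟨V ∩ V₂, D, G, W, hV.inter hV₂, ⟨hpV, ?_⟩, Metric.isOpen_ball.measurableSet,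
    hGdom ▸ hWdom, fun w hw => (hGχ w hw).ge, ?_⟩
  · exact (hV₂mem u₀ hu₀).mpr hu₀U₂
  · rintro y ⟨hyS, hyV, hyV₂⟩
    obtain ⟨u, hu, rfl⟩ : y ∈ Φ '' U := by rw [himg]; exact ⟨hyS, hyV⟩
    obtain ⟨hue, -, huW⟩ := (hV₂mem u hu).mp hyV₂
    refine ⟨ϖ u, huW, ?_⟩
    have h1 : e.symm (ϖ u) = u := hinv u hue
    have h2 : ψ₀ (ϖ u) = P₂ (Φ u) := by simp only [ψ₀, h1]
    rw [GraphDensity.param, hGψ _ (hWdom huW), h2]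
    exact hP _

/-- The surface measure on a piece of a graph is controlled by Lebesgue measure in the parameters,
since the parametrization is Lipschitz. -/
theorem GraphDensity.restrict_le {ε : ℝ} (G : GraphDensity k m ε) (D : OrthogonalSplitting n k m)
    (hε1 : ε ≤ 1) {W : Set (E k)} (hWm : MeasurableSet W) (hW : W ⊆ G.dom)
    (hχ : ∀ u ∈ W, 1 ≤ G.χ u) :
    (Measure.euclideanHausdorffMeasure k).restrict (G.param D '' W) ≤
      (2 : ℝ≥0∞) ^ k • ((volume.withDensity fun u => ENNReal.ofReal (G.χ u)).map (G.param D)) := by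
  have hLip : LipschitzOnWith 2 (G.param D) W := by
    refine LipschitzOnWith.of_dist_le_mul fun u hu u' hu' => ?_
    rw [dist_eq_norm, dist_eq_norm]
    have h1 : G.param D u - G.param D u' = D.ι (u - u') + D.ι' (G.ψ u - G.ψ u') := by
      simp only [param, map_sub]; abel
    rw [h1]
    calc _ ≤ ‖u - u'‖ + ‖G.ψ u - G.ψ u'‖ := by
          refine (norm_add_le _ _).trans ?_
          rw [D.ι.norm_map, D.ι'.norm_map]
      _ ≤ ‖u - u'‖ + 1 * ‖u - u'‖ := by
          have := G.norm_ψ_sub_le u (hW hu) u' (hW hu')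
          gcongr
          exact this.trans (by gcongr)
      _ = _ := by rw [one_mul, NNReal.coe_ofNat, two_mul]
  have hHE : ∀ W' ⊆ W, Measure.euclideanHausdorffMeasure k (G.param D '' W') ≤
      (2 : ℝ≥0∞) ^ k * volume W' := by
    intro W' hW'
    have h1 := (hLip.mono hW').hausdorffMeasure_image_le (d := (k : ℝ)) (by positivity)
    rw [← EuclideanSpace.euclideanHausdorffMeasure_eq_volume k]
    simp only [Measure.euclideanHausdorffMeasure_def, Measure.smul_apply]
    rw [mul_smul_comm]
    refine smul_le_smul_of_nonneg_left ?_ zero_le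
    simpa using h1
  refine Measure.le_iff.mpr fun B hB => ?_
  have hpre : MeasurableSet (G.param D ⁻¹' B) := G.measurable_param D hB
  rw [Measure.restrict_apply hB, Measure.smul_apply, Measure.map_apply (G.measurable_param D) hB,
    withDensity_apply _ hpre, smul_eq_mul]
  have h1 : B ∩ G.param D '' W = G.param D '' (W ∩ G.param D ⁻¹' B) := by
    rw [image_inter_preimage, inter_comm]
  rw [h1]
  refine (hHE _ inter_subset_left).trans (mul_le_mul' le_rfl ?_)
  calc volume (W ∩ G.param D ⁻¹' B) = ∫⁻ _u in W ∩ G.param D ⁻¹' B, 1 := by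
        rw [setLIntegral_one]
    _ ≤ ∫⁻ u in W ∩ G.param D ⁻¹' B, ENNReal.ofReal (G.χ u) := by
        refine setLIntegral_mono' (hWm.inter hpre) fun u hu => ?_
        rw [← ENNReal.ofReal_one]
        exact ENNReal.ofReal_le_ofReal (hχ u hu.1)
    _ ≤ _ := lintegral_mono_set inter_subset_right

end SurfaceGeometry

/-! ### Averages over a compact part of a surface -/

section SurfaceBound

open Filter

variable {n k : ℕ}

/-- Near each of its points, surface measure is dominated by a finite measure whose averages over
rotations satisfy the `Lᵖ`-improving bound. -/
theorem IsSmoothSurface.exists_dominating_measure {S : Set (E n)} (hS : IsSmoothSurface k S)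
    (hk : 1 ≤ k) (hkn : k < n) {p q : ℝ} (hp : p = (2 * n - k : ℝ) / n)
    (hpq : p.HolderConjugate q) {y : E n} (hy : y ∈ S) :
    ∃ V : Set (E n), IsOpen V ∧ y ∈ V ∧ ∃ ν : Measure (E n), IsFiniteMeasure ν ∧
      (Measure.euclideanHausdorffMeasure k).restrict (S ∩ V) ≤ ν ∧ ∃ C : ℝ≥0,
        ∀ f : E n → ℂ, Measurable f → MemLp f (ENNReal.ofReal p) volume →
          eLpNorm (fun z : E n × SO n => ∫⁻ y, ‖f (z.1 - rotate z.2⁻¹ y)‖ₑ ∂ν)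
            (ENNReal.ofReal q) (rigidMeasure n) ≤ C * eLpNorm f (ENNReal.ofReal p) volume := by
  have hn1 : (1 : ℝ) ≤ n := by exact_mod_cast (by omega : 1 ≤ n)
  have hn2 : (1 : ℝ) ≤ n ^ 2 := one_le_pow₀ hn1
  set ε : ℝ := (64 * n ^ 2)⁻¹ with hε
  have hε0 : 0 < ε := by positivity
  have hε1 : ε ≤ 1 := inv_le_one_of_one_le₀ (by linarith)
  have hεn : 64 * n ^ 2 * ε ≤ 1 := by rw [hε, mul_inv_cancel₀ (by positivity)]
  obtain ⟨V, D, G, W, hV, hyV, hWm, hWd, hWχ, hSV⟩ :=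
    hS.exists_graphDensity (m := n - k) (by omega) hε0 hy
  obtain ⟨C, hC0, hC⟩ := G.exists_lintegral_average_le D hk (by omega) hε0.le hεn hp hpq
  have hq0 : 0 < q := hpq.symm.pos
  have hχm : Measurable fun u => ENNReal.ofReal (G.χ u) :=
    G.contDiff_χ.continuous.measurable.ennreal_ofReal
  set ν₀ := (volume.withDensity fun u => ENNReal.ofReal (G.χ u)).map (G.param D) with hν₀
  have hfin : IsFiniteMeasure (volume.withDensity fun u => ENNReal.ofReal (G.χ u)) := by
    refine isFiniteMeasure_withDensity ?_
    exact G.integrable_χ.lintegral_lt_top.ne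
  have hfin' : IsFiniteMeasure ν₀ := by rw [hν₀]; infer_instance
  refine ⟨V, hV, hyV, (2 : ℝ≥0∞) ^ k • ν₀, ?_, ?_, 2 ^ k * C.toNNReal, fun f hfm hf => ?_⟩
  · exact ν₀.smul_finite (by simp)
  · exact (Measure.restrict_mono hSV le_rfl).trans (G.restrict_le D hε1 hWm hWd hWχ)
  · have havg : ∀ z : E n × SO n, ∫⁻ y, ‖f (z.1 - rotate z.2⁻¹ y)‖ₑ ∂((2 : ℝ≥0∞) ^ k • ν₀) =
        2 ^ k * G.average D (fun y => ‖f y‖ₑ) z := fun z => by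
      have h1 : Measurable fun y => ‖f (z.1 - rotate z.2⁻¹ y)‖ₑ := by
        have h2 : Continuous fun y => z.1 - rotate z.2⁻¹ y :=
          continuous_const.sub (rotateₗᵢ z.2⁻¹).continuous
        exact (hfm.comp h2.measurable).enorm
      have h3 : Measurable fun u => ‖f (z.1 - rotate z.2⁻¹ (G.param D u))‖ₑ :=
        h1.comp (G.measurable_param D)
      rw [lintegral_smul_measure, hν₀, lintegral_map h1 (G.measurable_param D),
        lintegral_withDensity_eq_lintegral_mul _ hχm h3, smul_eq_mul]
      rfl
    simp_rw [havg]
    rw [eLpNorm_eq_lintegral_rpow_enorm_toReal (by simpa using hq0) ENNReal.ofReal_ne_top,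
      ENNReal.toReal_ofReal hq0.le]
    simp_rw [enorm_eq_self, ENNReal.mul_rpow_of_nonneg _ _ hq0.le]
    rw [lintegral_const_mul _ ((G.measurable_average D hfm.enorm).pow_const q),
      ENNReal.mul_rpow_of_nonneg _ _ (by positivity), ← ENNReal.rpow_mul,
      mul_one_div_cancel hq0.ne', ENNReal.rpow_one]
    push_cast
    rw [mul_assoc]
    exact mul_le_mul' le_rfl (hC f hf)

/-- On a compact part of a smooth surface, surface measure is dominated by a finite measure whose
averages over rotations satisfy the `Lᵖ`-improving bound. -/
theorem IsSmoothSurface.exists_dominating_measure_of_isCompact {S : Set (E n)}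
    (hS : IsSmoothSurface k S) (hk : 1 ≤ k) (hkn : k < n) {p q : ℝ} (hp : p = (2 * n - k : ℝ) / n)
    (hpq : p.HolderConjugate q) {K : Set (E n)} (hK : IsCompact K) (hKS : K ⊆ S) :
    ∃ ν : Measure (E n), IsFiniteMeasure ν ∧
      (Measure.euclideanHausdorffMeasure k).restrict K ≤ ν ∧ ∃ C : ℝ≥0,
        ∀ f : E n → ℂ, Measurable f → MemLp f (ENNReal.ofReal p) volume →
          eLpNorm (fun z : E n × SO n => ∫⁻ y, ‖f (z.1 - rotate z.2⁻¹ y)‖ₑ ∂ν)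
            (ENNReal.ofReal q) (rigidMeasure n) ≤ C * eLpNorm f (ENNReal.ofReal p) volume := by
  have hq1 : 1 ≤ ENNReal.ofReal q := by
    rw [← ENNReal.ofReal_one]; exact ENNReal.ofReal_le_ofReal hpq.symm.lt.le
  have hmeas : ∀ (ν : Measure (E n)) [IsFiniteMeasure ν] {f : E n → ℂ}, Measurable f →
      Measurable fun z : E n × SO n => ∫⁻ y, ‖f (z.1 - rotate z.2⁻¹ y)‖ₑ ∂ν := by
    intro ν _ f hf
    exact ((hf.comp (measurable_sub_rotate measurable_id)).enorm).lintegral_prod_right'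
  have key : ∃ ν : Measure (E n), IsFiniteMeasure ν ∧
      (Measure.euclideanHausdorffMeasure k).restrict (S ∩ K) ≤ ν ∧ ∃ C : ℝ≥0,
        ∀ f : E n → ℂ, Measurable f → MemLp f (ENNReal.ofReal p) volume →
          eLpNorm (fun z : E n × SO n => ∫⁻ y, ‖f (z.1 - rotate z.2⁻¹ y)‖ₑ ∂ν)
            (ENNReal.ofReal q) (rigidMeasure n) ≤ C * eLpNorm f (ENNReal.ofReal p) volume := by
    refine hK.induction_on (p := fun s => ∃ ν : Measure (E n), IsFiniteMeasure ν ∧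
      (Measure.euclideanHausdorffMeasure k).restrict (S ∩ s) ≤ ν ∧ ∃ C : ℝ≥0,
        ∀ f : E n → ℂ, Measurable f → MemLp f (ENNReal.ofReal p) volume →
          eLpNorm (fun z : E n × SO n => ∫⁻ y, ‖f (z.1 - rotate z.2⁻¹ y)‖ₑ ∂ν)
            (ENNReal.ofReal q) (rigidMeasure n) ≤ C * eLpNorm f (ENNReal.ofReal p) volume)
      ?_ ?_ ?_ ?_
    · exact ⟨0, inferInstance, by simp, 0, fun f _ _ => by simp⟩
    · rintro s t hst ⟨ν, hν, hle, C, hC⟩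
      exact ⟨ν, hν, (Measure.restrict_mono (inter_subset_inter_right _ hst) le_rfl).trans hle,
        C, hC⟩
    · rintro s t ⟨ν₁, hν₁, hle₁, C₁, hC₁⟩ ⟨ν₂, hν₂, hle₂, C₂, hC₂⟩
      refine ⟨ν₁ + ν₂, inferInstance, ?_, C₁ + C₂, fun f hfm hf => ?_⟩
      · rw [inter_union_distrib_left]
        exact (Measure.restrict_union_le _ _).trans (add_le_add hle₁ hle₂)
      · simp_rw [lintegral_add_measure]
        refine (eLpNorm_add_le (hmeas ν₁ hfm).aestronglyMeasurable
          (hmeas ν₂ hfm).aestronglyMeasurable hq1).trans ?_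
        push_cast
        rw [add_mul]
        exact add_le_add (hC₁ f hfm hf) (hC₂ f hfm hf)
    · intro y hy
      obtain ⟨V, hV, hyV, h⟩ := hS.exists_dominating_measure hk hkn hp hpq (hKS hy)
      exact ⟨V, mem_nhdsWithin_of_mem_nhds (hV.mem_nhds hyV), h⟩
  rwa [inter_eq_self_of_subset_right hKS] at key

/-- Averages of an `Lᵖ` function over almost every translate of a finite measure are finite. -/
theorem ae_lintegral_sub_rotate_lt_top {τ : Measure (E n)} [IsFiniteMeasure τ] {p : ℝ}
    (hp : 1 ≤ p) {F : E n → ℝ≥0∞} (hF : Measurable F) (hFp : ∫⁻ y, F y ^ p ≠ ⊤) (θ : SO n) :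
    ∀ᵐ x, ∫⁻ y, F (x - rotate θ⁻¹ y) ∂τ < ⊤ := by
  have hsub : Measurable fun w : E n × E n => w.1 - rotate θ⁻¹ w.2 :=
    (measurable_sub_rotate measurable_id).comp
      ((measurable_fst.prodMk (measurable_const (a := θ))).prodMk measurable_snd)
  have hm : Measurable fun w : E n × E n => F (w.1 - rotate θ⁻¹ w.2) ^ p :=
    (hF.comp hsub).pow_const p
  have h1 : ∫⁻ x, (∫⁻ y, F (x - rotate θ⁻¹ y) ^ p ∂τ) ≠ ⊤ := by
    rw [lintegral_lintegral_swap hm.aemeasurable]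
    have h2 : ∀ y, ∫⁻ x, F (x - rotate θ⁻¹ y) ^ p = ∫⁻ x, F x ^ p := fun y =>
      lintegral_sub_right_eq_self (fun x => F x ^ p) _
    simp_rw [h2, lintegral_const]
    exact ENNReal.mul_ne_top hFp (measure_ne_top _ _)
  have h3 := ae_lt_top' hm.lintegral_prod_right'.aemeasurable h1
  filter_upwards [h3] with x hx
  have hle : ∀ t : ℝ≥0∞, t ≤ 1 + t ^ p := fun t => by
    rcases le_total t 1 with ht | ht
    · exact ht.trans le_self_add
    · calc t = t ^ (1 : ℝ) := (ENNReal.rpow_one t).symm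
        _ ≤ t ^ p := ENNReal.rpow_le_rpow_of_exponent_le ht hp
        _ ≤ _ := le_add_self
  calc ∫⁻ y, F (x - rotate θ⁻¹ y) ∂τ ≤ ∫⁻ y, (1 + F (x - rotate θ⁻¹ y) ^ p) ∂τ :=
        lintegral_mono fun y => hle _
    _ = τ univ + ∫⁻ y, F (x - rotate θ⁻¹ y) ^ p ∂τ := by
        rw [lintegral_add_left measurable_const, lintegral_one]
    _ < ⊤ := ENNReal.add_lt_top.mpr ⟨measure_lt_top _ _, hx⟩

end SurfaceBound

end

theorem theorem3 (n k : ℕ) (hn : 2 ≤ n) (hk : 1 ≤ k) (hkn : k ≤ n - 1)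
    (S : Set (E n)) (hS : IsSmoothSurface k S)
    (a : E n → ℂ) (ha : IsSmoothDensity S a) :
    ∃ C : ℝ≥0, ∀ f : E n → ℂ,
      MemLp f (ENNReal.ofReal ((2 * n - k : ℝ) / n)) volume →
      (∀ θ : SO n, ∀ᵐ x : E n,
        Integrable (fun y => f (x - rotate θ⁻¹ y) * a y) (surfaceMeasure k S)) ∧
      MemLp (fun z : E n × SO n => rotatedConv k S a f z.1 z.2)
        (ENNReal.ofReal ((2 * n - k : ℝ) / (n - k))) (volume.prod (rotationMeasure n)) ∧
      eLpNorm (fun z : E n × SO n => rotatedConv k S a f z.1 z.2)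
          (ENNReal.ofReal ((2 * n - k : ℝ) / (n - k))) (volume.prod (rotationMeasure n)) ≤
        C * eLpNorm f (ENNReal.ofReal ((2 * n - k : ℝ) / n)) volume := by
  have hkn' : k < n := by omega
  have hkr : (1 : ℝ) ≤ k := by exact_mod_cast hk
  have hknr : (k : ℝ) < n := by exact_mod_cast hkn'
  set p : ℝ := (2 * n - k : ℝ) / n with hp
  set q : ℝ := (2 * n - k : ℝ) / (n - k) with hq
  have hp1 : 1 < p := by rw [hp, one_lt_div (by linarith)]; linarith
  have hpq : p.HolderConjugate q := by
    refine Real.holderConjugate_iff.mpr ⟨hp1, ?_⟩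
    rw [hp, hq, inv_div, inv_div, ← add_div, div_eq_one_iff_eq (by linarith)]
    ring
  obtain ⟨hac, K, hK, hKS, haK⟩ := ha
  have hKm : MeasurableSet K := hK.isClosed.measurableSet
  obtain ⟨ν, hν, hle, C, hC⟩ :=
    hS.exists_dominating_measure_of_isCompact hk hkn' hp hpq hK hKS
  have hacK : ContinuousOn a K := hac.continuousOn.mono hKS
  obtain ⟨A, hA⟩ := hK.exists_bound_of_continuousOn hacK
  set τ := (Measure.euclideanHausdorffMeasure k : Measure (E n)).restrict K with hτ
  have hτfin : IsFiniteMeasure τ := isFiniteMeasure_of_le ν hle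
  have haτ : AEStronglyMeasurable a τ := hacK.aestronglyMeasurable hKm
  have hAτ : ∀ᵐ y ∂τ, ‖a y‖ ≤ A := by
    filter_upwards [ae_restrict_mem hKm] with y hy using hA y hy
  refine ⟨A.toNNReal * C, fun f hf => ?_⟩
  obtain ⟨f', hf'm, hff'⟩ := hf.1
  have hf'm : Measurable f' := hf'm.measurable
  have hf' : MemLp f' (ENNReal.ofReal p) volume := (memLp_congr_ae hff').mp hf
  -- the convolution only involves the values of the density on its compact support
  have hconv : ∀ x θ, rotatedConv k S a f x θ = ∫ y, f (x - rotate θ⁻¹ y) * a y ∂τ := fun x θ =>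
    setIntegral_eq_of_subset_of_forall_sdiff_eq_zero hS.measurableSet hKS
      fun y hy => by rw [haK y hy, mul_zero]
  have hconv' : (fun z : E n × SO n => rotatedConv k S a f z.1 z.2) =ᵐ[rigidMeasure n]
      fun z => ∫ y, f' (z.1 - rotate z.2⁻¹ y) * a y ∂τ := by
    filter_upwards [ae_ae_sub_rotate (τ := τ) measurable_id hff'] with z hz
    rw [hconv]
    refine integral_congr_ae ?_
    filter_upwards [hz] with y hy
    simp only [id] at hy
    rw [hy]
  have hbound : eLpNorm (fun z : E n × SO n => rotatedConv k S a f z.1 z.2)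
      (ENNReal.ofReal q) (rigidMeasure n) ≤
      (A.toNNReal * C : ℝ≥0) * eLpNorm f (ENNReal.ofReal p) volume := by
    rw [eLpNorm_congr_ae hconv', eLpNorm_congr_ae hff', ENNReal.coe_mul, mul_assoc]
    refine (eLpNorm_le_nnreal_smul_eLpNorm_of_ae_le_mul' (c := A.toNNReal)
      (g := fun z : E n × SO n => ∫⁻ y, ‖f' (z.1 - rotate z.2⁻¹ y)‖ₑ ∂ν)
      (Filter.Eventually.of_forall fun z => ?_) _).trans ?_
    · rw [enorm_eq_self]
      calc _ ≤ ∫⁻ y, ‖f' (z.1 - rotate z.2⁻¹ y) * a y‖ₑ ∂τ := enorm_integral_le_lintegral_enorm _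
        _ ≤ ∫⁻ y, A.toNNReal * ‖f' (z.1 - rotate z.2⁻¹ y)‖ₑ ∂τ := by
            refine lintegral_mono_ae ?_
            filter_upwards [hAτ] with y hy
            rw [enorm_mul, mul_comm]
            refine mul_le_mul' ?_ le_rfl
            rw [← ofReal_norm]
            exact ENNReal.ofReal_le_ofReal hy
        _ ≤ ∫⁻ y, A.toNNReal * ‖f' (z.1 - rotate z.2⁻¹ y)‖ₑ ∂ν := lintegral_mono' hle le_rfl
        _ = _ := lintegral_const_mul' _ _ ENNReal.coe_ne_top
    · exact mul_le_mul' le_rfl (hC f' hf'm hf')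
  refine ⟨fun θ => ?_, ⟨?_, hbound.trans_lt ?_⟩, hbound⟩
  · have hfin : ∫⁻ y, ‖f' y‖ₑ ^ p ≠ ⊤ := by
      have h1 := lintegral_rpow_enorm_lt_top_of_eLpNorm_lt_top (by simp; linarith)
        ENNReal.ofReal_ne_top hf'.2
      rw [ENNReal.toReal_ofReal (by linarith)] at h1
      exact h1.ne
    filter_upwards [ae_lintegral_sub_rotate_lt_top (τ := τ) hp1.le hf'm.enorm hfin θ,
      ae_ae_sub_rotate_right (τ := τ) measurable_id hff' θ] with x hx1 hx2
    have h1 : Integrable (fun y => f' (x - rotate θ⁻¹ y)) τ := by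
      have h2 : Continuous fun y => x - rotate θ⁻¹ y :=
        continuous_const.sub (rotateₗᵢ θ⁻¹).continuous
      exact ⟨(hf'm.comp h2.measurable).aestronglyMeasurable, hx1⟩
    have h3 : IntegrableOn (fun y => f (x - rotate θ⁻¹ y) * a y) K
        (Measure.euclideanHausdorffMeasure k) := by
      refine (h1.mul_bdd haτ hAτ).congr ?_
      filter_upwards [hx2] with y hy
      simp only [id] at hy
      rw [hy]
    exact h3.of_forall_sdiff_eq_zero hS.measurableSet fun y hy => by rw [haK y hy, mul_zero]
  · refine AEStronglyMeasurable.congr ?_ hconv'.symm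
    have h1 : AEStronglyMeasurable (fun w : (E n × SO n) × E n =>
        f' (w.1.1 - rotate w.1.2⁻¹ w.2) * a w.2) ((rigidMeasure n).prod τ) :=
      (hf'm.comp (measurable_sub_rotate measurable_id)).aestronglyMeasurable.mul haτ.comp_snd
    exact h1.integral_prod_right'
  · exact ENNReal.mul_lt_top ENNReal.coe_lt_top hf.2
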